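/- **Setting.** A tree $G$ on the vertex set $\{1,\dots,n\}$ (in particular, $G$ may be a line graph, i.e. a path) and numbers $T\ge 0$, $K\ge 1$, $f\ge 1$ are given. The vertices are the contexts. For every context $c$ and every arm $i\in\{1,\dots,K\}$ there is an unknown distribution $\nu_i^c$ on $[0,1]$ with mean $\mu_i^c$. There is an unknown labelling $y$ of the vertices such that $y(c)=y(c')$ implies $\nu_i^c=\nu_i^{c'}$ for all arms $i$, and at most $f$ edges $uv$ of $G$ are cut edges, i.e. satisfy $y(u)\ne y(v)$. In each round $t=1,\dots,T$ a context $s_t$ is revealed, a bandit algorithm plays an arm $I_t$, and it observes only the reward of this arm, which is drawn from $\nu_{I_t}^{s_t}$ independently of the past. The contexts are supplied by an arbitrary adversary, and $s_t$ may depend on the arms and observed rewards of the earlier rounds. The algorithm knows $G,K,T,f$, but neither $y$ nor the distributions. Its pseudo-regret is $$R_T=\mathbb E\Big[\sum_{t=1}^T\big(\max_{1\le i\le K}\mu_i^{s_t}-\mu_{I_t}^{s_t}\big)\Big].$$ **Theorem.** There is an efficient bandit algorithm with $R_T=\tilde O(T^{2/3}K^{1/3}f^{1/3})$. Precisely: there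 are a single randomized program (for a real RAM with unit cost, which can draw uniform random numbers in $[0,1]$) and constants $C,p$ such that, for all $n,K,T,f,G$ as above, the program makes at most $C\,(n+K+T)^p$ steps in total, whatever the contexts, rewards and random numbers are, and $$R_T\le C\,T^{2/3}K^{1/3}f^{1/3}\,\big(\log(n+T+2)\big)^p$$ for all $y$, all $\nu_i^c$ and every adversary as above. -/

import Mathlib

open MeasureTheory

namespace GraphBandit

/-! ### The machine model: a randomized real RAM with unit cost

Programs work on natural-number cells and real cells. Cells are organised in two-dimensional arrays:
`a` is the (constant) name of an array, and row and column may be computed. There is no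
multiplication of natural numbers, so their bit length grows by a bounded amount per step. Real numbers
admit the field operations and comparisons, and a fresh uniform random number in `[0,1]` may be drawn.
All loops are bounded, so that every program terminates. -/

/-- Expressions with a value in the natural numbers. -/
inductive NatExpr : Type
  | lit (k : ℕ)
  | get (a : ℕ) (row col : NatExpr)
  | add (e₁ e₂ : NatExpr)
  | sub (e₁ e₂ : NatExpr)
  | div (e₁ e₂ : NatExpr)

/-- Expressions with a value in the real numbers. -/
inductive RealExpr : Type
  | get (a : ℕ) (row col : NatExpr)
  | cast (e : NatExpr)
  | add (e₁ e₂ : RealExpr)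
  | sub (e₁ e₂ : RealExpr)
  | mul (e₁ e₂ : RealExpr)
  | div (e₁ e₂ : RealExpr)

/-- Tests. -/
inductive Test : Type
  | natLt (e₁ e₂ : NatExpr)
  | realLt (e₁ e₂ : RealExpr)
  | neg (b : Test)
  | conj (b₁ b₂ : Test)

/-- Programs. -/
inductive Cmd : Type
  | skip
  | setNat (a : ℕ) (row col : NatExpr) (e : NatExpr)
  | setReal (a : ℕ) (row col : NatExpr) (e : RealExpr)
  | draw (a : ℕ) (row col : NatExpr)
  | seq (c₁ c₂ : Cmd)
  | ite (b : Test) (c₁ c₂ : Cmd)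
  | loop (x : ℕ) (bound : NatExpr) (body : Cmd)

/-- A state of the machine: the two memories, the random numbers that have not been read yet, and
the number of steps made so far (which programs cannot read). -/
structure State : Type where
  nat : ℕ → ℕ → ℕ → ℕ
  real : ℕ → ℕ → ℕ → ℝ
  seed : ℕ → unitInterval
  steps : ℕ

/-- Write the natural number `v` into cell `(row, col)` of array `a`. -/
def State.writeNat (s : State) (a row col v : ℕ) : State :=
  { s with nat := fun a' r' c' => if a' = a ∧ r' = row ∧ c' = col then v else s.nat a' r' c' }

/-- Write the real number `v` into cell `(row, col)` of array `a`. -/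
noncomputable def State.writeReal (s : State) (a row col : ℕ) (v : ℝ) : State :=
  { s with real := fun a' r' c' => if a' = a ∧ r' = row ∧ c' = col then v else s.real a' r' c' }

/-- Count one step. -/
def State.tick (s : State) : State := { s with steps := s.steps + 1 }

/-- The value of a natural-number expression (`sub` is truncated, `div` rounds down). -/
def NatExpr.eval (s : State) : NatExpr → ℕ
  | .lit k => k
  | .get a row col => s.nat a (row.eval s) (col.eval s)
  | .add e₁ e₂ => e₁.eval s + e₂.eval s
  | .sub e₁ e₂ => e₁.eval s - e₂.eval s
  | .div e₁ e₂ => e₁.eval s / e₂.eval s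

/-- The value of a real expression. -/
noncomputable def RealExpr.eval (s : State) : RealExpr → ℝ
  | .get a row col => s.real a (row.eval s) (col.eval s)
  | .cast e => (e.eval s : ℝ)
  | .add e₁ e₂ => e₁.eval s + e₂.eval s
  | .sub e₁ e₂ => e₁.eval s - e₂.eval s
  | .mul e₁ e₂ => e₁.eval s * e₂.eval s
  | .div e₁ e₂ => e₁.eval s / e₂.eval s

/-- The truth of a test. -/
def Test.holds (s : State) : Test → Prop
  | .natLt e₁ e₂ => e₁.eval s < e₂.eval s
  | .realLt e₁ e₂ => e₁.eval s < e₂.eval s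
  | .neg b => ¬ b.holds s
  | .conj b₁ b₂ => b₁.holds s ∧ b₂.holds s

/-- `iterate step k s` applies `step 0`, `step 1`, …, `step (k - 1)` to `s`, in this order. -/
def iterate (step : ℕ → State → State) : ℕ → State → State
  | 0, s => s
  | k + 1, s => step k (iterate step k s)

open Classical in
/-- Execution of a program. Every assignment, draw, `skip`, test and loop header costs one step, and
so does the start of every iteration of a loop. (The size of expressions is bounded by the program,
so charging for their operations one by one changes the count by a constant factor only.)
`loop x bound body` evaluates `bound` once, and runs `body` for `x = 0, …, bound - 1`, where `x`
stands for cell `(0, 0)` of array `x`. -/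
noncomputable def Cmd.exec : Cmd → State → State
  | .skip, s => s.tick
  | .setNat a row col e, s => (s.writeNat a (row.eval s) (col.eval s) (e.eval s)).tick
  | .setReal a row col e, s => (s.writeReal a (row.eval s) (col.eval s) (e.eval s)).tick
  | .draw a row col, s =>
      { s.writeReal a (row.eval s) (col.eval s) (s.seed 0 : ℝ) with
        seed := fun k => s.seed (k + 1)
        steps := s.steps + 1 }
  | .seq c₁ c₂, s => c₂.exec (c₁.exec s)
  | .ite b c₁ c₂, s => if b.holds s then c₁.exec s.tick else c₂.exec s.tick
  | .loop x bound body, s =>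
      iterate (fun i s' => body.exec (s'.tick.writeNat x 0 0 i)) (bound.eval s) s.tick

/-! ### Bandit algorithms with graph-based contexts -/

/-- A bandit algorithm: `prepare` is run once, before the first round. In every round, `choose` is
run after the context has been revealed, and `update` after the reward has been revealed. -/
structure Algorithm : Type where
  prepare : Cmd
  choose : Cmd
  update : Cmd

open Classical in
/-- The initial state, with the input of the algorithm: cell `(0, 0)` of the arrays `0, 1, 2, 3` holds
the number `n` of vertices, the number `K` of arms, the number `T` of rounds and the bound `f` on the
cutsize; array `4` holds the adjacency matrix of the graph. Every other cell holds `0`. -/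
noncomputable def initialState {n : ℕ} (G : SimpleGraph (Fin n)) (K T f : ℕ)
    (ω : ℕ → unitInterval) : State where
  nat := fun a i j =>
    if a = 4 then (if ∃ u v : Fin n, (u : ℕ) = i ∧ (v : ℕ) = j ∧ G.Adj u v then 1 else 0)
    else if i = 0 ∧ j = 0 then
      (if a = 0 then n else if a = 1 then K else if a = 2 then T else if a = 3 then f else 0)
    else 0
  real := fun _ _ _ => 0
  seed := ω
  steps := 0

/-- An adaptive adversary that supplies the contexts: the context of round `t` may depend on the arms
and the observed rewards of all earlier rounds. (A fixed sequence of contexts is the special case in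
which it depends on `t` only.) -/
abbrev Adversary (n K : ℕ) : Type := (t : ℕ) → (Fin t → Fin K × unitInterval) → Fin n

/-- The state after the context `c` was revealed and an arm was chosen: the context is handed over in
cell `(0, 0)` of the natural-number array `5`. -/
noncomputable def Algorithm.chooseState (A : Algorithm) {n : ℕ} (s : State) (c : Fin n) : State :=
  A.choose.exec (s.writeNat 5 0 0 c)

/-- The arm chosen: the algorithm leaves it, modulo `K`, in cell `(0, 0)` of the natural-number
array `6`. -/
def chosenArm (K : ℕ) [NeZero K] (s : State) : Fin K := Fin.ofNat K (s.nat 6 0 0)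

/-- The state of the machine and the history (arms and observed rewards) after `t` rounds, where
`X t c i` is the reward that arm `i` has for context `c` in round `t`, and `ω` is the stream of random
numbers of the machine. Only the reward of the chosen arm for the current context is revealed: it is
handed over in cell `(0, 0)` of the real array `0`. -/
noncomputable def Algorithm.play (A : Algorithm) {n K : ℕ} [NeZero K] (G : SimpleGraph (Fin n))
    (T f : ℕ) (adv : Adversary n K) (X : ℕ → Fin n → Fin K → unitInterval)
    (ω : ℕ → unitInterval) : (t : ℕ) → State × (Fin t → Fin K × unitInterval)
  | 0 => (A.prepare.exec (initialState G K T f ω), Fin.elim0)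
  | t + 1 =>
      let p := A.play G T f adv X ω t
      let c := adv t p.2
      let s := A.chooseState p.1 c
      let i := chosenArm K s
      let r := X t c i
      (A.update.exec (s.writeReal 0 0 0 (r : ℝ)), Fin.snoc p.2 (i, r))

/-- The context of round `t` (rounds are numbered from `0`). -/
noncomputable def Algorithm.contextAt (A : Algorithm) {n K : ℕ} [NeZero K] (G : SimpleGraph (Fin n))
    (T f : ℕ) (adv : Adversary n K) (X : ℕ → Fin n → Fin K → unitInterval)
    (ω : ℕ → unitInterval) (t : ℕ) : Fin n :=
  adv t (A.play G T f adv X ω t).2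

/-- The arm played in round `t`. -/
noncomputable def Algorithm.armAt (A : Algorithm) {n K : ℕ} [NeZero K] (G : SimpleGraph (Fin n))
    (T f : ℕ) (adv : Adversary n K) (X : ℕ → Fin n → Fin K → unitInterval)
    (ω : ℕ → unitInterval) (t : ℕ) : Fin K :=
  chosenArm K (A.chooseState (A.play G T f adv X ω t).1 (A.contextAt G T f adv X ω t))

/-- The total number of steps of the preparation and of all `T` rounds. -/
noncomputable def Algorithm.runningTime (A : Algorithm) {n K : ℕ} [NeZero K]
    (G : SimpleGraph (Fin n)) (T f : ℕ) (adv : Adversary n K)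
    (X : ℕ → Fin n → Fin K → unitInterval) (ω : ℕ → unitInterval) : ℕ :=
  (A.play G T f adv X ω T).1.steps

/-- The mean reward of arm `i` for context `c`. -/
noncomputable def meanReward {n K : ℕ} (ν : Fin n → Fin K → ProbabilityMeasure unitInterval)
    (c : Fin n) (i : Fin K) : ℝ :=
  ∫ r, (r : ℝ) ∂(ν c i : Measure unitInterval)

/-- The sum over the `T` rounds of the mean reward of the best arm for the current context minus the
mean reward of the arm that is played. -/
noncomputable def Algorithm.regret (A : Algorithm) {n K : ℕ} [NeZero K] (G : SimpleGraph (Fin n))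
    (T f : ℕ) (adv : Adversary n K) (ν : Fin n → Fin K → ProbabilityMeasure unitInterval)
    (X : ℕ → Fin n → Fin K → unitInterval) (ω : ℕ → unitInterval) : ℝ :=
  ∑ t ∈ Finset.range T, ((⨆ i, meanReward ν (A.contextAt G T f adv X ω t) i) -
    meanReward ν (A.contextAt G T f adv X ω t) (A.armAt G T f adv X ω t))

/-- The law of the rewards and of the random numbers of the machine: all are independent, `X t c i` is
distributed as `ν c i`, and the random numbers are uniform on `[0,1]`. -/
noncomputable def law {n K : ℕ} (ν : Fin n → Fin K → ProbabilityMeasure unitInterval) :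
    Measure ((ℕ → Fin n → Fin K → unitInterval) × (ℕ → unitInterval)) :=
  (Measure.infinitePi fun _ : ℕ => Measure.pi fun c : Fin n => Measure.pi fun i : Fin K =>
      (ν c i : Measure unitInterval)).prod
    (Measure.infinitePi fun _ : ℕ => (volume : Measure unitInterval))

/-- The cutsize: the number of edges whose endpoints have different labels. -/
noncomputable def cutsize {n : ℕ} {L : Type*} (G : SimpleGraph (Fin n)) (y : Fin n → L) : ℕ :=
  {e : Sym2 (Fin n) | ∃ u v : Fin n, e = s(u, v) ∧ G.Adj u v ∧ y u ≠ y v}.ncard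

end GraphBandit

/-! The program is exponential weights with importance-weighted loss estimates, run over all `K ^ n`
maps from vertices to arms. The prior weight of a labelling is `α ^ c`, where `c` is the number of
edges of a spanning tree (found by graph search) that it cuts, and `α = 1 / (n * K)`.

Regret. A best policy can be chosen constant on the classes of `y`, so it cuts at most `f` tree
edges and has prior weight at least `α ^ f` (`pow_cutsize_le_treeWeight`). All prior weights
together sum to `K * (1 + (K - 1) * α) ^ (n - 1) ≤ e * K` (`sum_treeWeight`). Hence the logarithm of
the relative prior weight costs only `log K + 1 + f * log (n * K)` (`log_sum_div_le`). The usual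
potential argument bounds the regret by this cost divided by `η`, plus `η * T * K` (`hedge_regret`).
With `η` about `√(f / (T * K))` this is `√(T * K * f)` up to logarithms. That is below the claimed
rate when `K * f ≤ T`; otherwise the trivial bound `T` is below it.

Efficiency. The weight of a labelling is always the prior times a product of vertex factors `ψ v (x
v)`, and an update changes a single entry of `ψ` (`labelWeight_hedgeStep`). So `n * K` numbers
represent all `K ^ n` weights, and the law of the arm at the current context is a marginal of a tree
model, computable by eliminating leaves (`sum_treeWeight_mul_prod`, `treeMarginal_eq_marginal`). The
machine has no exponential function, so `1 / (1 + X)` replaces `exp (-X)`; the potential argument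
survives because `1 - 1 / (1 + X) ≥ X - X ^ 2` and `log (1 + X) ≤ X` (`potential_hedgeStep_le`).

Connection. `play_spec` shows that the memory of the machine follows the idealised process
`hedgeRun`. Expectations are taken by resampling the rewards and the random number of round `t`
(`measurePreserving_resample`): the past, hence also the adversary's context, is unaffected, and the
fresh round is integrated explicitly (`integral_roundGap`). -/

namespace GraphBandit

/-! ### Frames, running time and randomness of programs -/

/-- The natural-number arrays that a program may write to. -/
def Cmd.natWrites : Cmd → List ℕ
  | .setNat a _ _ _ => [a]
  | .seq c₁ c₂ => c₁.natWrites ++ c₂.natWrites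
  | .ite _ c₁ c₂ => c₁.natWrites ++ c₂.natWrites
  | .loop x _ body => x :: body.natWrites
  | _ => []

/-- The real arrays that a program may write to. -/
def Cmd.realWrites : Cmd → List ℕ
  | .setReal a _ _ _ => [a]
  | .draw a _ _ => [a]
  | .seq c₁ c₂ => c₁.realWrites ++ c₂.realWrites
  | .ite _ c₁ c₂ => c₁.realWrites ++ c₂.realWrites
  | .loop _ _ body => body.realWrites
  | _ => []

/-- The program contains no `draw`. -/
def Cmd.DrawFree : Cmd → Prop
  | .draw _ _ _ => False
  | .seq c₁ c₂ => c₁.DrawFree ∧ c₂.DrawFree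
  | .ite _ c₁ c₂ => c₁.DrawFree ∧ c₂.DrawFree
  | .loop _ _ body => body.DrawFree
  | _ => True

/-- The expressions that bound the loops of a program. -/
def Cmd.loopBounds : Cmd → List NatExpr
  | .seq c₁ c₂ => c₁.loopBounds ++ c₂.loopBounds
  | .ite _ c₁ c₂ => c₁.loopBounds ++ c₂.loopBounds
  | .loop _ b body => b :: body.loopBounds
  | _ => []

/-- The number of commands in a program. -/
def Cmd.size : Cmd → ℕ
  | .seq c₁ c₂ => c₁.size + c₂.size
  | .ite _ c₁ c₂ => c₁.size + c₂.size + 1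
  | .loop _ _ body => body.size + 1
  | _ => 1

theorem iterate_induction {P : ℕ → State → Prop} {step : ℕ → State → State} {k : ℕ} {s : State}
    (h₀ : P 0 s) (h : ∀ i < k, ∀ s', P i s' → P (i + 1) (step i s')) : P k (iterate step k s) := by
  induction k with
  | zero => exact h₀
  | succ k ih => exact h k (by omega) _ (ih fun i hi => h i (by omega))

/-- The invariant rule for loops. -/
theorem Cmd.exec_loop {P : ℕ → State → Prop} {x : ℕ} {b : NatExpr} {body : Cmd} {s : State} {k : ℕ}
    (hk : b.eval s = k) (h₀ : P 0 s.tick)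
    (h : ∀ i < k, ∀ s', P i s' → P (i + 1) (body.exec (s'.tick.writeNat x 0 0 i))) :
    P k ((Cmd.loop x b body).exec s) := by
  subst hk
  exact iterate_induction h₀ h

/-- Frame rule. Array names are constants, so the arrays that may change can be read off the syntax.
Together with its analogue for real arrays it carries facts across all subprograms below. -/
theorem Cmd.exec_nat_of_notMem {a : ℕ} (c : Cmd) (ha : a ∉ c.natWrites) (s : State) :
    (c.exec s).nat a = s.nat a := by
  induction c generalizing s with
  | skip => rfl
  | setNat a' row col e =>
    have : a ≠ a' := by simpa [natWrites] using ha
    simp [Cmd.exec, State.tick, State.writeNat, this]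
  | setReal => rfl
  | draw => rfl
  | seq c₁ c₂ h₁ h₂ =>
    simp only [natWrites, List.mem_append, not_or] at ha
    rw [Cmd.exec, h₂ ha.2, h₁ ha.1]
  | ite b c₁ c₂ h₁ h₂ =>
    simp only [natWrites, List.mem_append, not_or] at ha
    rw [Cmd.exec]
    split_ifs
    · rw [h₁ ha.1]; rfl
    · rw [h₂ ha.2]; rfl
  | loop x b body h =>
    simp only [natWrites, List.mem_cons, not_or] at ha
    refine Cmd.exec_loop (P := fun _ s' => s'.nat a = s.nat a) rfl rfl fun i _ s' hs' => ?_
    rw [h ha.2, ← hs']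
    simp [State.tick, State.writeNat, ha.1]

theorem Cmd.exec_real_of_notMem {a : ℕ} (c : Cmd) (ha : a ∉ c.realWrites) (s : State) :
    (c.exec s).real a = s.real a := by
  induction c generalizing s with
  | skip => rfl
  | setNat => rfl
  | setReal a' row col e =>
    have : a ≠ a' := by simpa [realWrites] using ha
    simp [Cmd.exec, State.tick, State.writeReal, this]
  | draw a' row col =>
    have : a ≠ a' := by simpa [realWrites] using ha
    simp [Cmd.exec, State.writeReal, this]
  | seq c₁ c₂ h₁ h₂ =>
    simp only [realWrites, List.mem_append, not_or] at ha
    rw [Cmd.exec, h₂ ha.2, h₁ ha.1]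
  | ite b c₁ c₂ h₁ h₂ =>
    simp only [realWrites, List.mem_append, not_or] at ha
    rw [Cmd.exec]
    split_ifs
    · rw [h₁ ha.1]; rfl
    · rw [h₂ ha.2]; rfl
  | loop x b body h =>
    refine Cmd.exec_loop (P := fun _ s' => s'.real a = s.real a) rfl rfl fun i _ s' hs' => ?_
    rw [h ha, ← hs']
    rfl

/-- Replace the random numbers that have not been read yet. -/
def State.withSeed (s : State) (ω : ℕ → unitInterval) : State := { s with seed := ω }

theorem NatExpr.eval_withSeed (s : State) (ω : ℕ → unitInterval) (e : NatExpr) :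
    e.eval (s.withSeed ω) = e.eval s := by
  induction e <;> simp_all [NatExpr.eval, State.withSeed]

theorem RealExpr.eval_withSeed (s : State) (ω : ℕ → unitInterval) (e : RealExpr) :
    e.eval (s.withSeed ω) = e.eval s := by
  induction e with
  | get a row col => simp [RealExpr.eval, NatExpr.eval_withSeed]; simp [State.withSeed]
  | cast e => simp [RealExpr.eval, NatExpr.eval_withSeed]
  | _ => simp_all [RealExpr.eval]

theorem Test.holds_withSeed (s : State) (ω : ℕ → unitInterval) (b : Test) :
    b.holds (s.withSeed ω) ↔ b.holds s := by
  induction b with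
  | natLt => simp [Test.holds, NatExpr.eval_withSeed]
  | realLt => simp [Test.holds, RealExpr.eval_withSeed]
  | neg b h => simp [Test.holds, h]
  | conj b₁ b₂ h₁ h₂ => simp [Test.holds, h₁, h₂]

/-- A program that draws no random numbers does not depend on them. -/
theorem Cmd.exec_withSeed (c : Cmd) (hc : c.DrawFree) (s : State) (ω : ℕ → unitInterval) :
    c.exec (s.withSeed ω) = (c.exec s).withSeed ω := by
  induction c generalizing s with
  | skip => rfl
  | setNat a row col e => simp only [Cmd.exec, NatExpr.eval_withSeed]; rfl
  | setReal a row col e =>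
    simp only [Cmd.exec, NatExpr.eval_withSeed, RealExpr.eval_withSeed]; rfl
  | draw => exact hc.elim
  | seq c₁ c₂ h₁ h₂ => rw [Cmd.exec, h₁ hc.1, h₂ hc.2, Cmd.exec]
  | ite b c₁ c₂ h₁ h₂ =>
    rw [Cmd.exec, Cmd.exec]
    by_cases hb : b.holds s
    · rw [if_pos hb, if_pos ((Test.holds_withSeed s ω b).2 hb)]
      exact h₁ hc.1 s.tick
    · rw [if_neg hb, if_neg (mt (Test.holds_withSeed s ω b).1 hb)]
      exact h₂ hc.2 s.tick
  | loop x b body h =>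
    simp only [Cmd.exec, NatExpr.eval_withSeed]
    induction b.eval s with
    | zero => rfl
    | succ k ih =>
      rw [iterate, iterate, ih]
      exact h hc ((iterate (fun i s' => body.exec (s'.tick.writeNat x 0 0 i)) k
        s.tick).tick.writeNat x 0 0 k)

theorem Cmd.exec_seed (c : Cmd) (hc : c.DrawFree) (s : State) : (c.exec s).seed = s.seed :=
  (congrArg State.seed (c.exec_withSeed hc s s.seed) :)

/-- A program whose loops are executed at most `M` times each makes at most polynomially many steps.
The hypothesis says that the bounds of the loops are at most `M` as long as the arrays in `I` are
unchanged. -/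
theorem Cmd.exec_steps_le {I : List ℕ} {m : ℕ → ℕ → ℕ → ℕ} {M : ℕ} (c : Cmd)
    (hI : ∀ a ∈ I, a ∉ c.natWrites)
    (hb : ∀ b ∈ c.loopBounds, ∀ s : State, (∀ a ∈ I, s.nat a = m a) → b.eval s ≤ M)
    (s : State) (hs : ∀ a ∈ I, s.nat a = m a) :
    (c.exec s).steps ≤ s.steps + c.size * (M + 1) ^ c.size := by
  induction c generalizing s with
  | skip => simp [Cmd.exec, State.tick, size]
  | setNat => simp [Cmd.exec, State.tick, State.writeNat, size]
  | setReal => simp [Cmd.exec, State.tick, State.writeReal, size]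
  | draw => simp [Cmd.exec, size]
  | seq c₁ c₂ h₁ h₂ =>
    simp only [natWrites, loopBounds, List.mem_append, not_or] at hI hb
    have e₁ := h₁ (fun a ha => (hI a ha).1) (fun b hb' => hb b (.inl hb')) s hs
    have e₂ := h₂ (fun a ha => (hI a ha).2) (fun b hb' => hb b (.inr hb')) (c₁.exec s)
      fun a ha => by rw [c₁.exec_nat_of_notMem (hI a ha).1, hs a ha]
    have p₁ : (M + 1) ^ c₁.size ≤ (M + 1) ^ (c₁.size + c₂.size) :=
      Nat.pow_le_pow_right (by omega) (by omega)
    have p₂ : (M + 1) ^ c₂.size ≤ (M + 1) ^ (c₁.size + c₂.size) :=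
      Nat.pow_le_pow_right (by omega) (by omega)
    simp only [Cmd.exec, size]
    nlinarith [Nat.mul_le_mul_left c₁.size p₁, Nat.mul_le_mul_left c₂.size p₂]
  | ite b c₁ c₂ h₁ h₂ =>
    simp only [natWrites, loopBounds, List.mem_append, not_or] at hI hb
    have e₁ := h₁ (fun a ha => (hI a ha).1) (fun b hb' => hb b (.inl hb')) s.tick hs
    have e₂ := h₂ (fun a ha => (hI a ha).2) (fun b hb' => hb b (.inr hb')) s.tick hs
    have p₁ : (M + 1) ^ c₁.size ≤ (M + 1) ^ (c₁.size + c₂.size + 1) :=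
      Nat.pow_le_pow_right (by omega) (by omega)
    have p₂ : (M + 1) ^ c₂.size ≤ (M + 1) ^ (c₁.size + c₂.size + 1) :=
      Nat.pow_le_pow_right (by omega) (by omega)
    have p₃ : 1 ≤ (M + 1) ^ (c₁.size + c₂.size + 1) := Nat.one_le_pow _ _ (by omega)
    have t : s.tick.steps = s.steps + 1 := rfl
    simp only [Cmd.exec, size]
    split_ifs <;> nlinarith [Nat.mul_le_mul_left c₁.size p₁, Nat.mul_le_mul_left c₂.size p₂]
  | loop x b body h =>
    simp only [natWrites, loopBounds, List.mem_cons, not_or] at hI hb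
    have key := Cmd.exec_loop (x := x) (b := b) (body := body) (s := s)
      (P := fun i s' => (∀ a ∈ I, s'.nat a = m a) ∧
        s'.steps ≤ s.steps + 1 + i * (1 + body.size * (M + 1) ^ body.size)) rfl
      ⟨hs, by simp [State.tick]⟩ (fun i _ s' hs' => by
        have hs₁ : ∀ a ∈ I, (s'.tick.writeNat x 0 0 i).nat a = m a := fun a ha => by
          rw [← hs'.1 a ha]
          simp [State.tick, State.writeNat, (hI a ha).1]
        refine ⟨fun a ha => ?_, ?_⟩
        · rw [body.exec_nat_of_notMem (hI a ha).2, hs₁ a ha]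
        · have := h (fun a ha => (hI a ha).2) (fun b hb' => hb b (.inr hb')) _ hs₁
          have t : (s'.tick.writeNat x 0 0 i).steps = s'.steps + 1 := rfl
          have := hs'.2
          rw [add_mul, one_mul]
          omega)
    refine key.2.trans ?_
    have hM := hb b (.inl rfl) s hs
    -- Let `z` be the size of the body. The loop header and the starts of at most `M` iterations
    -- cost at most `1 + M ≤ (M + 1) ^ (z + 1)`, the bodies at most `M * z * (M + 1) ^ z`; together
    -- this is at most `(z + 1) * (M + 1) ^ (z + 1)`.
    have p₁ : (M + 1) ^ 1 ≤ (M + 1) ^ (body.size + 1) :=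
      Nat.pow_le_pow_right (by omega) (by omega)
    have p₂ : (M + 1) ^ (body.size + 1) = (M + 1) * (M + 1) ^ body.size := by ring
    have := Nat.mul_le_mul_right (1 + body.size * (M + 1) ^ body.size) hM
    simp only [size]
    nlinarith [Nat.zero_le (body.size * (M + 1) ^ body.size)]

/-- The invariant rule for loops, with the frame conditions supplied to the induction step. -/
theorem Cmd.exec_loop_frame {P : ℕ → State → Prop} {x : ℕ} {b : NatExpr} {body : Cmd} {s : State}
    {k : ℕ} (hk : b.eval s = k) (h₀ : P 0 s.tick)
    (hx : ∀ i s', P i s' → P i (s'.tick.writeNat x 0 0 i))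
    (h : ∀ i < k, ∀ s', s'.nat x 0 0 = i →
      (∀ a, a ∉ x :: body.natWrites → s'.nat a = s.nat a) →
      (∀ a, a ∉ body.realWrites → s'.real a = s.real a) → P i s' → P (i + 1) (body.exec s')) :
    P k ((Cmd.loop x b body).exec s) := by
  refine (Cmd.exec_loop (P := fun i s' => P i s' ∧
    (∀ a, a ∉ x :: body.natWrites → s'.nat a = s.nat a) ∧
    (∀ a, a ∉ body.realWrites → s'.real a = s.real a)) hk ⟨h₀, fun _ _ => rfl, fun _ _ => rfl⟩
    fun i hi s' hs' => ?_).1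
  have f₁ : ∀ a, a ∉ x :: body.natWrites → (s'.tick.writeNat x 0 0 i).nat a = s.nat a := by
    intro a ha
    have hax : a ≠ x := fun h => ha (by simp [h])
    rw [← hs'.2.1 a ha]
    simp [State.tick, State.writeNat, hax]
  have f₂ : ∀ a, a ∉ body.realWrites → (s'.tick.writeNat x 0 0 i).real a = s.real a := hs'.2.2
  refine ⟨h i hi _ (by simp [State.writeNat]) f₁ f₂ (hx i s' hs'.1), fun a ha => ?_, fun a ha => ?_⟩
  · rw [body.exec_nat_of_notMem (fun h => ha (List.mem_cons_of_mem _ h)), f₁ a ha]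
  · rw [body.exec_real_of_notMem ha, f₂ a ha]

/-! ### The program -/

/-- Cell `(0, 0)` of a natural-number array. -/
def natCell (a : ℕ) : NatExpr := .get a (.lit 0) (.lit 0)

/-- Cell `(0, 0)` of a real array. -/
def realCell (a : ℕ) : RealExpr := .get a (.lit 0) (.lit 0)

/-- Assignment to cell `(0, 0)` of a real array. -/
def setRealCell (a : ℕ) (e : RealExpr) : Cmd := .setReal a (.lit 0) (.lit 0) e

/-- Assignment to cell `(0, 0)` of a natural-number array. -/
def setNatCell (a : ℕ) (e : NatExpr) : Cmd := .setNat a (.lit 0) (.lit 0) e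

/-- The test for equality of natural numbers. -/
def natEq (e₁ e₂ : NatExpr) : Test := .conj (.neg (.natLt e₁ e₂)) (.neg (.natLt e₂ e₁))

theorem natEq_holds (s : State) (e₁ e₂ : NatExpr) :
    (natEq e₁ e₂).holds s ↔ e₁.eval s = e₂.eval s := by
  simp only [natEq, Test.holds]
  omega

/-- Search for an edge from a visited vertex (array `7`) to a vertex that is not visited. Its
endpoints are left in arrays `10` and `11`. -/
def findEdge : Cmd :=
  .loop 13 (natCell 0) (.loop 14 (natCell 0)
    (.ite (.conj (.natLt (.lit 0) (.get 4 (natCell 13) (natCell 14)))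
        (.conj (.natLt (.lit 0) (.get 7 (.lit 0) (natCell 13)))
          (.neg (.natLt (.lit 0) (.get 7 (.lit 0) (natCell 14))))))
      (.seq (setNatCell 10 (natCell 13)) (setNatCell 11 (natCell 14))) .skip))

/-- Graph search from vertex `0`: arrays `8` and `9` list the vertices other than `0` in the order of
their discovery, and the vertices from which they were discovered. -/
def graphSearch : Cmd :=
  .seq (.setNat 7 (.lit 0) (.lit 0) (.lit 1))
    (.loop 12 (.sub (natCell 0) (.lit 1))
      (.seq findEdge
        (.seq (.setNat 8 (.lit 0) (natCell 12) (natCell 11))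
          (.seq (.setNat 9 (.lit 0) (natCell 12) (natCell 10))
            (.setNat 7 (.lit 0) (natCell 11) (.lit 1))))))

/-- All weights (real array `1`) are set to `1`. -/
def initWeights : Cmd :=
  .loop 12 (natCell 0) (.loop 13 (natCell 1)
    (.setReal 1 (natCell 12) (natCell 13) (.cast (.lit 1))))

/-- The learning rate (real array `5`) is set to the reciprocal of the square root of `T * K / f`,
rounded up. -/
def initRate : Cmd :=
  .seq (.loop 12 (.add (natCell 2) (natCell 1))
    (.ite (.realLt (.mul (.mul (.cast (natCell 12)) (.cast (natCell 12))) (.cast (natCell 3)))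
        (.mul (.cast (natCell 2)) (.cast (natCell 1))))
      (setRealCell 5 (.cast (.add (natCell 12) (.lit 1)))) .skip))
    (setRealCell 5 (.div (.cast (.lit 1)) (realCell 5)))

/-- The weight of a cut edge (real array `4`) is `1 / (n * K)`. -/
def initCut : Cmd :=
  setRealCell 4 (.div (.cast (.lit 1)) (.mul (.cast (natCell 0)) (.cast (natCell 1))))

/-- `sumRow x a b row` computes, in real array `a`, the sum of the first `K` entries of the given row
of real array `b`. -/
def sumRow (x a b : ℕ) (row : NatExpr) : Cmd :=
  .seq (setRealCell a (.cast (.lit 0)))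
    (.loop x (natCell 1) (setRealCell a (.add (realCell a) (.get b row (natCell x)))))

/-- Copy the weights to real array `2`, where only the arm in cell `12` is allowed for the current
context. -/
def clampCmd : Cmd :=
  .loop 13 (natCell 0) (.loop 14 (natCell 1)
    (.ite (.conj (natEq (natCell 13) (natCell 5)) (.neg (natEq (natCell 14) (natCell 12))))
      (.setReal 2 (natCell 13) (natCell 14) (.cast (.lit 0)))
      (.setReal 2 (natCell 13) (natCell 14) (.get 1 (natCell 13) (natCell 14)))))

/-- The index of the vertex that is eliminated next. -/
def elimIndex : NatExpr := .sub (.sub (natCell 0) (.lit 2)) (natCell 13)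

/-- The vertex that is eliminated next. -/
def elimChild : NatExpr := .get 8 (.lit 0) elimIndex

/-- The parent of the vertex that is eliminated next. -/
def elimParent : NatExpr := .get 9 (.lit 0) elimIndex

/-- Send the message from a vertex to its parent. -/
def elimStepCmd : Cmd :=
  .seq (sumRow 14 6 2 elimChild)
    (.loop 14 (natCell 1) (.setReal 2 elimParent (natCell 14)
      (.mul (.get 2 elimParent (natCell 14))
        (.add (.mul (realCell 4) (realCell 6))
          (.mul (.sub (.cast (.lit 1)) (realCell 4)) (.get 2 elimChild (natCell 14)))))))

/-- Eliminate all vertices other than `0`. -/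
def elimCmd : Cmd := .loop 13 (.sub (natCell 0) (.lit 1)) elimStepCmd

/-- Compute the unnormalised marginal distribution (real array `3`) of the arm at the current
context. -/
def marginalsCmd : Cmd :=
  .loop 12 (natCell 1)
    (.seq (.seq clampCmd elimCmd)
      (.seq (sumRow 13 6 2 (.lit 0)) (.setReal 3 (.lit 0) (natCell 12) (realCell 6))))

/-- Sample an arm from the marginal distribution. -/
def sampleCmd : Cmd :=
  .seq (.seq (.draw 8 (.lit 0) (.lit 0)) (setRealCell 9 (.cast (.lit 0))))
    (.loop 12 (natCell 1)
      (.seq (.ite (.realLt (.mul (realCell 8) (realCell 7)) (realCell 9)) .skip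
          (setNatCell 6 (natCell 12)))
        (setRealCell 9 (.add (realCell 9) (.get 3 (.lit 0) (natCell 12))))))

/-- Exponential weights (with the exponential function replaced by a rational function) over the
labellings of the vertices with arms. -/
def treeHedge : Algorithm where
  prepare := .seq graphSearch (.seq initWeights (.seq initRate initCut))
  choose := .seq (.seq marginalsCmd (sumRow 12 7 3 (.lit 0))) sampleCmd
  update := .setReal 1 (natCell 5) (natCell 6)
    (.div (.get 1 (natCell 5) (natCell 6))
      (.add (.cast (.lit 1))
        (.div (.mul (.mul (realCell 5) (.sub (.cast (.lit 1)) (realCell 0))) (realCell 7))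
          (.get 3 (.lit 0) (natCell 6)))))

/-! ### What the program computes -/

section Pure

variable {V : Type*} [DecidableEq V] {K : ℕ}

/-- Send the message from `v` to `p`. -/
def elimStep (α : ℝ) (v p : V) (B : V → Fin K → ℝ) : V → Fin K → ℝ := fun w i =>
  if w = p then B w i * (α * ∑ j, B v j + (1 - α) * B v i) else B w i

/-- Eliminate the vertices `ch (m - 1)`, …, `ch 0`, where `pa e` is the parent of `ch e`. -/
def eliminate (α : ℝ) (ch pa : ℕ → V) : ℕ → (V → Fin K → ℝ) → V → Fin K → ℝ
  | 0, B => B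
  | m + 1, B => eliminate α ch pa m (elimStep α (ch m) (pa m) B)

/-- Allow only arm `a` at `c`. -/
def clamp (ψ : V → Fin K → ℝ) (c : V) (a : Fin K) : V → Fin K → ℝ := fun v i =>
  if v = c ∧ i ≠ a then 0 else ψ v i

/-- The last `i` such that the sum of `Z` over all `j < i` is at most `u * ∑ j, Z j`. -/
noncomputable def sample [NeZero K] (Z : Fin K → ℝ) (u : ℝ) : Fin K :=
  (Finset.univ.filter fun i => ∑ j with j < i, Z j ≤ u * ∑ j, Z j).sup id

end Pure

/-- A list of distinct vertices `ch 0`, …, `ch (m - 1)` other than `r`, where each `ch e` is adjacent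
to the vertex `pa e`, which is `r` or occurs earlier in the list. -/
structure SearchOrder {V : Type*} (G : SimpleGraph V) (r : V) (ch pa : ℕ → V) (m : ℕ) : Prop where
  adj : ∀ e < m, G.Adj (pa e) (ch e)
  ne_root : ∀ e < m, ch e ≠ r
  ne_of_lt : ∀ e < m, ∀ e' < e, ch e' ≠ ch e
  parent : ∀ e < m, pa e = r ∨ ∃ e' < e, ch e' = pa e

/-! ### Correctness of the elimination program. -/

theorem sumRow_spec {x a b v k : ℕ} {row : NatExpr} {s : State} (hab : a ≠ b) (hk : s.nat 1 0 0 = k)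
    (hrow : ∀ s' : State, (∀ a', a' ≠ x → s'.nat a' = s.nat a') → row.eval s' = v) :
    ((sumRow x a b row).exec s).real a 0 0 = ∑ j ∈ Finset.range k, s.real b v j := by
  rw [sumRow, Cmd.exec]
  set s₁ := (setRealCell a (.cast (.lit 0))).exec s with hs₁
  have hn : s₁.nat = s.nat := rfl
  have hb : s₁.real b = s.real b := Cmd.exec_real_of_notMem _
    (by simp [setRealCell, Cmd.realWrites, hab.symm]) _
  refine Cmd.exec_loop_frame (P := fun i s' => s'.real a 0 0 = ∑ j ∈ Finset.range i, s.real b v j)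
    (by simpa [natCell, NatExpr.eval, hn] using hk) ?_ (fun _ _ h => h) ?_
  · simp [hs₁, setRealCell, Cmd.exec, State.tick, State.writeReal, NatExpr.eval, RealExpr.eval]
  · intro i _ s' hi hf hr h
    -- The row expression is evaluated anew in each iteration; `hrow` ensures that it does not
    -- depend on the loop counter.
    have hv : row.eval s' = v := hrow s' fun a' ha' => by
      rw [hf a' (by simp [setRealCell, Cmd.natWrites, ha']), hn]
    have hb' : s'.real b = s.real b := by
      rw [hr b (by simp [setRealCell, Cmd.realWrites, hab.symm]), hb]
    simp [setRealCell, realCell, natCell, Cmd.exec, State.tick, State.writeReal, NatExpr.eval,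
      RealExpr.eval, hv, hi, h, hb', Finset.sum_range_succ]

theorem clampCmd_spec {n K : ℕ} {s : State} (hn : s.nat 0 0 0 = n) (hK : s.nat 1 0 0 = K)
    {ψ : Fin n → Fin K → ℝ} (hψ : ∀ (v : Fin n) (i : Fin K), s.real 1 v i = ψ v i)
    {c : Fin n} (hc : s.nat 5 0 0 = c) {a : Fin K} (ha : s.nat 12 0 0 = a) (v : Fin n)
    (i : Fin K) : (clampCmd.exec s).real 2 v i = clamp ψ c a v i := by
  refine Cmd.exec_loop_frame (P := fun k s' => ∀ (v : Fin n) (i : Fin K), (v : ℕ) < k →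
    s'.real 2 v i = clamp ψ c a v i) (by simpa [natCell, NatExpr.eval] using hn) (by simp)
    (fun _ _ h => h) ?_ v i v.2
  intro k hk s₁ hk₁ hf hr h v i hv
  simp only [Cmd.natWrites, Cmd.realWrites, List.mem_cons, not_or] at hf hr
  -- The invariant follows the lexicographic order of the cells: rows before `k` are finished, and
  -- row `k` up to column `l`.
  have P := Cmd.exec_loop_frame (x := 14) (b := natCell 1) (s := s₁) (k := K)
    (body := (.ite (.conj (natEq (natCell 13) (natCell 5)) (.neg (natEq (natCell 14) (natCell 12))))
      (.setReal 2 (natCell 13) (natCell 14) (.cast (.lit 0)))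
      (.setReal 2 (natCell 13) (natCell 14) (.get 1 (natCell 13) (natCell 14)))))
    (P := fun l s' => ∀ (v : Fin n) (i : Fin K), ((v : ℕ) < k ∨ (v : ℕ) = k ∧ (i : ℕ) < l) →
      s'.real 2 v i = clamp ψ c a v i) (by simp [natCell, NatExpr.eval, hf 1, hK])
    (by intro v i hv; exact h v i (by omega))
    (fun _ _ h => h) ?_ v i (by omega)
  · exact P
  intro l hl s₂ hl₂ hf₂ hr₂ h₂ v i hv
  simp only [Cmd.natWrites, Cmd.realWrites, List.mem_cons, not_or] at hf₂ hr₂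
  have e13 : s₂.nat 13 0 0 = k := by simp [hf₂ 13, hk₁]
  have e5 : s₂.nat 5 0 0 = c := by simp [hf₂ 5, hf 5, hc]
  have e12 : s₂.nat 12 0 0 = a := by simp [hf₂ 12, hf 12, ha]
  have e1 : s₂.real 1 = s.real 1 := by simp [hr₂ 1, hr 1]
  have test : Test.holds s₂ (.conj (natEq (natCell 13) (natCell 5))
      (.neg (natEq (natCell 14) (natCell 12)))) ↔ k = c ∧ l ≠ a := by
    simp [Test.holds, natEq_holds, natCell, NatExpr.eval, e13, e5, hl₂, e12]
  have value : ((Cmd.ite (.conj (natEq (natCell 13) (natCell 5))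
      (.neg (natEq (natCell 14) (natCell 12))))
      (.setReal 2 (natCell 13) (natCell 14) (.cast (.lit 0)))
      (.setReal 2 (natCell 13) (natCell 14) (.get 1 (natCell 13) (natCell 14)))).exec s₂).real 2 v i =
      if (v : ℕ) = k ∧ (i : ℕ) = l then if k = c ∧ l ≠ a then 0 else s.real 1 k l
        else s₂.real 2 v i := by
    rw [Cmd.exec, ← e1]
    by_cases hc : k = c ∧ l ≠ a
    · rw [if_pos (test.2 hc), if_pos hc]
      simp [Cmd.exec, State.writeReal, State.tick, natCell, NatExpr.eval, RealExpr.eval, e13, hl₂]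
    · rw [if_neg (mt test.1 hc), if_neg hc]
      simp [Cmd.exec, State.writeReal, State.tick, natCell, NatExpr.eval, RealExpr.eval, e13, hl₂]
  rw [value]
  by_cases hvi : (v : ℕ) = k ∧ (i : ℕ) = l
  · obtain ⟨rfl, rfl⟩ := hvi
    simp [clamp, Fin.ext_iff, hψ]
  · rw [if_neg hvi, h₂ v i (by omega)]

theorem elimStepCmd_spec {n K : ℕ} {s : State} (hK : s.nat 1 0 0 = K)
    {B : Fin n → Fin K → ℝ} (hB : ∀ (v : Fin n) (i : Fin K), s.real 2 v i = B v i)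
    {α : ℝ} (hα : s.real 4 0 0 = α) {e : ℕ} (he : elimIndex.eval s = e) {v p : Fin n}
    (hv : s.nat 8 0 e = v) (hp : s.nat 9 0 e = p) (w : Fin n) (i : Fin K) :
    (elimStepCmd.exec s).real 2 w i = elimStep α v p B w i := by
  have index : ∀ s' : State, (∀ a, a ≠ 14 → s'.nat a = s.nat a) → elimIndex.eval s' = e := by
    intro s' h
    rw [← he]
    simp [elimIndex, natCell, NatExpr.eval, h 0, h 13]
  have child : ∀ s' : State, (∀ a, a ≠ 14 → s'.nat a = s.nat a) → elimChild.eval s' = v := by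
    intro s' h
    simp [elimChild, NatExpr.eval, index s' h, h 8, hv]
  have parent : ∀ s' : State, (∀ a, a ≠ 14 → s'.nat a = s.nat a) → elimParent.eval s' = p := by
    intro s' h
    simp [elimParent, NatExpr.eval, index s' h, h 9, hp]
  rw [elimStepCmd, Cmd.exec]
  have hS := sumRow_spec (x := 14) (a := 6) (b := 2) (by decide) hK child
  have hf : ∀ a, a ≠ 14 → ((sumRow 14 6 2 elimChild).exec s).nat a = s.nat a := fun a ha =>
    Cmd.exec_nat_of_notMem _ (by simp [sumRow, setRealCell, Cmd.natWrites, ha]) _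
  have hr : ∀ a, a ≠ 6 → ((sumRow 14 6 2 elimChild).exec s).real a = s.real a := fun a ha =>
    Cmd.exec_real_of_notMem _ (by simp [sumRow, setRealCell, Cmd.realWrites, ha]) _
  set s₁ := (sumRow 14 6 2 elimChild).exec s
  rw [Finset.sum_range, Finset.sum_congr rfl fun j _ => hB v j] at hS
  -- The update is done in place. This is harmless, since the row sum has been saved beforehand and
  -- iteration `l` reads column `l` only, which no earlier iteration has touched.
  have h := Cmd.exec_loop_frame (x := 14) (b := natCell 1) (s := s₁) (k := K)
    (body := .setReal 2 elimParent (natCell 14)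
      (.mul (.get 2 elimParent (natCell 14))
        (.add (.mul (realCell 4) (realCell 6))
          (.mul (.sub (.cast (.lit 1)) (realCell 4)) (.get 2 elimChild (natCell 14))))))
    (P := fun l s' => ∀ (w : Fin n) (i : Fin K),
      s'.real 2 w i = if (i : ℕ) < l then elimStep α v p B w i else B w i)
    (by simp [natCell, NatExpr.eval, hf 1, hK])
    (by intro w i; simp [State.tick, hr 2, hB]) (fun _ _ h => h) ?_ w i
  · rw [h, if_pos i.2]
  intro l hl s₂ hl₂ hf₂ hr₂ h₂ w i
  simp only [Cmd.natWrites, Cmd.realWrites, List.mem_cons, not_or] at hf₂ hr₂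
  have hf' : ∀ a, a ≠ 14 → s₂.nat a = s.nat a := fun a ha => by
    rw [hf₂ a (by simp [ha]), hf a ha]
  have e4 : s₂.real 4 0 0 = α := by simp [hr₂ 4, hr 4, hα]
  have e6 : s₂.real 6 0 0 = ∑ j, B v j := by simp [hr₂ 6, hS]
  have eB : ∀ w : Fin n, s₂.real 2 w l = B w ⟨l, hl⟩ := fun w => by
    simpa using h₂ w ⟨l, hl⟩
  simp only [Cmd.exec, natCell, realCell, State.tick, State.writeReal, NatExpr.eval, RealExpr.eval,
    parent s₂ hf', child s₂ hf', hl₂, e4, e6, eB, Nat.cast_one, true_and, Fin.val_inj]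
  by_cases hi : (i : ℕ) = l
  · have hi' : i = ⟨l, hl⟩ := Fin.ext hi
    subst hi'
    simp only [and_true, elimStep, eB]
    by_cases hw : w = p <;> simp [hw]
  · rw [if_neg (fun h => hi h.2), h₂ w i]
    have : (i : ℕ) < l ↔ (i : ℕ) < l + 1 := by omega
    simp only [this]

theorem elimCmd_spec {n K : ℕ} {s : State} (hn : s.nat 0 0 0 = n) (hK : s.nat 1 0 0 = K)
    {B : Fin n → Fin K → ℝ} (hB : ∀ (v : Fin n) (i : Fin K), s.real 2 v i = B v i)
    {α : ℝ} (hα : s.real 4 0 0 = α) {ch pa : ℕ → Fin n}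
    (hch : ∀ e < n - 1, s.nat 8 0 e = ch e) (hpa : ∀ e < n - 1, s.nat 9 0 e = pa e) (v : Fin n)
    (i : Fin K) : (elimCmd.exec s).real 2 v i = eliminate α ch pa (n - 1) B v i := by
  -- Vertices are eliminated in reverse order of discovery. The invariant says that the eliminations
  -- still to come turn the current table into the desired result.
  obtain ⟨B', h₁, h₂⟩ := Cmd.exec_loop_frame (x := 13) (b := .sub (natCell 0) (.lit 1)) (s := s)
    (k := n - 1) (body := elimStepCmd)
    (P := fun l s' => ∃ B' : Fin n → Fin K → ℝ, (∀ (v : Fin n) (i : Fin K), s'.real 2 v i = B' v i) ∧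
      eliminate α ch pa (n - 1 - l) B' = eliminate α ch pa (n - 1) B)
    (by simp [natCell, NatExpr.eval, hn]) ⟨B, hB, rfl⟩ (fun _ _ h => h) (by
      rintro l hl s' hl' hf hr ⟨B', h₁, h₂⟩
      simp only [elimStepCmd, sumRow, setRealCell, Cmd.natWrites, Cmd.realWrites, List.mem_cons,
        List.mem_append, not_or] at hf hr
      have he : elimIndex.eval s' = n - 1 - (l + 1) := by
        simp only [elimIndex, natCell, NatExpr.eval, hl', hf 0 (by simp), hn]
        omega
      refine ⟨_, elimStepCmd_spec (by simp [hf 1, hK]) h₁ (α := α) (by simp [hr 4, hα]) he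
        (by rw [hf 8 (by simp), hch _ (by omega)]) (by rw [hf 9 (by simp), hpa _ (by omega)]), ?_⟩
      rw [← h₂, show n - 1 - l = n - 1 - (l + 1) + 1 by omega, eliminate])
  rw [Nat.sub_self, eliminate] at h₂
  rw [← h₂, ← h₁ v i]
  rfl

/-- The unnormalised marginal distribution of the label of `c`, computed by elimination. -/
def treeMarginal {V : Type*} [DecidableEq V] {K : ℕ} (α : ℝ) (r : V) (ch pa : ℕ → V) (m : ℕ)
    (ψ : V → Fin K → ℝ) (c : V) (a : Fin K) : ℝ :=
  ∑ i, eliminate α ch pa m (clamp ψ c a) r i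

theorem clampCmd_elimCmd_spec {n K : ℕ} {s : State} (hn : s.nat 0 0 0 = n) (hK : s.nat 1 0 0 = K)
    {ψ : Fin n → Fin K → ℝ} (hψ : ∀ (v : Fin n) (i : Fin K), s.real 1 v i = ψ v i)
    {α : ℝ} (hα : s.real 4 0 0 = α) {ch pa : ℕ → Fin n}
    (hch : ∀ e < n - 1, s.nat 8 0 e = ch e) (hpa : ∀ e < n - 1, s.nat 9 0 e = pa e)
    {c : Fin n} (hc : s.nat 5 0 0 = c) {a : Fin K} (ha : s.nat 12 0 0 = a) (v : Fin n)
    (i : Fin K) : ((Cmd.seq clampCmd elimCmd).exec s).real 2 v i =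
      eliminate α ch pa (n - 1) (clamp ψ c a) v i := by
  have hf : ∀ a, a ≠ 13 → a ≠ 14 → (clampCmd.exec s).nat a = s.nat a := fun a h₁ h₂ =>
    Cmd.exec_nat_of_notMem _ (by simp [clampCmd, Cmd.natWrites, h₁, h₂]) _
  have hr : ∀ a, a ≠ 2 → (clampCmd.exec s).real a = s.real a := fun a h₁ =>
    Cmd.exec_real_of_notMem _ (by simp [clampCmd, Cmd.realWrites, h₁]) _
  exact elimCmd_spec (by simp [hf 0, hn]) (by simp [hf 1, hK]) (clampCmd_spec hn hK hψ hc ha)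
    (by simp [hr 4, hα]) (by simpa [hf 8] using hch) (by simpa [hf 9] using hpa) v i

/-- Elimination destroys its table, so the table is rebuilt from the weights for every arm; only
real array `3` persists from one arm to the next. -/
theorem marginalsCmd_spec {n K : ℕ} {s : State} (hn : s.nat 0 0 0 = n) (hK : s.nat 1 0 0 = K)
    {ψ : Fin n → Fin K → ℝ} (hψ : ∀ (v : Fin n) (i : Fin K), s.real 1 v i = ψ v i)
    {α : ℝ} (hα : s.real 4 0 0 = α) {ch pa : ℕ → Fin n}
    (hch : ∀ e < n - 1, s.nat 8 0 e = ch e) (hpa : ∀ e < n - 1, s.nat 9 0 e = pa e)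
    {c : Fin n} (hc : s.nat 5 0 0 = c) {r : Fin n} (hr : (r : ℕ) = 0) (a : Fin K) :
    (marginalsCmd.exec s).real 3 0 a = treeMarginal α r ch pa (n - 1) ψ c a := by
  refine Cmd.exec_loop_frame (P := fun l s' => ∀ a : Fin K, (a : ℕ) < l →
    s'.real 3 0 a = treeMarginal α r ch pa (n - 1) ψ c a) (by simpa [natCell, NatExpr.eval] using hK)
    (by simp) (fun _ _ h => h) ?_ a a.2
  intro l hl s₁ hl₁ hf hreal h a ha
  simp only [clampCmd, elimCmd, elimStepCmd, sumRow, setRealCell, Cmd.natWrites, Cmd.realWrites,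
    List.mem_cons, List.mem_append, not_or] at hf hreal
  rw [Cmd.exec, Cmd.exec]
  have hB := clampCmd_elimCmd_spec (s := s₁) (by simp [hf 0, hn]) (by simp [hf 1, hK]) (ψ := ψ)
    (by simp [hreal 1, hψ]) (α := α) (by simp [hreal 4, hα]) (ch := ch) (pa := pa)
    (by simpa [hf 8] using hch) (by simpa [hf 9] using hpa) (c := c) (by simp [hf 5, hc])
    (a := ⟨l, hl⟩) hl₁
  have hf₂ : ∀ a, a ≠ 13 → a ≠ 14 → ((Cmd.seq clampCmd elimCmd).exec s₁).nat a = s₁.nat a :=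
    fun a h₁ h₂ => Cmd.exec_nat_of_notMem _
      (by simp [clampCmd, elimCmd, elimStepCmd, sumRow, setRealCell, Cmd.natWrites, h₁, h₂]) _
  have hr₂ : ∀ a, a ≠ 2 → a ≠ 6 → ((Cmd.seq clampCmd elimCmd).exec s₁).real a = s₁.real a :=
    fun a h₁ h₂ => Cmd.exec_real_of_notMem _
      (by simp [clampCmd, elimCmd, elimStepCmd, sumRow, setRealCell, Cmd.realWrites, h₁, h₂]) _
  generalize (Cmd.seq clampCmd elimCmd).exec s₁ = s₂ at *
  have hS := sumRow_spec (x := 13) (a := 6) (b := 2) (s := s₂) (by decide)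
    (show _ = K by simp [hf₂ 1, hf 1, hK]) (row := .lit 0) (v := 0) (fun _ _ => rfl)
  have hf₃ : ((sumRow 13 6 2 (.lit 0)).exec s₂).nat 12 = s₂.nat 12 :=
    Cmd.exec_nat_of_notMem _ (by simp [sumRow, setRealCell, Cmd.natWrites]) _
  have hr₃ : ((sumRow 13 6 2 (.lit 0)).exec s₂).real 3 = s₂.real 3 :=
    Cmd.exec_real_of_notMem _ (by simp [sumRow, setRealCell, Cmd.realWrites]) _
  generalize (sumRow 13 6 2 (.lit 0)).exec s₂ = s₃ at *
  have e12 : s₃.nat 12 0 0 = l := by rw [hf₃, hf₂ 12 (by decide) (by decide), hl₁]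
  simp only [Cmd.exec, State.tick, State.writeReal, natCell, realCell, NatExpr.eval, RealExpr.eval,
    e12, true_and, hr₃, hS]
  by_cases hal : (a : ℕ) = l
  · rw [if_pos hal, Finset.sum_range, treeMarginal]
    refine Finset.sum_congr rfl fun j _ => ?_
    rw [← hr, hB r j, Fin.ext (a := a) (b := ⟨l, hl⟩) hal]
  · rw [if_neg hal, hr₂ 3 (by decide) (by decide), h a (by omega)]

/-! ### Sampling by inversion of the distribution function. -/

theorem sample_eq_iff {K : ℕ} [NeZero K] {Z : Fin K → ℝ} {u : ℝ} (hZ : ∀ a, 0 ≤ Z a) (hu : 0 ≤ u)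
    {i : Fin K} : sample Z u = i ↔ ∑ j with j < i, Z j ≤ u * ∑ j, Z j ∧
      ∀ i' > i, u * ∑ j, Z j < ∑ j with j < i', Z j := by
  set S := Finset.univ.filter fun i : Fin K => ∑ j with j < i, Z j ≤ u * ∑ j, Z j with hS
  have mem : ∀ i, i ∈ S ↔ ∑ j with j < i, Z j ≤ u * ∑ j, Z j := by simp [hS]
  -- Index `0` always qualifies, because its prefix sum is empty; so the supremum is attained.
  have h₀ : (0 : Fin K) ∈ S := by
    rw [mem, Finset.sum_eq_zero]
    · exact mul_nonneg hu (Finset.sum_nonneg fun j _ => hZ j)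
    · intro j hj
      simp at hj
  have hmem : sample Z u ∈ S := by
    obtain ⟨b, hb, h⟩ := Finset.exists_mem_eq_sup S ⟨0, h₀⟩ id
    rw [sample, ← hS, h]
    exact hb
  have hle : ∀ i ∈ S, i ≤ sample Z u := fun i hi => Finset.le_sup (f := id) hi
  constructor
  · rintro rfl
    refine ⟨(mem _).1 hmem, fun i' hi' => ?_⟩
    by_contra hlt
    exact (hle i' ((mem _).2 (not_lt.1 hlt))).not_gt hi'
  · rintro ⟨h₁, h₂⟩
    refine le_antisymm ?_ (hle i ((mem i).2 h₁))
    by_contra hlt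
    exact (h₂ _ (not_le.1 hlt)).not_ge ((mem _).1 hmem)

theorem sum_filter_lt_eq_sum_range {K : ℕ} (g : ℕ → ℝ) (i : Fin K) :
    ∑ j : Fin K with j < i, g j = ∑ j ∈ Finset.range i, g j := by
  refine Finset.sum_bij (fun j _ => (j : ℕ)) ?_ ?_ ?_ ?_
  · simp
  · simp [Fin.ext_iff]
  · intro b hb
    have hb := Finset.mem_range.1 hb
    exact ⟨⟨b, hb.trans i.2⟩, Finset.mem_filter.2 ⟨Finset.mem_univ _, hb⟩, rfl⟩
  · simp

theorem sampleCmd_spec {K : ℕ} [NeZero K] {s : State} (hK : s.nat 1 0 0 = K) {Z : Fin K → ℝ}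
    (hZ : ∀ a : Fin K, s.real 3 0 a = Z a) (hZ₀ : ∀ a, 0 ≤ Z a)
    (hW : s.real 7 0 0 = ∑ j, Z j) :
    (sampleCmd.exec s).nat 6 0 0 = sample Z (s.seed 0) := by
  rw [sampleCmd, Cmd.exec]
  set s₁ := (Cmd.seq (.draw 8 (.lit 0) (.lit 0)) (setRealCell 9 (.cast (.lit 0)))).exec s with hs₁
  have hn₁ : s₁.nat = s.nat := rfl
  have e8 : s₁.real 8 0 0 = s.seed 0 := by
    simp [hs₁, setRealCell, Cmd.exec, State.tick, State.writeReal, NatExpr.eval]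
  have e9 : s₁.real 9 0 0 = 0 := by
    simp [hs₁, setRealCell, Cmd.exec, State.tick, State.writeReal, NatExpr.eval, RealExpr.eval]
  have hr₁ : ∀ a, a ≠ 8 → a ≠ 9 → s₁.real a = s.real a := fun a h₁ h₂ =>
    Cmd.exec_real_of_notMem _ (by simp [setRealCell, Cmd.realWrites, h₁, h₂]) _
  have e7 : s₁.real 7 0 0 = ∑ j, Z j := by simp [hr₁ 7, hW]
  have hu : 0 ≤ (s.seed 0 : ℝ) := (s.seed 0).2.1
  clear_value s₁
  -- Cell `9` holds the prefix sum and cell `6` the last index that passed the test. Nothing is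
  -- claimed about cell `6` before the first iteration, when it may still hold the arm of an earlier
  -- round.
  have key := Cmd.exec_loop_frame (x := 12) (b := natCell 1) (s := s₁) (k := K)
    (body := (.seq (.ite (.realLt (.mul (realCell 8) (realCell 7)) (realCell 9)) .skip
          (setNatCell 6 (natCell 12)))
        (setRealCell 9 (.add (realCell 9) (.get 3 (.lit 0) (natCell 12))))))
    (P := fun l s' => s'.real 9 0 0 = ∑ j ∈ Finset.range l, s.real 3 0 j ∧ (0 < l →
      s'.nat 6 0 0 < l ∧
      ∑ j ∈ Finset.range (s'.nat 6 0 0), s.real 3 0 j ≤ s.seed 0 * ∑ j, Z j ∧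
      ∀ l' < l, s'.nat 6 0 0 < l' →
        s.seed 0 * ∑ j, Z j < ∑ j ∈ Finset.range l', s.real 3 0 j))
    (by simp [natCell, NatExpr.eval, hn₁, hK])
    ⟨by simpa [State.tick] using e9, by simp⟩
    (by
      intro i s' h
      simpa [State.tick, State.writeNat] using h) ?_
  · obtain ⟨-, h⟩ := key
    obtain ⟨h₁, h₂, h₃⟩ := h (Nat.pos_of_neZero K)
    have : sample Z (s.seed 0) = ⟨_, h₁⟩ := by
      rw [sample_eq_iff hZ₀ hu]
      simp only [← hZ, sum_filter_lt_eq_sum_range (fun j => s.real 3 0 j)]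
      simp only [hZ]
      exact ⟨h₂, fun i' hi' => h₃ i' i'.2 hi'⟩
    rw [this]
  · rintro l hl s' hl' hf hr ⟨h₁, h₂⟩
    simp only [setRealCell, setNatCell, Cmd.natWrites, Cmd.realWrites, List.mem_cons,
      List.mem_append, not_or] at hf hr
    have e8' : s'.real 8 0 0 = s.seed 0 := by simp [hr 8, e8]
    have e7' : s'.real 7 0 0 = ∑ j, Z j := by simp [hr 7, e7]
    have e3' : s'.real 3 = s.real 3 := by simp [hr 3, hr₁ 3]
    have test : Test.holds s' (.realLt (.mul (realCell 8) (realCell 7)) (realCell 9)) ↔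
        s.seed 0 * ∑ j, Z j < ∑ j ∈ Finset.range l, s.real 3 0 j := by
      simp [Test.holds, RealExpr.eval, realCell, NatExpr.eval, e8', e7', h₁]
    rw [Cmd.exec, Cmd.exec]
    by_cases ht : s.seed 0 * ∑ j, Z j < ∑ j ∈ Finset.range l, s.real 3 0 j
    · rw [if_pos (test.2 ht)]
      -- At `l = 0` the prefix sum is `0`, so the strict inequality fails and cell `6` is written:
      -- its stale content cannot survive.
      have hl₀ : 0 < l := by
        rcases Nat.eq_zero_or_pos l with rfl | h
        · simp only [Finset.range_zero, Finset.sum_empty] at ht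
          exact absurd ht (mul_nonneg hu (Finset.sum_nonneg fun j _ => hZ₀ j)).not_gt
        · exact h
      obtain ⟨h₂, h₃, h₄⟩ := h₂ hl₀
      refine ⟨?_, fun _ => ⟨?_, h₃, fun l' hl' h => ?_⟩⟩
      · simp [Cmd.exec, setRealCell, realCell, natCell, State.tick, State.writeReal, NatExpr.eval,
          RealExpr.eval, hl', e3', h₁, Finset.sum_range_succ]
      · exact Nat.lt_succ_of_lt h₂
      · rcases Nat.lt_succ_iff_lt_or_eq.1 hl' with hlt | rfl
        · exact h₄ l' hlt h
        · exact ht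
    · rw [if_neg (mt test.1 ht)]
      have e6 : ((setRealCell 9 (.add (realCell 9) (.get 3 (.lit 0) (natCell 12)))).exec
          ((setNatCell 6 (natCell 12)).exec s'.tick)).nat 6 0 0 = l := by
        simp [Cmd.exec, setRealCell, setNatCell, natCell, State.tick, State.writeReal,
          State.writeNat, NatExpr.eval, hl']
      rw [e6]
      refine ⟨?_, fun _ => ⟨Nat.lt_succ_self l, not_lt.1 ht, fun l' hl' h => by omega⟩⟩
      simp [Cmd.exec, setRealCell, setNatCell, realCell, natCell, State.tick, State.writeReal,
        State.writeNat, NatExpr.eval, RealExpr.eval, hl', e3', h₁, Finset.sum_range_succ]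

theorem sampleCmd_seed (s : State) : (sampleCmd.exec s).seed = fun k => s.seed (k + 1) := by
  rw [sampleCmd, Cmd.exec, Cmd.exec_seed _ (by simp [Cmd.DrawFree, setNatCell, setRealCell])]
  rfl

/-! ### Graph search. -/

theorem findEdge_spec {n : ℕ} {G : SimpleGraph (Fin n)} {s : State} (hn : s.nat 0 0 0 = n)
    (hG : ∀ u v : Fin n, 0 < s.nat 4 u v ↔ G.Adj u v)
    (h : ∃ u v : Fin n, G.Adj u v ∧ 0 < s.nat 7 0 u ∧ s.nat 7 0 v = 0) :
    ∃ u v : Fin n, (G.Adj u v ∧ 0 < s.nat 7 0 u ∧ s.nat 7 0 v = 0) ∧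
      (findEdge.exec s).nat 10 0 0 = u ∧ (findEdge.exec s).nat 11 0 0 = v := by
  -- The loops have no early exit, so later hits overwrite earlier ones. The invariant only asserts
  -- that some suitable edge is stored once one has been scanned.
  let Good : State → Prop := fun s' =>
    ∃ u v : Fin n, (G.Adj u v ∧ 0 < s.nat 7 0 u ∧ s.nat 7 0 v = 0) ∧
      s'.nat 10 0 0 = u ∧ s'.nat 11 0 0 = v
  have outer := Cmd.exec_loop_frame (x := 13) (b := natCell 0) (s := s) (k := n)
    (P := fun k s' => (∃ u v : Fin n, (u : ℕ) < k ∧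
      (G.Adj u v ∧ 0 < s.nat 7 0 u ∧ s.nat 7 0 v = 0)) → Good s')
    (body := (.loop 14 (natCell 0)
      (.ite (.conj (.natLt (.lit 0) (.get 4 (natCell 13) (natCell 14)))
        (.conj (.natLt (.lit 0) (.get 7 (.lit 0) (natCell 13)))
          (.neg (.natLt (.lit 0) (.get 7 (.lit 0) (natCell 14))))))
      (.seq (setNatCell 10 (natCell 13)) (setNatCell 11 (natCell 14))) .skip)))
    (by simpa [natCell, NatExpr.eval] using hn) (by simp)
    (fun _ _ h => by simpa [Good, State.tick, State.writeNat] using h) ?_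
  · obtain ⟨u, v, huv⟩ := h
    exact outer ⟨u, v, u.2, huv⟩
  intro k hk s₁ hk₁ hf _ h₁
  simp only [setNatCell, Cmd.natWrites, List.mem_cons, List.mem_append, not_or] at hf
  have inner := Cmd.exec_loop_frame (x := 14) (b := natCell 0) (s := s₁) (k := n)
    (P := fun l s' => (∃ u v : Fin n, ((u : ℕ) < k ∨ (u : ℕ) = k ∧ (v : ℕ) < l) ∧
      (G.Adj u v ∧ 0 < s.nat 7 0 u ∧ s.nat 7 0 v = 0)) → Good s')
    (body := (.ite (.conj (.natLt (.lit 0) (.get 4 (natCell 13) (natCell 14)))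
        (.conj (.natLt (.lit 0) (.get 7 (.lit 0) (natCell 13)))
          (.neg (.natLt (.lit 0) (.get 7 (.lit 0) (natCell 14))))))
      (.seq (setNatCell 10 (natCell 13)) (setNatCell 11 (natCell 14))) .skip))
    (by simp [natCell, NatExpr.eval, hf 0, hn]) ?_
    (fun _ _ h => by simpa [Good, State.tick, State.writeNat] using h) ?_
  · rintro ⟨u, v, hu, huv⟩
    exact inner ⟨u, v, by omega, huv⟩
  · rintro ⟨u, v, hu, huv⟩
    exact h₁ ⟨u, v, by omega, huv⟩
  intro l hl s₂ hl₂ hf₂ _ h₂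
  simp only [setNatCell, Cmd.natWrites, List.mem_cons, List.mem_append, not_or] at hf₂
  have e13 : s₂.nat 13 0 0 = k := by simp [hf₂ 13, hk₁]
  have test : Test.holds s₂ (.conj (.natLt (.lit 0) (.get 4 (natCell 13) (natCell 14)))
        (.conj (.natLt (.lit 0) (.get 7 (.lit 0) (natCell 13)))
          (.neg (.natLt (.lit 0) (.get 7 (.lit 0) (natCell 14)))))) ↔
      G.Adj ⟨k, hk⟩ ⟨l, hl⟩ ∧ 0 < s.nat 7 0 k ∧ s.nat 7 0 l = 0 := by
    rw [← hG]
    simp [Test.holds, NatExpr.eval, natCell, e13, hl₂, hf₂ 4, hf 4, hf₂ 7, hf 7]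
  rw [Cmd.exec]
  by_cases ht : G.Adj ⟨k, hk⟩ ⟨l, hl⟩ ∧ 0 < s.nat 7 0 k ∧ s.nat 7 0 l = 0
  · rw [if_pos (test.2 ht)]
    intro _
    refine ⟨_, _, ht, ?_, ?_⟩ <;>
    simp [setNatCell, natCell, Cmd.exec, State.tick, State.writeNat, NatExpr.eval, e13, hl₂]
  · rw [if_neg (mt test.1 ht)]
    rintro ⟨u, v, huv, huv'⟩
    refine h₂ ⟨u, v, ?_, huv'⟩
    by_contra hne
    obtain ⟨rfl, rfl⟩ : (u : ℕ) = k ∧ (v : ℕ) = l := by omega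
    exact ht huv'

/-- In a connected graph, fewer edges than vertices minus one cannot reach every vertex. -/
theorem exists_adj_new {n : ℕ} {G : SimpleGraph (Fin n)} (hconn : G.Connected) (r : Fin n)
    (ch : ℕ → Fin n) {k : ℕ} (hk : k < n - 1) :
    ∃ u v, G.Adj u v ∧ (u = r ∨ ∃ e < k, ch e = u) ∧ ¬ (v = r ∨ ∃ e < k, ch e = v) := by
  let S : Finset (Fin n) := insert r ((Finset.range k).image ch)
  have hS : ∀ v, v ∈ S ↔ v = r ∨ ∃ e < k, ch e = v := by simp [S]
  have hcard : S.card < Fintype.card (Fin n) := by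
    have h₁ := Finset.card_insert_le r ((Finset.range k).image ch)
    have h₂ := Finset.card_image_le (s := Finset.range k) (f := ch)
    simp only [Finset.card_range, Fintype.card_fin, S] at *
    omega
  obtain ⟨w, hw⟩ : ∃ w, w ∉ S := by
    by_contra! h
    exact hcard.ne (by rw [Finset.eq_univ_of_forall h, Finset.card_univ])
  -- A walk from the root to a vertex outside `S` must leave `S` along some edge.
  obtain ⟨p⟩ := hconn.preconnected r w
  obtain ⟨d, -, h₁, h₂⟩ := p.exists_boundary_dart (S : Set (Fin n)) (by simp [S]) (by simpa using hw)
  exact ⟨d.fst, d.snd, d.adj, (hS _).1 (by simpa using h₁), fun h => h₂ (by simpa using (hS _).2 h)⟩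

theorem SearchOrder.extend {V : Type*} {G : SimpleGraph V} {r : V} {ch pa : ℕ → V} {m : ℕ}
    (h : SearchOrder G r ch pa m) {u v : V} (huv : G.Adj u v) (hu : u = r ∨ ∃ e < m, ch e = u)
    (hv : ¬ (v = r ∨ ∃ e < m, ch e = v)) :
    SearchOrder G r (Function.update ch m v) (Function.update pa m u) (m + 1) := by
  push Not at hv
  have c : ∀ e < m, Function.update ch m v e = ch e := fun e he =>
    Function.update_of_ne he.ne _ _
  have p : ∀ e < m, Function.update pa m u e = pa e := fun e he =>
    Function.update_of_ne he.ne _ _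
  refine ⟨fun e he => ?_, fun e he => ?_, fun e he e' he' => ?_, fun e he => ?_⟩ <;>
  rcases Nat.lt_succ_iff_lt_or_eq.1 he with hlt | rfl
  · simpa [c e hlt, p e hlt] using h.adj e hlt
  · simpa using huv
  · simpa [c e hlt] using h.ne_root e hlt
  · simpa using hv.1
  · simpa [c e hlt, c e' (he'.trans hlt)] using h.ne_of_lt e hlt e' he'
  · simpa [c e' he'] using hv.2 e' he'
  · rw [p e hlt]
    exact (h.parent e hlt).imp_right fun ⟨e', he', h'⟩ => ⟨e', he', by rw [c e' (he'.trans hlt), h']⟩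
  · rw [Function.update_self]
    exact hu.imp_right fun ⟨e', he', h'⟩ => ⟨e', he', by rw [c e' he', h']⟩

/-- Array `7` marks exactly the root and the listed vertices. As long as fewer than `n - 1` vertices
are listed, connectedness yields an edge that leaves the marked set, so each of the `n - 1`
iterations discovers a new vertex. -/
theorem graphSearch_spec {n : ℕ} {G : SimpleGraph (Fin n)} (hconn : G.Connected) {s : State}
    (hn : s.nat 0 0 0 = n) (hG : ∀ u v : Fin n, 0 < s.nat 4 u v ↔ G.Adj u v)
    (h₇ : ∀ i j, s.nat 7 i j = 0) {r : Fin n} (hr : (r : ℕ) = 0) :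
    ∃ ch pa : ℕ → Fin n, SearchOrder G r ch pa (n - 1) ∧
      (∀ e < n - 1, (graphSearch.exec s).nat 8 0 e = ch e) ∧
      ∀ e < n - 1, (graphSearch.exec s).nat 9 0 e = pa e := by
  rw [graphSearch, Cmd.exec]
  set s₁ := (Cmd.setNat 7 (.lit 0) (.lit 0) (.lit 1)).exec s with hs₁
  have hf : ∀ a, a ≠ 7 → s₁.nat a = s.nat a := fun a h =>
    Cmd.exec_nat_of_notMem _ (by simp [Cmd.natWrites, h]) _
  have e7 : ∀ v : Fin n, 0 < s₁.nat 7 0 v ↔ v = r := by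
    intro v
    simp [hs₁, Cmd.exec, State.tick, State.writeNat, NatExpr.eval, h₇, Fin.ext_iff, hr,
      Nat.pos_iff_ne_zero]
  obtain ⟨ch, pa, h, h8, h9, -⟩ := Cmd.exec_loop_frame (x := 12) (b := .sub (natCell 0) (.lit 1))
    (s := s₁) (k := n - 1)
    (body := (.seq findEdge
        (.seq (.setNat 8 (.lit 0) (natCell 12) (natCell 11))
          (.seq (.setNat 9 (.lit 0) (natCell 12) (natCell 10))
            (.setNat 7 (.lit 0) (natCell 11) (.lit 1))))))
    (P := fun k s' => ∃ ch pa : ℕ → Fin n, SearchOrder G r ch pa k ∧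
      (∀ e < k, s'.nat 8 0 e = ch e) ∧ (∀ e < k, s'.nat 9 0 e = pa e) ∧
      ∀ v : Fin n, 0 < s'.nat 7 0 v ↔ v = r ∨ ∃ e < k, ch e = v)
    (by simp [natCell, NatExpr.eval, hf 0, hn])
    ⟨fun _ => r, fun _ => r, ⟨by simp, by simp, by simp, by simp⟩, by simp, by simp, by simpa [State.tick] using e7⟩
    (fun _ _ h => by simpa [State.tick, State.writeNat] using h) (by
      rintro k hk s₂ hk₂ hf₂ - ⟨ch, pa, h, h8, h9, h7⟩
      simp only [findEdge, setNatCell, Cmd.natWrites, List.mem_cons, List.mem_append, not_or] at hf₂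
      have h7' : ∀ v : Fin n, s₂.nat 7 0 v = 0 ↔ ¬ (v = r ∨ ∃ e < k, ch e = v) := fun v => by
        rw [← h7]
        omega
      obtain ⟨u, v, ⟨huv, hu, hv⟩, e10, e11⟩ := findEdge_spec (G := G) (s := s₂)
        (by simp [hf₂ 0, hf 0, hn]) (by simpa [hf₂ 4, hf 4] using hG) (by
          obtain ⟨u, v, huv, hu, hv⟩ := exists_adj_new hconn r ch hk
          exact ⟨u, v, huv, (h7 u).2 hu, (h7' v).2 hv⟩)
      have hf₃ : ∀ a, a ≠ 10 → a ≠ 11 → a ≠ 13 → a ≠ 14 → (findEdge.exec s₂).nat a = s₂.nat a :=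
        fun a h₁ h₂ h₃ h₄ => Cmd.exec_nat_of_notMem _
          (by simp [findEdge, setNatCell, Cmd.natWrites, h₁, h₂, h₃, h₄]) _
      rw [Cmd.exec]
      generalize findEdge.exec s₂ = s₃ at *
      have e12 : s₃.nat 12 0 0 = k := by simp [hf₃ 12, hk₂]
      refine ⟨Function.update ch k v, Function.update pa k u,
        h.extend huv ((h7 u).1 hu) ((h7' v).1 hv), fun e he => ?_, fun e he => ?_, fun w => ?_⟩
      · simp only [Cmd.exec, State.tick, State.writeNat, natCell, NatExpr.eval, e12, e11, e10]
        rcases Nat.lt_succ_iff_lt_or_eq.1 he with hlt | rfl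
        · simp [hlt.ne, hf₃ 8, h8 e hlt]
        · simp
      · simp only [Cmd.exec, State.tick, State.writeNat, natCell, NatExpr.eval, e12, e11, e10]
        rcases Nat.lt_succ_iff_lt_or_eq.1 he with hlt | rfl
        · simp [hlt.ne, hf₃ 9, h9 e hlt]
        · simp
      · have : (w = r ∨ ∃ e < k + 1, Function.update ch k v e = w) ↔
            w = v ∨ (w = r ∨ ∃ e < k, ch e = w) := by
          constructor
          · rintro (hw | ⟨e, he, hw⟩)
            · exact .inr (.inl hw)
            · rcases Nat.lt_succ_iff_lt_or_eq.1 he with hlt | rfl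
              · exact .inr (.inr ⟨e, hlt, by simpa [hlt.ne] using hw⟩)
              · exact .inl (by simpa using hw.symm)
          · rintro (hw | hw | ⟨e, he, hw⟩)
            · exact .inr ⟨k, by omega, by simp [hw]⟩
            · exact .inl hw
            · exact .inr ⟨e, by omega, by simpa [he.ne] using hw⟩
        rw [this, ← h7]
        simp only [Cmd.exec, State.tick, State.writeNat, natCell, NatExpr.eval, e12, e11, e10]
        by_cases hw : w = v <;> simp [hw, Fin.val_inj, hf₃ 7])
  exact ⟨ch, pa, h, h8, h9⟩

/-! ### Initial weights and learning rate. -/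

theorem initWeights_spec {n K : ℕ} {s : State} (hn : s.nat 0 0 0 = n) (hK : s.nat 1 0 0 = K)
    (v : Fin n) (i : Fin K) : (initWeights.exec s).real 1 v i = 1 := by
  refine Cmd.exec_loop_frame (P := fun k s' => ∀ (v : Fin n) (i : Fin K), (v : ℕ) < k →
    s'.real 1 v i = 1) (by simpa [natCell, NatExpr.eval] using hn) (by simp)
    (fun _ _ h => h) ?_ v i v.2
  intro k hk s₁ hk₁ hf _ h v i hv
  simp only [Cmd.natWrites, List.mem_cons, not_or] at hf
  refine Cmd.exec_loop_frame (x := 13) (b := natCell 1) (s := s₁) (k := K)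
    (P := fun l s' => ∀ (v : Fin n) (i : Fin K), ((v : ℕ) < k ∨ (v : ℕ) = k ∧ (i : ℕ) < l) →
      s'.real 1 v i = 1) (by simp [natCell, NatExpr.eval, hf 1, hK])
    (by intro v i hv; exact h v i (by omega)) (fun _ _ h => h) ?_ v i (by omega)
  intro l hl s₂ hl₂ hf₂ _ h₂ v i hv
  simp only [Cmd.natWrites, List.mem_cons, not_or] at hf₂
  have e12 : s₂.nat 12 0 0 = k := by simp [hf₂ 12, hk₁]
  by_cases hvi : (v : ℕ) = k ∧ (i : ℕ) = l
  · simp [Cmd.exec, State.tick, State.writeReal, natCell, NatExpr.eval, RealExpr.eval, e12, hl₂, hvi]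
  · simpa [Cmd.exec, State.tick, State.writeReal, natCell, NatExpr.eval, e12, hl₂, hvi]
      using h₂ v i (by omega)

/-- The loop keeps the successor of the last `j` with `j ^ 2 * f < T * K`, which is `√(T * K / f)`
rounded up. If no `j` passes the test, `m = 0` and the rate is `1 / 0 = 0`; for `f ≥ 1` this happens
only when `T * K = 0`. -/
theorem initRate_spec {K T f : ℕ} {s : State} (hK : s.nat 1 0 0 = K) (hT : s.nat 2 0 0 = T)
    (hf : s.nat 3 0 0 = f) (h₅ : s.real 5 0 0 = 0) :
    ∃ m : ℕ, (initRate.exec s).real 5 0 0 = 1 / m ∧ (1 ≤ f → T * K ≤ m ^ 2 * f) ∧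
      (1 ≤ m → (m - 1) ^ 2 * f < T * K) := by
  rw [initRate, Cmd.exec]
  obtain ⟨m, hm, h₁, h₂, h₃⟩ := Cmd.exec_loop_frame (x := 12) (b := .add (natCell 2) (natCell 1))
    (s := s) (k := T + K)
    (body := (.ite (.realLt
          (.mul (.mul (.cast (natCell 12)) (.cast (natCell 12))) (.cast (natCell 3)))
          (.mul (.cast (natCell 2)) (.cast (natCell 1))))
        (setRealCell 5 (.cast (.add (natCell 12) (.lit 1)))) .skip))
    (P := fun l s' => ∃ m ≤ l, s'.real 5 0 0 = m ∧ (∀ j < l, m ≤ j → T * K ≤ j ^ 2 * f) ∧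
      (1 ≤ m → (m - 1) ^ 2 * f < T * K))
    (by simp [natCell, NatExpr.eval, hK, hT]) ⟨0, le_rfl, by simpa [State.tick] using h₅, by simp, by simp⟩
    (fun _ _ h => h) (by
      rintro l hl s' hl' hfr - ⟨m, hm, h₁, h₂, h₃⟩
      simp only [setRealCell, Cmd.natWrites, List.mem_cons, not_or] at hfr
      have test : Test.holds s' (.realLt
          (.mul (.mul (.cast (natCell 12)) (.cast (natCell 12))) (.cast (natCell 3)))
          (.mul (.cast (natCell 2)) (.cast (natCell 1)))) ↔ l ^ 2 * f < T * K := by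
        simp only [Test.holds, RealExpr.eval, NatExpr.eval, natCell, hl', hfr 3 (by simp),
          hfr 2 (by simp), hfr 1 (by simp), hf, hT, hK]
        rw [pow_two]
        exact_mod_cast Iff.rfl
      rw [Cmd.exec]
      by_cases ht : l ^ 2 * f < T * K
      · rw [if_pos (test.2 ht)]
        refine ⟨l + 1, le_rfl, ?_, fun j hj hj' => by omega, fun _ => by simpa using ht⟩
        simp [setRealCell, Cmd.exec, State.tick, State.writeReal, RealExpr.eval, NatExpr.eval,
          natCell, hl']
      · rw [if_neg (mt test.1 ht)]
        refine ⟨m, by omega, h₁, fun j hj hj' => ?_, h₃⟩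
        rcases Nat.lt_succ_iff_lt_or_eq.1 hj with hlt | rfl
        · exact h₂ j hlt hj'
        · exact not_lt.1 ht)
  refine ⟨m, ?_, fun hf₁ => ?_, h₃⟩
  · simp [setRealCell, realCell, Cmd.exec, State.tick, State.writeReal, RealExpr.eval,
      NatExpr.eval] at h₁ ⊢
    rw [h₁]
  -- Either the test failed at `j = m`, or `m` is the full loop bound `T + K`, and `T * K ≤ (T + K)
  -- ^ 2` shows that the loop was long enough.
  · rcases hm.lt_or_eq with hlt | rfl
    · exact h₂ m hlt le_rfl
    · nlinarith [Nat.zero_le (T * K), Nat.zero_le (T ^ 2), Nat.zero_le (K ^ 2),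
        Nat.le_mul_of_pos_right ((T + K) ^ 2) hf₁]

/-! ### Elimination computes the partition function of a tree -/

theorem SearchOrder.of_succ {V : Type*} {G : SimpleGraph V} {r : V} {ch pa : ℕ → V} {m : ℕ}
    (h : SearchOrder G r ch pa (m + 1)) : SearchOrder G r ch pa m :=
  ⟨fun e he => h.adj e (by omega), fun e he => h.ne_root e (by omega),
    fun e he => h.ne_of_lt e (by omega), fun e he => h.parent e (by omega)⟩

section Elimination

variable {V : Type*} [DecidableEq V] {K : ℕ}

/-- The weight of a labelling: a factor `α` for every cut edge `ch e`, `pa e`. -/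
def treeWeight (α : ℝ) (ch pa : ℕ → V) (m : ℕ) (x : V → Fin K) : ℝ :=
  ∏ e ∈ Finset.range m, if x (ch e) = x (pa e) then 1 else α

/-- The vertices that are not eliminated. -/
def remaining (r : V) (ch : ℕ → V) (m : ℕ) : Finset V := insert r ((Finset.range m).image ch)

theorem mem_remaining {r : V} {ch : ℕ → V} {m : ℕ} {v : V} :
    v ∈ remaining r ch m ↔ v = r ∨ ∃ e < m, ch e = v := by
  simp [remaining]

theorem remaining_succ (r : V) (ch : ℕ → V) (m : ℕ) :
    remaining r ch (m + 1) = insert (ch m) (remaining r ch m) := by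
  rw [remaining, remaining, Finset.range_add_one, Finset.image_insert, Finset.insert_comm]

theorem SearchOrder.notMem_remaining {G : SimpleGraph V} {r : V} {ch pa : ℕ → V} {m : ℕ}
    (h : SearchOrder G r ch pa (m + 1)) : ch m ∉ remaining r ch m := by
  rw [mem_remaining]
  rintro (h' | ⟨e, he, h'⟩)
  · exact h.ne_root m (by omega) h'
  · exact h.ne_of_lt m (by omega) e he h'

theorem SearchOrder.parent_mem {G : SimpleGraph V} {r : V} {ch pa : ℕ → V} {m : ℕ}
    (h : SearchOrder G r ch pa m) {e k : ℕ} (he : e < m) (hk : e ≤ k) : pa e ∈ remaining r ch k :=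
  mem_remaining.2 ((h.parent e he).imp_right fun ⟨e', h₁, h₂⟩ => ⟨e', by omega, h₂⟩)

variable [Fintype V]

/-- Exchanging `x v` with `i` is an involution on the pairs `(x, i)`. This sums out the label of one
vertex while the index set remains that of all labellings, at the price of a factor `K`. -/
theorem sum_sum_update (v : V) (F : (V → Fin K) → ℝ) :
    ∑ x, ∑ i, F (Function.update x v i) = K * ∑ x, F x := by
  let e : (V → Fin K) × Fin K → (V → Fin K) × Fin K := fun z => (Function.update z.1 v z.2, z.1 v)
  have he : Function.Involutive e := fun z => by simp [e]
  have h : ∑ z : (V → Fin K) × Fin K, F (Function.update z.1 v z.2) =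
      ∑ z : (V → Fin K) × Fin K, F z.1 :=
    Fintype.sum_equiv he.toPerm _ (fun z => F z.1) fun _ => rfl
  rw [← Fintype.sum_prod_type' (f := fun x i => F (Function.update x v i)), h,
    Fintype.sum_prod_type]
  simp [Finset.mul_sum]

/-- Parents precede children in the search order, so `ch m` is a leaf among the remaining vertices.
Summing over its label gives `∑ i, (if i = x p then 1 else α) * B i = α * ∑ B + (1 - α) * B (x p)`,
where `p = pa m` and `B` is the row of `ch m`; this is a function of the parent's label and is
absorbed into the parent's row. The powers of `K` compensate for summing over all labellings
although only the labels of the `m + 1` remaining vertices matter. -/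
theorem sum_treeWeight_mul_prod [NeZero K] (α : ℝ) {G : SimpleGraph V} {r : V} {ch pa : ℕ → V}
    {m : ℕ} (h : SearchOrder G r ch pa m) (B : V → Fin K → ℝ) :
    (K : ℝ) ^ (m + 1) * ∑ x, treeWeight α ch pa m x * ∏ v ∈ remaining r ch m, B v (x v) =
      (K : ℝ) ^ Fintype.card V * ∑ i, eliminate α ch pa m B r i := by
  induction m generalizing B with
  | zero =>
    rw [zero_add, pow_one, ← sum_sum_update r]
    simp [treeWeight, remaining, eliminate]
  | succ m ih =>
    rw [eliminate, ← ih h.of_succ, pow_succ, mul_assoc, ← sum_sum_update (ch m)]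
    congr 1
    refine Finset.sum_congr rfl fun x _ => ?_
    have hv := h.notMem_remaining
    have hp : pa m ∈ remaining r ch m := h.parent_mem (by omega) le_rfl
    have ne : ∀ w ∈ remaining r ch m, w ≠ ch m := fun w hw h' => hv (h' ▸ hw)
    have hupd : ∀ i, treeWeight α ch pa (m + 1) (Function.update x (ch m) i) *
        ∏ v ∈ remaining r ch (m + 1), B v (Function.update x (ch m) i v) =
        (treeWeight α ch pa m x * ∏ v ∈ remaining r ch m, B v (x v)) *
          ((if i = x (pa m) then 1 else α) * B (ch m) i) := by
      intro i
      rw [remaining_succ, Finset.prod_insert hv, treeWeight, Finset.prod_range_succ, treeWeight]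
      -- Edges listed earlier do not touch `ch m`, so relabelling it leaves their factors alone.
      have e₁ : ∀ e ∈ Finset.range m,
          (if Function.update x (ch m) i (ch e) = Function.update x (ch m) i (pa e) then (1 : ℝ)
            else α) = if x (ch e) = x (pa e) then 1 else α := by
        intro e he
        have he := Finset.mem_range.1 he
        rw [Function.update_of_ne (h.ne_of_lt m (by omega) e he),
          Function.update_of_ne (ne _ (h.parent_mem (by omega) he.le))]
      have e₂ : ∀ v ∈ remaining r ch m, B v (Function.update x (ch m) i v) = B v (x v) :=
        fun v hv => by rw [Function.update_of_ne (ne v hv)]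
      rw [Finset.prod_congr rfl e₁, Finset.prod_congr rfl e₂, Function.update_self,
        Function.update_of_ne (ne _ hp)]
      ring
    have hstep : ∏ v ∈ remaining r ch m, elimStep α (ch m) (pa m) B v (x v) =
        (∏ v ∈ remaining r ch m, B v (x v)) *
          (α * ∑ j, B (ch m) j + (1 - α) * B (ch m) (x (pa m))) := by
      rw [← Finset.prod_ite_eq_of_mem' (remaining r ch m) (pa m)
        (fun v => α * ∑ j, B (ch m) j + (1 - α) * B (ch m) (x v)) hp, ← Finset.prod_mul_distrib]
      refine Finset.prod_congr rfl fun v _ => ?_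
      rw [elimStep]
      split_ifs <;> simp
    have hsum : ∑ i, (if i = x (pa m) then 1 else α) * B (ch m) i =
        α * ∑ j, B (ch m) j + (1 - α) * B (ch m) (x (pa m)) := by
      have : ∀ i, (if i = x (pa m) then 1 else α) * B (ch m) i =
          α * B (ch m) i + if i = x (pa m) then (1 - α) * B (ch m) i else 0 := by
        intro i
        split_ifs <;> ring
      simp [this, Finset.sum_add_distrib, Finset.mul_sum]
    rw [Finset.sum_congr rfl fun i _ => hupd i, ← Finset.mul_sum, hsum, hstep, mul_assoc]

theorem SearchOrder.remaining_eq_univ {G : SimpleGraph V} {r : V} {ch pa : ℕ → V} {m : ℕ}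
    (h : SearchOrder G r ch pa m) (hm : m + 1 = Fintype.card V) :
    remaining r ch m = Finset.univ := by
  rw [← Finset.card_eq_iff_eq_univ, ← hm]
  clear hm
  induction m with
  | zero => simp [remaining]
  | succ m ih => rw [remaining_succ, Finset.card_insert_of_notMem h.notMem_remaining, ih h.of_succ]

/-- The weight of a labelling, given the prior weights and the weights of the labels of the
vertices. -/
def labelWeight (wt : (V → Fin K) → ℝ) (ψ : V → Fin K → ℝ) (x : V → Fin K) : ℝ :=
  wt x * ∏ v, ψ v (x v)

/-- The total weight of the labellings for which `c` has label `a`. -/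
def marginal (wt : (V → Fin K) → ℝ) (ψ : V → Fin K → ℝ) (c : V) (a : Fin K) : ℝ :=
  ∑ x with x c = a, labelWeight wt ψ x

/-- Clamping annihilates every labelling with `x c ≠ a` and leaves the others unchanged. When all
vertices are listed, both powers of `K` coincide and cancel. -/
theorem treeMarginal_eq_marginal [NeZero K] (α : ℝ) {G : SimpleGraph V} {r : V} {ch pa : ℕ → V}
    {m : ℕ} (h : SearchOrder G r ch pa m) (hm : m + 1 = Fintype.card V) (ψ : V → Fin K → ℝ) (c : V)
    (a : Fin K) : treeMarginal α r ch pa m ψ c a = marginal (treeWeight α ch pa m) ψ c a := by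
  have key := sum_treeWeight_mul_prod α h (clamp ψ c a)
  rw [hm] at key
  have hK : (K : ℝ) ^ Fintype.card V ≠ 0 := pow_ne_zero _ (Nat.cast_ne_zero.2 (NeZero.ne K))
  rw [treeMarginal, ← mul_left_cancel₀ hK key, h.remaining_eq_univ hm, marginal, Finset.sum_filter]
  refine Finset.sum_congr rfl fun x _ => ?_
  split_ifs with hx
  · rw [labelWeight]
    congr 1
    refine Finset.prod_congr rfl fun v _ => ?_
    rw [clamp, if_neg]
    rintro ⟨rfl, h'⟩
    exact h' hx
  · rw [Finset.prod_eq_zero (Finset.mem_univ c), mul_zero]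
    simp [clamp, hx]

end Elimination

/-! ### Exponential weights -/

section Step

variable {V : Type*} [DecidableEq V] {K : ℕ} {ψ : V → Fin K → ℝ}

/-- The weights after arm `i` was played for context `c` and got reward `ρ`, where `Z` are the
unnormalised probabilities of the arms. -/
noncomputable def hedgeStep (η : ℝ) (Z : Fin K → ℝ) (ψ : V → Fin K → ℝ) (c : V) (i : Fin K) (ρ : ℝ) :
    V → Fin K → ℝ := fun v j =>
  if v = c ∧ j = i then ψ v j / (1 + η * (1 - ρ) * (∑ a, Z a) / Z i) else ψ v j

theorem hedgeStep_pos {η : ℝ} (hη : 0 ≤ η) {Z : Fin K → ℝ} (hZ : ∀ a, 0 < Z a)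
    (hψ : ∀ v i, 0 < ψ v i) (c : V) (i : Fin K) {ρ : ℝ} (hρ : ρ ≤ 1) (v : V) (j : Fin K) :
    0 < hedgeStep η Z ψ c i ρ v j := by
  have h₁ : 0 ≤ 1 - ρ := by linarith
  have h₂ : 0 ≤ ∑ a, Z a := Finset.sum_nonneg fun a _ => (hZ a).le
  have h₃ := hZ i
  rw [hedgeStep]
  split_ifs
  · exact div_pos (hψ v j) (by positivity)
  · exact hψ v j

end Step

section Weights

variable {V : Type*} [Fintype V] {K : ℕ} {wt : (V → Fin K) → ℝ} {ψ : V → Fin K → ℝ}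

theorem labelWeight_pos (hwt : ∀ x, 0 < wt x) (hψ : ∀ v i, 0 < ψ v i) (x : V → Fin K) :
    0 < labelWeight wt ψ x :=
  mul_pos (hwt x) (Finset.prod_pos fun v _ => hψ v _)

variable [DecidableEq V]

theorem sum_marginal (c : V) : ∑ a, marginal wt ψ c a = ∑ x, labelWeight wt ψ x :=
  Finset.sum_fiberwise _ _ _

theorem labelWeight_le_marginal (hwt : ∀ x, 0 < wt x) (hψ : ∀ v i, 0 < ψ v i) {x : V → Fin K}
    {c : V} {a : Fin K} (hx : x c = a) : labelWeight wt ψ x ≤ marginal wt ψ c a :=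
  Finset.single_le_sum (f := labelWeight wt ψ) (fun x _ => (labelWeight_pos hwt hψ x).le)
    (by simpa using hx)

theorem marginal_pos (hwt : ∀ x, 0 < wt x) (hψ : ∀ v i, 0 < ψ v i) (c : V) (a : Fin K) :
    0 < marginal wt ψ c a :=
  (labelWeight_pos hwt hψ _).trans_le (labelWeight_le_marginal hwt hψ (x := fun _ => a) rfl)

/-- Only the factor of vertex `c` changes, so modifying one entry of `ψ` performs the multiplicative
update of all labellings simultaneously. -/
theorem labelWeight_hedgeStep (η : ℝ) (Z : Fin K → ℝ) (c : V) (i : Fin K) (ρ : ℝ) (x : V → Fin K) :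
    labelWeight wt (hedgeStep η Z ψ c i ρ) x =
      labelWeight wt ψ x * if x c = i then (1 + η * (1 - ρ) * (∑ a, Z a) / Z i)⁻¹ else 1 := by
  rw [labelWeight, labelWeight, mul_assoc]
  congr 1
  have : ∀ v, hedgeStep η Z ψ c i ρ v (x v) = ψ v (x v) *
      if v = c then (if x v = i then (1 + η * (1 - ρ) * (∑ a, Z a) / Z i)⁻¹ else 1) else 1 := by
    intro v
    rw [hedgeStep]
    by_cases h₁ : v = c <;> by_cases h₂ : x v = i <;> simp [h₁, h₂, div_eq_mul_inv]
  simp only [this, Finset.prod_mul_distrib, Finset.prod_ite_eq', Finset.mem_univ, if_true]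

/-- The logarithm of the total weight, relative to the weight of `π`. -/
noncomputable def potential (wt : (V → Fin K) → ℝ) (π : V → Fin K) (ψ : V → Fin K → ℝ) : ℝ :=
  Real.log (∑ x, labelWeight wt ψ x) - Real.log (labelWeight wt ψ π)

theorem potential_nonneg (hwt : ∀ x, 0 < wt x) (hψ : ∀ v i, 0 < ψ v i) (π : V → Fin K) :
    0 ≤ potential wt π ψ :=
  sub_nonneg.2 (Real.log_le_log (labelWeight_pos hwt hψ π)
    (Finset.single_le_sum (fun x _ => (labelWeight_pos hwt hψ x).le) (Finset.mem_univ π)))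

/-- With `X = η * ℓ * W / Z i`, which is `η` times the loss estimate, the total weight drops from
`W` to `W - (1 - 1 / (1 + X)) * Z i`, while the weight of `π` loses a factor `1 + X` only if `π c =
i`. The first change is bounded through `log y ≤ y - 1`, the second through `log (1 + X) ≤ X`. -/
theorem potential_hedgeStep_le (hwt : ∀ x, 0 < wt x) (hψ : ∀ v i, 0 < ψ v i) {η : ℝ} (hη : 0 ≤ η)
    (π : V → Fin K) (c : V) (i : Fin K) {ρ : ℝ} (hρ₀ : 0 ≤ ρ) (hρ : ρ ≤ 1) :
    potential wt π (hedgeStep η (marginal wt ψ c) ψ c i ρ) ≤ potential wt π ψ -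
      η * ((1 - ρ) - η * ((∑ a, marginal wt ψ c a) / marginal wt ψ c i) -
        if π c = i then (1 - ρ) * ((∑ a, marginal wt ψ c a) / marginal wt ψ c i) else 0) := by
  have hZ := marginal_pos hwt hψ c
  have hnew := hedgeStep_pos hη hZ hψ c i hρ
  set Z := marginal wt ψ c with hZdef
  set W := ∑ a, Z a with hW
  have hWZ : Z i ≤ W := Finset.single_le_sum (fun a _ => (hZ a).le) (Finset.mem_univ i)
  have hWpos : 0 < W := (hZ i).trans_le hWZ
  have hWeq : W = ∑ x, labelWeight wt ψ x := sum_marginal c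
  set ℓ := 1 - ρ with hℓ
  have hℓ₀ : 0 ≤ ℓ := by linarith
  have hℓ₁ : ℓ ≤ 1 := by linarith
  set X := η * ℓ * W / Z i with hX
  have hX₀ : 0 ≤ X := by have := hZ i; positivity
  have total : ∑ x, labelWeight wt (hedgeStep η Z ψ c i ρ) x = W - (1 - (1 + X)⁻¹) * Z i := by
    have : ∀ x, labelWeight wt (hedgeStep η Z ψ c i ρ) x = labelWeight wt ψ x -
        (1 - (1 + X)⁻¹) * if x c = i then labelWeight wt ψ x else 0 := by
      intro x
      rw [labelWeight_hedgeStep]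
      split_ifs <;> simp only [hX, hW, hℓ] <;> ring
    simp only [this, Finset.sum_sub_distrib, ← Finset.mul_sum]
    rw [← hWeq, ← Finset.sum_filter]
    rfl
  have totalpos : 0 < ∑ x, labelWeight wt (hedgeStep η Z ψ c i ρ) x :=
    Finset.sum_pos (fun x _ => labelWeight_pos hwt hnew x) ⟨π, Finset.mem_univ π⟩
  have h₁ : Real.log (∑ x, labelWeight wt (hedgeStep η Z ψ c i ρ) x) ≤
      Real.log W - η * ℓ + η * η * (W / Z i) := by
    have e : ∑ x, labelWeight wt (hedgeStep η Z ψ c i ρ) x =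
        W * (1 - (1 - (1 + X)⁻¹) * (Z i / W)) := by
      rw [total]
      field_simp
    have pos : 0 < 1 - (1 - (1 + X)⁻¹) * (Z i / W) := by
      rw [e] at totalpos
      exact pos_of_mul_pos_right totalpos hWpos.le
    rw [e, Real.log_mul hWpos.ne' pos.ne']
    have l₁ := Real.log_le_sub_one_of_pos pos
    -- The rational factor satisfies a second-order bound of the same kind as `1 - exp (-X) ≥ X - X
    -- ^ 2 / 2`.
    have l₂ : X - X ^ 2 ≤ 1 - (1 + X)⁻¹ := by
      have : 1 - (1 + X)⁻¹ = X - X ^ 2 + X ^ 3 / (1 + X) := by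
        field_simp
        ring
      rw [this]
      have : 0 ≤ X ^ 3 / (1 + X) := by positivity
      linarith
    have l₃ : 0 ≤ Z i / W := (div_pos (hZ i) hWpos).le
    have l₄ := mul_le_mul_of_nonneg_right l₂ l₃
    have l₅ : (X - X ^ 2) * (Z i / W) = η * ℓ - η * η * ℓ ^ 2 * (W / Z i) := by
      have := (hZ i).ne'
      rw [hX]
      field_simp
    -- Dropping `ℓ ^ 2 ≤ 1` leaves a variance term whose mean over the sampled arm is exactly `η ^ 2
    -- * K`.
    have l₆ : η * η * ℓ ^ 2 * (W / Z i) ≤ η * η * (W / Z i) := by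
      have hq : 0 ≤ W / Z i := (div_pos hWpos (hZ i)).le
      have : ℓ ^ 2 ≤ 1 := by nlinarith
      nlinarith [mul_nonneg (mul_nonneg hη hη) hq]
    linarith
  have h₂ : Real.log (labelWeight wt ψ π) - Real.log (labelWeight wt (hedgeStep η Z ψ c i ρ) π) ≤
      η * if π c = i then ℓ * (W / Z i) else 0 := by
    rw [labelWeight_hedgeStep]
    split_ifs with hπ
    · have hpos : 0 < 1 + X := by linarith
      change _ - Real.log (_ * (1 + X)⁻¹) ≤ _
      rw [Real.log_mul (labelWeight_pos hwt hψ π).ne' (inv_ne_zero hpos.ne'), Real.log_inv]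
      have := Real.log_le_sub_one_of_pos hpos
      have e : X = η * (ℓ * (W / Z i)) := by rw [hX]; ring
      linarith
    · simp
  rw [potential, potential, ← hWeq]
  linarith

end Weights

/-! ### Resampling one coordinate of a product measure -/

/-- Independence of coordinate `t` from the others, in the form that a fresh copy of it does not
alter the law. On boxes, the constraint on coordinate `t` simply moves to the second factor. -/
theorem measurePreserving_update {ι Ω : Type*} [DecidableEq ι] [MeasurableSpace Ω]
    (P : ι → Measure Ω) [∀ i, IsProbabilityMeasure (P i)] (t : ι) :
    MeasurePreserving (fun z : (ι → Ω) × Ω => Function.update z.1 t z.2)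
      ((Measure.infinitePi P).prod (P t)) (Measure.infinitePi P) := by
  have hm : Measurable (fun z : (ι → Ω) × Ω => Function.update z.1 t z.2) := by
    refine measurable_pi_iff.2 fun i => ?_
    by_cases hi : i = t
    · subst hi
      simpa using measurable_snd
    · simp only [Function.update_of_ne hi]
      fun_prop
  refine ⟨hm, Measure.eq_infinitePi P fun s S hS => ?_⟩
  rw [Measure.map_apply hm (MeasurableSet.pi s.countable_toSet fun i _ => hS i)]
  have hpre : (fun z : (ι → Ω) × Ω => Function.update z.1 t z.2) ⁻¹' (s : Set ι).pi S =
      (Set.pi (s.erase t : Finset ι) S) ×ˢ (if t ∈ s then S t else Set.univ) := by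
    ext z
    simp only [Set.mem_preimage, Set.mem_pi, Set.mem_prod, Finset.coe_erase, Set.mem_sdiff,
      Finset.mem_coe, Set.mem_singleton_iff]
    constructor
    · intro h
      refine ⟨fun i hi => by simpa [Function.update_of_ne hi.2] using h i hi.1, ?_⟩
      split_ifs with ht
      · simpa using h t ht
      · trivial
    · rintro ⟨h₁, h₂⟩ i hi
      by_cases hit : i = t
      · subst hit
        simpa [hi] using h₂
      · simpa [Function.update_of_ne hit] using h₁ i ⟨hi, hit⟩
  rw [hpre, Measure.prod_prod, Measure.infinitePi_pi P fun i _ => hS i]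
  split_ifs with ht
  · rw [Finset.prod_erase_mul _ _ ht]
  · rw [measure_univ, mul_one, Finset.erase_eq_of_notMem ht]

theorem measurePreserving_prodAssoc {α β γ : Type*} [MeasurableSpace α] [MeasurableSpace β]
    [MeasurableSpace γ] (μ : Measure α) (ν : Measure β) (ρ : Measure γ) [IsProbabilityMeasure μ]
    [IsProbabilityMeasure ν] [IsProbabilityMeasure ρ] :
    MeasurePreserving (MeasurableEquiv.prodAssoc : (α × β) × γ ≃ᵐ α × β × γ)
      ((μ.prod ν).prod ρ) (μ.prod (ν.prod ρ)) :=
  ⟨MeasurableEquiv.measurable _, Measure.prodAssoc_prod⟩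

theorem measurePreserving_prodProdProdComm {α β γ δ : Type*} [MeasurableSpace α]
    [MeasurableSpace β] [MeasurableSpace γ] [MeasurableSpace δ] (μ : Measure α) (ν : Measure β)
    (ρ : Measure γ) (τ : Measure δ) [IsProbabilityMeasure μ] [IsProbabilityMeasure ν]
    [IsProbabilityMeasure ρ] [IsProbabilityMeasure τ] :
    MeasurePreserving (fun z : (α × β) × γ × δ => ((z.1.1, z.2.1), (z.1.2, z.2.2)))
      ((μ.prod ν).prod (ρ.prod τ)) ((μ.prod ρ).prod (ν.prod τ)) := by
  have h₁ := measurePreserving_prodAssoc μ ν (ρ.prod τ)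
  have h₂ := (measurePreserving_prodAssoc ν ρ τ).symm
  have h₃ := (Measure.measurePreserving_swap (μ := ν) (ν := ρ)).prod (MeasurePreserving.id τ)
  have h₄ := measurePreserving_prodAssoc ρ ν τ
  have h₅ := (measurePreserving_prodAssoc μ ρ (ν.prod τ)).symm
  exact h₅.comp (((MeasurePreserving.id μ).prod (h₄.comp (h₃.comp h₂))).comp h₁)

/-! ### Sampling -/

/-- The sample is a function of the finite set of admissible indices, and each value of that set is
described by finitely many inequalities or their negations. -/
theorem measurable_sample {K : ℕ} [NeZero K] {Ω : Type*} [MeasurableSpace Ω] {Z : Ω → Fin K → ℝ}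
    {u : Ω → ℝ} (hZ : ∀ a, Measurable fun z => Z z a) (hu : Measurable u) :
    Measurable fun z => sample (Z z) (u z) := by
  have h : Measurable fun z => (Finset.univ.filter fun i : Fin K =>
      ∑ j with j < i, Z z j ≤ u z * ∑ j, Z z j) := by
    refine measurable_to_countable' fun S => ?_
    have : (fun z => (Finset.univ.filter fun i : Fin K =>
        ∑ j with j < i, Z z j ≤ u z * ∑ j, Z z j)) ⁻¹' {S} =
        ⋂ i : Fin K, {z | ∑ j with j < i, Z z j ≤ u z * ∑ j, Z z j ↔ i ∈ S} := by
      ext z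
      simp [Finset.ext_iff]
    rw [this]
    refine MeasurableSet.iInter fun i => ?_
    have hi : MeasurableSet {z | ∑ j with j < i, Z z j ≤ u z * ∑ j, Z z j} :=
      measurableSet_le (by fun_prop) (by fun_prop)
    by_cases hS : i ∈ S
    · simpa only [hS, iff_true] using hi
    · simp only [hS, iff_false]
      exact hi.compl
  exact (Measurable.of_discrete (f := fun S : Finset (Fin K) => S.sup id)).comp h

/-- The event contains a half-open interval of length `Z i / ∑ a, Z a`. These lower bounds already
sum to `1`, so all are equalities, and the endpoint `u = 1` needs no separate treatment. -/
theorem volume_sample {K : ℕ} [NeZero K] {Z : Fin K → ℝ} (hZ : ∀ a, 0 < Z a) (i : Fin K) :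
    volume.real {u : unitInterval | sample Z u = i} = Z i / ∑ a, Z a := by
  have hmeas : Measurable fun u : unitInterval => sample Z u :=
    measurable_sample (fun _ => measurable_const) measurable_subtype_coe
  have hW : 0 < ∑ a, Z a := Finset.sum_pos (fun a _ => hZ a) ⟨0, Finset.mem_univ _⟩
  have lower : ∀ i, Z i / ∑ a, Z a ≤ volume.real {u : unitInterval | sample Z u = i} := by
    intro i
    have hpre : ∑ j with j < i, Z j + Z i ≤ ∑ a, Z a := by
      rw [add_comm, ← Finset.sum_insert (by simp)]
      exact Finset.sum_le_sum_of_subset_of_nonneg (Finset.subset_univ _) fun a _ _ => (hZ a).le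
    have h₀ : 0 ≤ ∑ j with j < i, Z j := Finset.sum_nonneg fun a _ => (hZ a).le
    have hi := hZ i
    let x : unitInterval := ⟨(∑ j with j < i, Z j) / ∑ a, Z a, by positivity,
      (div_le_one hW).2 (by linarith)⟩
    let y : unitInterval := ⟨(∑ j with j < i, Z j + Z i) / ∑ a, Z a, by positivity,
      (div_le_one hW).2 hpre⟩
    have hxy : volume.real (Set.Ico x y) = Z i / ∑ a, Z a := by
      have e : (y : ℝ) - x = Z i / ∑ a, Z a := by
        simp only [x, y]
        ring
      rw [Measure.real, unitInterval.volume_Ico, e, ENNReal.toReal_ofReal (by positivity)]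
    rw [← hxy]
    refine measureReal_mono fun u hu => ?_
    have h₁ : (∑ j with j < i, Z j) / ∑ a, Z a ≤ u := hu.1
    have h₂ : (u : ℝ) < (∑ j with j < i, Z j + Z i) / ∑ a, Z a := hu.2
    rw [div_le_iff₀ hW] at h₁
    rw [lt_div_iff₀ hW] at h₂
    refine (sample_eq_iff (fun a => (hZ a).le) u.2.1).2 ⟨h₁, fun i' hi' => h₂.trans_le ?_⟩
    rw [add_comm, ← Finset.sum_insert (by simp)]
    refine Finset.sum_le_sum_of_subset_of_nonneg (fun a ha => ?_) fun a _ _ => (hZ a).le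
    simp only [Finset.mem_insert, Finset.mem_filter, Finset.mem_univ, true_and] at ha ⊢
    rcases ha with rfl | ha
    · exact hi'
    · exact ha.trans hi'
  have htotal : ∑ i, volume.real {u : unitInterval | sample Z u = i} = 1 := by
    have := sum_measureReal_preimage_singleton (μ := (volume : Measure unitInterval))
      (f := fun u : unitInterval => sample Z u) Finset.univ
      fun i _ => hmeas (measurableSet_singleton i)
    simpa [Set.preimage] using this
  have hsum : ∑ i, Z i / ∑ a, Z a = 1 := by rw [← Finset.sum_div, div_self hW.ne']
  exact ((Finset.sum_eq_sum_iff_of_le fun i _ => lower i).1 (hsum.trans htotal.symm) i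
    (Finset.mem_univ i)).symm

theorem integral_sample {K : ℕ} [NeZero K] {Z : Fin K → ℝ} (hZ : ∀ a, 0 < Z a) (g : Fin K → ℝ) :
    ∫ u : unitInterval, g (sample Z u) = ∑ i, Z i / (∑ a, Z a) * g i := by
  have hmeas : Measurable fun u : unitInterval => sample Z u :=
    measurable_sample (fun _ => measurable_const) measurable_subtype_coe
  rw [← integral_map (φ := fun u : unitInterval => sample Z u) (f := g) hmeas.aemeasurable
    (Measurable.of_discrete).aestronglyMeasurable]
  have := Measure.isProbabilityMeasure_map (μ := (volume : Measure unitInterval)) hmeas.aemeasurable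
  rw [integral_fintype (Integrable.of_finite)]
  refine Finset.sum_congr rfl fun i _ => ?_
  rw [map_measureReal_apply hmeas (measurableSet_singleton i), ← volume_sample hZ i, smul_eq_mul]
  rfl

/-! ### The regret of exponential weights -/

/-! ### Independence of rounds, and measurability with discrete parameters. -/

section Law

variable {n K : ℕ}

/-- Replace the rewards and the random number of round `t`. -/
noncomputable def resample (t : ℕ)
    (w : ((ℕ → Fin n → Fin K → unitInterval) × (ℕ → unitInterval)) ×
      (Fin n → Fin K → unitInterval) × unitInterval) :
    (ℕ → Fin n → Fin K → unitInterval) × (ℕ → unitInterval) :=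
  (Function.update w.1.1 t w.2.1, Function.update w.1.2 t w.2.2)

/-- The law of the rewards of one round. -/
noncomputable def rewardLaw (ν : Fin n → Fin K → ProbabilityMeasure unitInterval) :
    Measure (Fin n → Fin K → unitInterval) :=
  Measure.pi fun c => Measure.pi fun i => (ν c i : Measure unitInterval)

instance (ν : Fin n → Fin K → ProbabilityMeasure unitInterval) :
    IsProbabilityMeasure (rewardLaw ν) := by
  unfold rewardLaw
  infer_instance

theorem law_eq (ν : Fin n → Fin K → ProbabilityMeasure unitInterval) :
    law ν = (Measure.infinitePi fun _ : ℕ => rewardLaw ν).prod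
      (Measure.infinitePi fun _ : ℕ => (volume : Measure unitInterval)) := rfl

instance (ν : Fin n → Fin K → ProbabilityMeasure unitInterval) : IsProbabilityMeasure (law ν) := by
  rw [law_eq]
  infer_instance

theorem measurePreserving_resample (ν : Fin n → Fin K → ProbabilityMeasure unitInterval) (t : ℕ) :
    MeasurePreserving (resample (n := n) (K := K) t)
      ((law ν).prod ((rewardLaw ν).prod volume)) (law ν) := by
  rw [law_eq]
  exact ((measurePreserving_update (fun _ : ℕ => rewardLaw ν) t).prod
    (measurePreserving_update (fun _ : ℕ => (volume : Measure unitInterval)) t)).comp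
    (measurePreserving_prodProdProdComm _ _ _ _)

theorem integral_rewardLaw (ν : Fin n → Fin K → ProbabilityMeasure unitInterval) (c : Fin n)
    (i : Fin K) : ∫ a, (a c i : ℝ) ∂(rewardLaw ν) = meanReward ν c i := by
  have h₁ := measurePreserving_eval
    (μ := fun c => Measure.pi fun i => (ν c i : Measure unitInterval)) c
  have h₂ := measurePreserving_eval (μ := fun i => (ν c i : Measure unitInterval)) i
  have h := h₂.comp h₁
  rw [meanReward, ← h.map_eq, integral_map h.aemeasurable (by fun_prop)]
  rfl

theorem meanReward_mem (ν : Fin n → Fin K → ProbabilityMeasure unitInterval) (c : Fin n)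
    (i : Fin K) : 0 ≤ meanReward ν c i ∧ meanReward ν c i ≤ 1 := by
  refine ⟨integral_nonneg fun r => r.2.1, ?_⟩
  have : Integrable (fun r : unitInterval => (r : ℝ)) (ν c i : Measure unitInterval) :=
    Integrable.of_bound (by fun_prop) 1 (ae_of_all _ fun r => by
      rw [Real.norm_eq_abs, abs_of_nonneg r.2.1]; exact r.2.2)
  calc meanReward ν c i ≤ ∫ _, (1 : ℝ) ∂(ν c i : Measure unitInterval) :=
        integral_mono this (integrable_const _) fun r => r.2.2
    _ = 1 := by simp

theorem exists_ratio_bound {p : Fin K → ℝ} (hp : ∀ i, 0 < p i) :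
    ∃ D, ∀ i, (∑ i, p i) / p i ≤ D :=
  ⟨∑ j, (∑ i, p i) / p j, fun i => Finset.single_le_sum (f := fun j => (∑ i, p i) / p j)
    (fun j _ => div_nonneg (Finset.sum_nonneg fun i _ => (hp i).le) (hp j).le) (Finset.mem_univ i)⟩

/-- Contexts and arms are random indices with countably many values; measurability may be checked
with the index frozen. -/
theorem measurable_discrete_param {Ω δ γ : Type*} [MeasurableSpace Ω] [MeasurableSpace δ]
    [Countable δ] [MeasurableSingletonClass δ] [MeasurableSpace γ] {c : Ω → δ} (hc : Measurable c)
    {F : δ → Ω → γ} (hF : ∀ d, Measurable (F d)) : Measurable fun z => F (c z) z :=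
  (measurable_from_prod_countable_right (f := fun p : δ × Ω => F p.1 p.2) hF).comp
    (hc.prodMk measurable_id)

theorem measurable_hedgeStep_snoc {Z : (Fin n → Fin K → ℝ) → Fin n → Fin K → ℝ} {η : ℝ}
    (hZ : ∀ c a, Measurable fun ψ => Z ψ c a) {Ω : Type*}
    [MeasurableSpace Ω] {t : ℕ} {p : Ω → (Fin n → Fin K → ℝ) × (Fin t → Fin K × unitInterval)}
    (hp : Measurable p) {ρ : Ω → unitInterval} (hρ : Measurable ρ) (c : Fin n) (i : Fin K) :
    Measurable fun z => ((hedgeStep η (Z (p z).1 c) (p z).1 c i (ρ z),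
      Fin.snoc (p z).2 (i, ρ z)) : (Fin n → Fin K → ℝ) × (Fin (t + 1) → Fin K × unitInterval)) := by
  have hZ' : ∀ a, Measurable fun z => Z (p z).1 c a := fun a => (hZ c a).comp hp.fst
  have hψ : ∀ v j, Measurable fun z => (p z).1 v j := fun v j => by fun_prop
  refine Measurable.prodMk (measurable_pi_iff.2 fun v => measurable_pi_iff.2 fun j => ?_)
    (measurable_pi_iff.2 fun k => ?_)
  · unfold hedgeStep
    split_ifs <;> fun_prop
  · refine Fin.lastCases ?_ (fun k => ?_) k
    · simpa using measurable_const.prodMk hρ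
    · simp only [Fin.snoc_castSucc]
      fun_prop

end Law

/-- The weights and the history after `t` rounds of exponential weights, where `Z ψ c` are the
unnormalised probabilities of the arms for weights `ψ` and context `c`. -/
noncomputable def hedgeRun {n K : ℕ} [NeZero K]
    (Z : (Fin n → Fin K → ℝ) → Fin n → Fin K → ℝ) (η : ℝ) (adv : Adversary n K)
    (z : (ℕ → Fin n → Fin K → unitInterval) × (ℕ → unitInterval)) :
    (t : ℕ) → (Fin n → Fin K → ℝ) × (Fin t → Fin K × unitInterval)
  | 0 => (fun _ _ => 1, Fin.elim0)
  | t + 1 =>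
      let p := hedgeRun Z η adv z t
      let c := adv t p.2
      let i := sample (Z p.1 c) (z.2 t)
      (hedgeStep η (Z p.1 c) p.1 c i (z.1 t c i), Fin.snoc p.2 (i, z.1 t c i))

/-! ### The idealised process and its expected regret. -/

section Hedge

variable {n K : ℕ} [NeZero K] (Z : (Fin n → Fin K → ℝ) → Fin n → Fin K → ℝ) (η : ℝ)
  (adv : Adversary n K)

/-- The context of round `t`. -/
noncomputable def hedgeContext (t : ℕ)
    (z : (ℕ → Fin n → Fin K → unitInterval) × (ℕ → unitInterval)) : Fin n :=
  adv t (hedgeRun Z η adv z t).2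

/-- The unnormalised probabilities of the arms in round `t`. -/
noncomputable def hedgeProb (t : ℕ)
    (z : (ℕ → Fin n → Fin K → unitInterval) × (ℕ → unitInterval)) : Fin K → ℝ :=
  Z (hedgeRun Z η adv z t).1 (hedgeContext Z η adv t z)

/-- The arm played in round `t`. -/
noncomputable def hedgeArm (t : ℕ)
    (z : (ℕ → Fin n → Fin K → unitInterval) × (ℕ → unitInterval)) : Fin K :=
  sample (hedgeProb Z η adv t z) (z.2 t)

/-- The process is adapted: its state before round `t` is a function of the earlier rounds only.
Therefore resampling round `t` does not affect it. -/
theorem hedgeRun_congr {z z' : (ℕ → Fin n → Fin K → unitInterval) × (ℕ → unitInterval)} {t : ℕ}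
    (h₁ : ∀ s < t, z.1 s = z'.1 s) (h₂ : ∀ s < t, z.2 s = z'.2 s) :
    hedgeRun Z η adv z t = hedgeRun Z η adv z' t := by
  induction t with
  | zero => rfl
  | succ t ih =>
    simp only [hedgeRun, ih (fun s hs => h₁ s (by omega)) fun s hs => h₂ s (by omega),
      h₁ t (by omega), h₂ t (by omega)]

theorem hedgeRun_resample (t : ℕ) (w : ((ℕ → Fin n → Fin K → unitInterval) × (ℕ → unitInterval)) ×
      (Fin n → Fin K → unitInterval) × unitInterval) :
    hedgeRun Z η adv (resample t w) t = hedgeRun Z η adv w.1 t :=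
  hedgeRun_congr Z η adv (fun _ hs => Function.update_of_ne hs.ne _ _)
    fun _ hs => Function.update_of_ne hs.ne _ _

variable {Z η adv}

/-- Measurability of the run up to time `t` is a hypothesis here and in the next two lemmas, because
they serve in the induction step of `measurable_hedgeRun`. -/
theorem measurable_hedgeContext_of (hadv : ∀ t, Measurable (adv t)) {t : ℕ}
    (h : Measurable fun z => hedgeRun Z η adv z t) : Measurable (hedgeContext Z η adv t) :=
  (hadv t).comp h.snd

theorem measurable_hedgeProb_of (hZ : ∀ c a, Measurable fun ψ => Z ψ c a)
    (hadv : ∀ t, Measurable (adv t)) {t : ℕ}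
    (h : Measurable fun z => hedgeRun Z η adv z t) (a : Fin K) :
    Measurable fun z => hedgeProb Z η adv t z a :=
  measurable_discrete_param (measurable_hedgeContext_of hadv h)
    (F := fun c z => Z (hedgeRun Z η adv z t).1 c a) fun c => (hZ c a).comp h.fst

theorem measurable_hedgeArm_of (hZ : ∀ c a, Measurable fun ψ => Z ψ c a)
    (hadv : ∀ t, Measurable (adv t)) {t : ℕ}
    (h : Measurable fun z => hedgeRun Z η adv z t) : Measurable (hedgeArm Z η adv t) :=
  measurable_sample (measurable_hedgeProb_of hZ hadv h) (by fun_prop)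

theorem measurable_hedgeRun (hZ : ∀ c a, Measurable fun ψ => Z ψ c a)
    (hadv : ∀ t, Measurable (adv t)) (t : ℕ) : Measurable fun z => hedgeRun Z η adv z t := by
  induction t with
  | zero => exact measurable_const
  | succ t ih =>
    exact measurable_discrete_param
      ((measurable_hedgeContext_of hadv ih).prodMk (measurable_hedgeArm_of hZ hadv ih))
      (F := fun d z => ((hedgeStep η (Z (hedgeRun Z η adv z t).1 d.1) (hedgeRun Z η adv z t).1 d.1 d.2
        (z.1 t d.1 d.2), Fin.snoc (hedgeRun Z η adv z t).2 (d.2, z.1 t d.1 d.2)) :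
        (Fin n → Fin K → ℝ) × (Fin (t + 1) → Fin K × unitInterval)))
      fun d => measurable_hedgeStep_snoc hZ ih (by fun_prop) d.1 d.2

/-- The regret of one round in which arm `sample p u` is played for context `c`, minus the loss of
this arm and the contributions of the estimated losses. -/
noncomputable def roundGap (ν : Fin n → Fin K → ProbabilityMeasure unitInterval) (π : Fin n → Fin K)
    (η : ℝ) (p : Fin K → ℝ) (c : Fin n) (a : Fin n → Fin K → unitInterval) (u : unitInterval) : ℝ :=
  (meanReward ν c (π c) - meanReward ν c (sample p u)) -
    ((1 - a c (sample p u)) - η * ((∑ i, p i) / p (sample p u)) -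
      if π c = sample p u then (1 - a c (sample p u)) * ((∑ i, p i) / p (sample p u)) else 0)

theorem abs_roundGap_le (ν : Fin n → Fin K → ProbabilityMeasure unitInterval) (π : Fin n → Fin K)
    (hη : 0 ≤ η) {p : Fin K → ℝ} (hp : ∀ i, 0 < p i) {D : ℝ} (hD : ∀ i, (∑ i, p i) / p i ≤ D)
    (c : Fin n) (a : Fin n → Fin K → unitInterval) (u : unitInterval) :
    |roundGap ν π η p c a u| ≤ 2 + η * D + D := by
  have h₁ := meanReward_mem ν c (π c)
  have h₂ := meanReward_mem ν c (sample p u)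
  have h₃ := (a c (sample p u)).2
  have h₄ := hD (sample p u)
  have h₅ : 0 ≤ (∑ i, p i) / p (sample p u) :=
    div_nonneg (Finset.sum_nonneg fun i _ => (hp i).le) (hp _).le
  have h₆ := mul_nonneg hη h₅
  have h₇ := mul_le_mul_of_nonneg_left h₄ hη
  have h₈ : 0 ≤ 1 - (a c (sample p u) : ℝ) := by linarith [h₃.2]
  have h₉ : (1 - (a c (sample p u) : ℝ)) * ((∑ i, p i) / p (sample p u)) ≤
      1 * ((∑ i, p i) / p (sample p u)) :=
    mul_le_mul_of_nonneg_right (by linarith [h₃.1]) h₅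
  have h₁₀ := mul_nonneg h₈ h₅
  rw [roundGap, abs_le]
  split_ifs <;> constructor <;> linarith [h₃.1, h₃.2]

theorem measurable_roundGap {Ω : Type*} [MeasurableSpace Ω]
    (ν : Fin n → Fin K → ProbabilityMeasure unitInterval) (π : Fin n → Fin K)
    {p : Ω → Fin K → ℝ} (hp : ∀ i, Measurable fun z => p z i) {c : Ω → Fin n} (hc : Measurable c)
    {a : Ω → Fin n → Fin K → unitInterval} (ha : Measurable a) {u : Ω → unitInterval}
    (hu : Measurable u) : Measurable fun z => roundGap ν π η (p z) (c z) (a z) (u z) := by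
  refine measurable_discrete_param (hc.prodMk (measurable_sample hp (u := fun z => (u z : ℝ))
    (by fun_prop))) (F := fun d z => (meanReward ν d.1 (π d.1) - meanReward ν d.1 d.2) -
    ((1 - a z d.1 d.2) - η * ((∑ i, p z i) / p z d.2) -
      if π d.1 = d.2 then (1 - a z d.1 d.2) * ((∑ i, p z i) / p z d.2) else 0)) fun d => ?_
  split_ifs <;> fun_prop

/-- The random number that selects the arm is independent of the rewards, so the reward of the
selected arm may be replaced by its mean. -/
theorem integral_affine_sample (ν : Fin n → Fin K → ProbabilityMeasure unitInterval)
    {p : Fin K → ℝ} (hp : ∀ i, 0 < p i) (c : Fin n) (A B : Fin K → ℝ) :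
    ∫ a, ∫ u : unitInterval, A (sample p u) + B (sample p u) * (a c (sample p u) : ℝ)
      ∂volume ∂(rewardLaw ν) = ∑ i, p i / (∑ i, p i) * (A i + B i * meanReward ν c i) := by
  have ha : ∀ i, Integrable (fun a : Fin n → Fin K → unitInterval => (a c i : ℝ)) (rewardLaw ν) :=
    fun i => Integrable.of_bound (measurable_subtype_coe.comp
      (by fun_prop : Measurable fun a : Fin n → Fin K → unitInterval => a c i)).aestronglyMeasurable
      1 (ae_of_all _ fun a => by
      rw [Real.norm_eq_abs, abs_of_nonneg (a c i).2.1]; exact (a c i).2.2)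
  have inner : ∀ a : Fin n → Fin K → unitInterval,
      ∫ u : unitInterval, A (sample p u) + B (sample p u) * (a c (sample p u) : ℝ) =
        ∑ i, p i / (∑ i, p i) * (A i + B i * (a c i : ℝ)) := fun a =>
    integral_sample hp fun i => A i + B i * (a c i : ℝ)
  rw [integral_congr_ae (ae_of_all _ inner), integral_finsetSum _ fun i _ => by
    exact ((integrable_const (A i)).add ((ha i).const_mul (B i))).const_mul _]
  refine Finset.sum_congr rfl fun i _ => ?_
  rw [integral_const_mul, integral_add (integrable_const _) ((ha i).const_mul _),
    integral_const_mul, integral_rewardLaw, integral_const, probReal_univ, one_smul]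

theorem integrable_roundGap (ν : Fin n → Fin K → ProbabilityMeasure unitInterval)
    (π : Fin n → Fin K) (hη : 0 ≤ η) {p : Fin K → ℝ} (hp : ∀ i, 0 < p i) (c : Fin n) :
    Integrable (fun w : (Fin n → Fin K → unitInterval) × unitInterval =>
      roundGap ν π η p c w.1 w.2) ((rewardLaw ν).prod volume) := by
  obtain ⟨D, hD⟩ := exists_ratio_bound hp
  exact Integrable.of_bound (measurable_roundGap (p := fun _ => p) (c := fun _ => c) ν π
    (fun _ => measurable_const) measurable_const measurable_fst measurable_snd).aestronglyMeasurable
    (2 + η * D + D)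
    (ae_of_all _ fun w => abs_roundGap_le ν π hη hp hD c w.1 w.2)

/-- Importance weighting is unbiased. The means of the played loss and of the estimated loss of `π
c` are the true ones and cancel against the regret; what remains is `η` times the mean of `(∑ i, p
i) / p I` for the played arm `I`, and this mean is `K`. -/
theorem integral_roundGap (ν : Fin n → Fin K → ProbabilityMeasure unitInterval) (π : Fin n → Fin K)
    (hη : 0 ≤ η) {p : Fin K → ℝ} (hp : ∀ i, 0 < p i) (c : Fin n) :
    ∫ w, roundGap ν π η p c w.1 w.2 ∂((rewardLaw ν).prod (volume : Measure unitInterval)) =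
      η * K := by
  rw [integral_prod _ (integrable_roundGap ν π hη hp c)]
  have hW : 0 < ∑ i, p i := Finset.sum_pos (fun i _ => hp i) ⟨0, Finset.mem_univ _⟩
  have key := integral_affine_sample ν hp c (fun i => meanReward ν c (π c) - meanReward ν c i - 1 +
    η * ((∑ i, p i) / p i) + if π c = i then (∑ i, p i) / p i else 0)
    (fun i => 1 - if π c = i then (∑ i, p i) / p i else 0)
  have term : ∀ i, p i / (∑ i, p i) * (meanReward ν c (π c) - meanReward ν c i - 1 +
      η * ((∑ i, p i) / p i) + (if π c = i then (∑ i, p i) / p i else 0) +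
      (1 - if π c = i then (∑ i, p i) / p i else 0) * meanReward ν c i) =
      p i / (∑ i, p i) * (meanReward ν c (π c) - 1) + η +
        if π c = i then 1 - meanReward ν c i else 0 := by
    intro i
    have := (hp i).ne'
    generalize (∑ i, p i) = W at *
    have := hW.ne'
    split_ifs <;> field_simp <;> ring
  rw [Finset.sum_congr rfl fun i _ => term i, Finset.sum_add_distrib, Finset.sum_add_distrib,
    ← Finset.sum_mul, ← Finset.sum_div, div_self hW.ne', Finset.sum_ite_eq,
    if_pos (Finset.mem_univ _), Finset.sum_const, Finset.card_univ, Fintype.card_fin,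
    nsmul_eq_mul] at key
  calc _ = _ := integral_congr_ae (ae_of_all _ fun a => integral_congr_ae (ae_of_all _ fun u => by
        simp only [roundGap]
        split_ifs <;> ring))
    _ = _ := key
    _ = η * K := by ring

/-- A marginal is at least the weight of a constant labelling, and the total is at most the total
prior weight. The bound may be huge; it yields integrability and positivity and does not enter the
regret. -/
theorem exists_marginal_ratio_bound {wt : (Fin n → Fin K) → ℝ} (hwt : ∀ x, 0 < wt x) {b : ℝ}
    (hb : 0 < b) : ∃ D, 0 ≤ D ∧ ∀ ψ : Fin n → Fin K → ℝ, (∀ v i, b ≤ ψ v i) → (∀ v i, ψ v i ≤ 1) →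
      ∀ c i, (∑ a, marginal wt ψ c a) / marginal wt ψ c i ≤ D := by
  obtain ⟨x₀, hx₀⟩ := Finite.exists_min wt
  refine ⟨(∑ x, wt x) / (wt x₀ * b ^ n), ?_, fun ψ h₁ h₂ c i => ?_⟩
  · have := hwt x₀
    have := Finset.sum_nonneg fun x (_ : x ∈ Finset.univ) => (hwt x).le
    positivity
  have hψ : ∀ v i, 0 < ψ v i := fun v i => hb.trans_le (h₁ v i)
  rw [sum_marginal]
  refine div_le_div₀ (Finset.sum_nonneg fun x _ => (hwt x).le)
    (Finset.sum_le_sum fun x _ => ?_) (mul_pos (hwt x₀) (by positivity)) ?_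
  · exact mul_le_of_le_one_right (hwt x).le
      (Finset.prod_le_one (fun v _ => (hψ v _).le) fun v _ => h₂ v _)
  · refine le_trans ?_ (labelWeight_le_marginal hwt hψ (x := fun _ => i) rfl)
    refine mul_le_mul (hx₀ _) ?_ (by positivity) (hwt _).le
    simpa using Finset.prod_le_prod (s := Finset.univ) (fun _ _ => hb.le)
      fun (v : Fin n) _ => h₁ v i

/-- The weights of exponential weights stay above a positive bound. -/
theorem exists_hedgeRun_bound {wt : (Fin n → Fin K) → ℝ} (hwt : ∀ x, 0 < wt x) (hη : 0 ≤ η)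
    (adv : Adversary n K) (t : ℕ) :
    (∃ b > 0, ∀ z v i, b ≤ (hedgeRun (marginal wt) η adv z t).1 v i) ∧
      ∀ z v i, (hedgeRun (marginal wt) η adv z t).1 v i ≤ 1 := by
  induction t with
  | zero => exact ⟨⟨1, one_pos, fun _ _ _ => le_rfl⟩, fun _ _ _ => le_rfl⟩
  | succ t ih =>
    obtain ⟨⟨b, hb, h₁⟩, h₂⟩ := ih
    obtain ⟨D, hD₀, hD⟩ := exists_marginal_ratio_bound hwt hb
    -- The divisor of an update lies between `1` and `1 + η * D`.
    have key : ∀ z v i, (hedgeRun (marginal wt) η adv z t).1 v i / (1 + η * D) ≤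
        (hedgeRun (marginal wt) η adv z (t + 1)).1 v i ∧
        (hedgeRun (marginal wt) η adv z (t + 1)).1 v i ≤ (hedgeRun (marginal wt) η adv z t).1 v i := by
      intro z v i
      have hηD := mul_nonneg hη hD₀
      have hpos : 0 < (hedgeRun (marginal wt) η adv z t).1 v i := hb.trans_le (h₁ z v i)
      have hD' := hD _ (h₁ z) (h₂ z)
      have hψ : ∀ v i, 0 < (hedgeRun (marginal wt) η adv z t).1 v i := fun v i =>
        hb.trans_le (h₁ z v i)
      simp only [hedgeRun, hedgeStep]
      split_ifs
      · set c := adv t (hedgeRun (marginal wt) η adv z t).2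
        set ψ := (hedgeRun (marginal wt) η adv z t).1
        set k := sample (marginal wt ψ c) (z.2 t)
        have h₃ := (z.1 t c k).2
        have h₄ : 0 ≤ (∑ a, marginal wt ψ c a) / marginal wt ψ c k :=
          div_nonneg (Finset.sum_nonneg fun a _ => (marginal_pos hwt hψ c a).le)
            (marginal_pos hwt hψ c k).le
        have h₅ : 0 ≤ η * (1 - (z.1 t c k : ℝ)) := mul_nonneg hη (by linarith [h₃.2])
        have h₆ : η * (1 - (z.1 t c k : ℝ)) ≤ η := mul_le_of_le_one_right hη (by linarith [h₃.1])
        have h₇ := mul_le_mul h₆ (hD' c k) h₄ hη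
        have h₈ := mul_nonneg h₅ h₄
        rw [mul_div_assoc]
        exact ⟨div_le_div_of_nonneg_left hpos.le (by linarith) (by linarith),
          div_le_self hpos.le (by linarith)⟩
      · exact ⟨div_le_self hpos.le (by linarith), le_rfl⟩
    have hηD := mul_nonneg hη hD₀
    refine ⟨⟨b / (1 + η * D), by positivity, fun z v i => ?_⟩, fun z v i =>
      (key z v i).2.trans (h₂ z v i)⟩
    exact (div_le_div_of_nonneg_right (h₁ z v i) (by positivity)).trans (key z v i).1

/-- The pseudo-regret of exponential weights with prior `wt`, compared with the policy `π`. -/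
theorem hedge_regret (ν : Fin n → Fin K → ProbabilityMeasure unitInterval)
    (hadv : ∀ t, Measurable (adv t)) {wt : (Fin n → Fin K) → ℝ} (hwt : ∀ x, 0 < wt x) (hη : 0 < η)
    (π : Fin n → Fin K) (T : ℕ) :
    Integrable (fun z => ∑ t ∈ Finset.range T,
      (meanReward ν (hedgeContext (marginal wt) η adv t z) (π (hedgeContext (marginal wt) η adv t z)) -
        meanReward ν (hedgeContext (marginal wt) η adv t z) (hedgeArm (marginal wt) η adv t z)))
      (law ν) ∧
    ∫ z, ∑ t ∈ Finset.range T,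
      (meanReward ν (hedgeContext (marginal wt) η adv t z) (π (hedgeContext (marginal wt) η adv t z)) -
        meanReward ν (hedgeContext (marginal wt) η adv t z) (hedgeArm (marginal wt) η adv t z))
      ∂(law ν) ≤ Real.log ((∑ x, wt x) / wt π) / η + T * (η * K) := by
  set Z := marginal wt with hZdef
  have hZ : ∀ c a, Measurable fun ψ => Z ψ c a := fun c a => by
    simp only [hZdef, marginal, labelWeight]
    fun_prop
  have hrun := measurable_hedgeRun (η := η) hZ hadv
  have hctx : ∀ t, Measurable (hedgeContext Z η adv t) := fun t =>
    measurable_hedgeContext_of hadv (hrun t)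
  have hprob : ∀ t a, Measurable fun z => hedgeProb Z η adv t z a := fun t a =>
    measurable_hedgeProb_of hZ hadv (hrun t) a
  have harm : ∀ t, Measurable (hedgeArm Z η adv t) := fun t => measurable_hedgeArm_of hZ hadv (hrun t)
  have hψ : ∀ t z v i, 0 < (hedgeRun Z η adv z t).1 v i := fun t z v i => by
    obtain ⟨⟨b, hb, h⟩, -⟩ := exists_hedgeRun_bound hwt hη.le adv t
    exact hb.trans_le (h z v i)
  have hp : ∀ t z i, 0 < hedgeProb Z η adv t z i := fun t z i => marginal_pos hwt (hψ t z) _ _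
  have hregret : ∀ t, Integrable (fun z =>
      meanReward ν (hedgeContext Z η adv t z) (π (hedgeContext Z η adv t z)) -
        meanReward ν (hedgeContext Z η adv t z) (hedgeArm Z η adv t z)) (law ν) := fun t => by
    refine Integrable.of_bound (Measurable.aestronglyMeasurable ?_) 1 (ae_of_all _ fun z => ?_)
    · exact measurable_discrete_param ((hctx t).prodMk (harm t))
        (F := fun d _ => meanReward ν d.1 (π d.1) - meanReward ν d.1 d.2) fun _ => measurable_const
    · have h₁ := meanReward_mem ν (hedgeContext Z η adv t z) (π (hedgeContext Z η adv t z))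
      have h₂ := meanReward_mem ν (hedgeContext Z η adv t z) (hedgeArm Z η adv t z)
      rw [Real.norm_eq_abs, abs_le]
      constructor <;> linarith
  let G : ℕ → (ℕ → Fin n → Fin K → unitInterval) × (ℕ → unitInterval) → ℝ := fun t z =>
    roundGap ν π η (hedgeProb Z η adv t z) (hedgeContext Z η adv t z) (z.1 t) (z.2 t)
  have hGint : ∀ t, Integrable (G t) (law ν) := fun t => by
    obtain ⟨⟨b, hb, h₁⟩, h₂⟩ := exists_hedgeRun_bound hwt hη.le adv t
    obtain ⟨D, -, hD⟩ := exists_marginal_ratio_bound hwt hb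
    exact Integrable.of_bound (measurable_roundGap ν π (hprob t) (hctx t) (by fun_prop)
      (by fun_prop)).aestronglyMeasurable (2 + η * D + D)
      (ae_of_all _ fun z => abs_roundGap_le ν π hη.le (hp t z) (hD _ (h₁ z) (h₂ z) _) _ _ _)
  -- After resampling round `t`, probabilities and context depend on the old randomness and the
  -- reward and the random number on the new, so the inner integral is `integral_roundGap` for fixed
  -- probabilities and context.
  have hG : ∀ t, ∫ z, G t z ∂(law ν) = η * K := fun t => by
    have hmp := measurePreserving_resample (n := n) (K := K) ν t
    have hres : ∀ w, G t (resample t w) = roundGap ν π η (hedgeProb Z η adv t w.1)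
        (hedgeContext Z η adv t w.1) w.2.1 w.2.2 := fun w => by
      simp only [G, hedgeProb, hedgeContext, hedgeRun_resample]
      simp [resample]
    have hint : Integrable (fun w => G t (resample t w))
        ((law ν).prod ((rewardLaw ν).prod (volume : Measure unitInterval))) :=
      hmp.integrable_comp_of_integrable (hGint t)
    rw [← hmp.map_eq, integral_map hmp.aemeasurable
      (by rw [hmp.map_eq]; exact (hGint t).aestronglyMeasurable), integral_prod _ hint]
    simp only [hres, integral_roundGap ν π hη.le (hp t _)]
    simp
  -- Pathwise telescoping. The regret of a round minus `G` is the bracket in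
  -- `potential_hedgeStep_le`, and the initial potential, with all vertex factors `1`, is the
  -- logarithm on the right.
  have hpath : ∀ z, η * ∑ t ∈ Finset.range T,
      ((meanReward ν (hedgeContext Z η adv t z) (π (hedgeContext Z η adv t z)) -
        meanReward ν (hedgeContext Z η adv t z) (hedgeArm Z η adv t z)) - G t z) ≤
      Real.log ((∑ x, wt x) / wt π) - potential wt π (hedgeRun Z η adv z T).1 := by
    intro z
    induction T with
    | zero =>
      have hW : 0 < ∑ x, wt x := Finset.sum_pos (fun x _ => hwt x) ⟨π, Finset.mem_univ π⟩
      simp [hedgeRun, potential, labelWeight, Real.log_div hW.ne' (hwt π).ne']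
    | succ T ih =>
      have hstep := potential_hedgeStep_le hwt (hψ T z) hη.le π (hedgeContext Z η adv T z)
        (hedgeArm Z η adv T z) (ρ := z.1 T (hedgeContext Z η adv T z) (hedgeArm Z η adv T z))
        (z.1 T _ _).2.1 (z.1 T _ _).2.2
      rw [Finset.sum_range_succ, mul_add]
      have e : (hedgeRun Z η adv z (T + 1)).1 = hedgeStep η
          (marginal wt (hedgeRun Z η adv z T).1 (hedgeContext Z η adv T z)) (hedgeRun Z η adv z T).1
          (hedgeContext Z η adv T z) (hedgeArm Z η adv T z)
          (z.1 T (hedgeContext Z η adv T z) (hedgeArm Z η adv T z)) := rfl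
      rw [e]
      have hGe : (meanReward ν (hedgeContext Z η adv T z) (π (hedgeContext Z η adv T z)) -
          meanReward ν (hedgeContext Z η adv T z) (hedgeArm Z η adv T z)) - G T z =
          (1 - (z.1 T (hedgeContext Z η adv T z) (hedgeArm Z η adv T z) : ℝ)) -
          η * ((∑ i, hedgeProb Z η adv T z i) / hedgeProb Z η adv T z (hedgeArm Z η adv T z)) -
          if π (hedgeContext Z η adv T z) = hedgeArm Z η adv T z then
            (1 - (z.1 T (hedgeContext Z η adv T z) (hedgeArm Z η adv T z) : ℝ)) *
            ((∑ i, hedgeProb Z η adv T z i) / hedgeProb Z η adv T z (hedgeArm Z η adv T z)) else 0 :=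
        sub_sub_cancel _ _
      rw [hGe]
      have hprobe : hedgeProb Z η adv T z =
        marginal wt (hedgeRun Z η adv z T).1 (hedgeContext Z η adv T z) := rfl
      rw [hprobe]
      linarith
  refine ⟨integrable_finsetSum _ fun t _ => hregret t, ?_⟩
  have hbound : ∀ z, ∑ t ∈ Finset.range T,
      (meanReward ν (hedgeContext Z η adv t z) (π (hedgeContext Z η adv t z)) -
        meanReward ν (hedgeContext Z η adv t z) (hedgeArm Z η adv t z)) ≤
      Real.log ((∑ x, wt x) / wt π) / η + ∑ t ∈ Finset.range T, G t z := by
    intro z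
    have h₁ := hpath z
    have h₂ := potential_nonneg hwt (hψ T z) π
    rw [Finset.sum_sub_distrib] at h₁
    have h₃ := (le_div_iff₀' hη).2 (h₁.trans (sub_le_self _ h₂))
    linarith
  calc _ ≤ ∫ z, (Real.log ((∑ x, wt x) / wt π) / η + ∑ t ∈ Finset.range T, G t z) ∂(law ν) :=
        integral_mono (integrable_finsetSum _ fun t _ => hregret t)
          ((integrable_const _).add (integrable_finsetSum _ fun t _ => hGint t)) hbound
    _ = Real.log ((∑ x, wt x) / wt π) / η + T * (η * K) := by
        rw [integral_add (integrable_const _) (integrable_finsetSum _ fun t _ => hGint t),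
          integral_finsetSum _ fun t _ => hGint t, Finset.sum_congr rfl fun t _ => hG t]
        simp

end Hedge

/-! ### The program runs exponential weights -/

/-- The memory holds the input, the search order, the parameters and the weights `ψ`. -/
structure Ready {n K : ℕ} (α η : ℝ) (ch pa : ℕ → Fin n) (ψ : Fin n → Fin K → ℝ) (s : State) :
    Prop where
  vertices : s.nat 0 0 0 = n
  arms : s.nat 1 0 0 = K
  child : ∀ e < n - 1, s.nat 8 0 e = ch e
  parent : ∀ e < n - 1, s.nat 9 0 e = pa e
  cut : s.real 4 0 0 = α
  rate : s.real 5 0 0 = η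
  weights : ∀ (v : Fin n) (i : Fin K), s.real 1 v i = ψ v i

theorem Ready.congr {n K : ℕ} {α η : ℝ} {ch pa : ℕ → Fin n} {ψ : Fin n → Fin K → ℝ} {s s' : State}
    (h : Ready α η ch pa ψ s) (hn : ∀ a ∈ [0, 1, 8, 9], s'.nat a = s.nat a)
    (hr : ∀ a ∈ [1, 4, 5], s'.real a = s.real a) : Ready α η ch pa ψ s' where
  vertices := by rw [hn 0 (by simp), h.vertices]
  arms := by rw [hn 1 (by simp), h.arms]
  child := by rw [hn 8 (by simp)]; exact h.child
  parent := by rw [hn 9 (by simp)]; exact h.parent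
  cut := by rw [hr 4 (by simp), h.cut]
  rate := by rw [hr 5 (by simp), h.rate]
  weights := by rw [hr 1 (by simp)]; exact h.weights

/-- The search order and `m` are obtained before `ω` is given, so that one prior serves all
outcomes. This is possible because the preparation draws nothing: it is analysed with a dummy seed,
which is then replaced. -/
theorem prepare_spec {n : ℕ} {G : SimpleGraph (Fin n)} (hG : G.Connected) {r : Fin n}
    (hr : (r : ℕ) = 0) (K T f : ℕ) :
    ∃ (ch pa : ℕ → Fin n) (m : ℕ), SearchOrder G r ch pa (n - 1) ∧
      (1 ≤ f → T * K ≤ m ^ 2 * f) ∧ (1 ≤ m → (m - 1) ^ 2 * f < T * K) ∧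
      ∀ ω, Ready (1 / ((n : ℝ) * K)) (1 / m) ch pa (fun (_ : Fin n) (_ : Fin K) => 1)
        (treeHedge.prepare.exec (initialState G K T f ω)) ∧
        (treeHedge.prepare.exec (initialState G K T f ω)).seed = ω := by
  set s₀ := initialState G K T f fun _ => 0 with hs₀
  have f₁ : ∀ a ∈ [0, 1, 2, 3], (graphSearch.exec s₀).nat a = s₀.nat a := fun a ha =>
    Cmd.exec_nat_of_notMem _ (by
      simp only [List.mem_cons, List.not_mem_nil, or_false] at ha
      rcases ha with rfl | rfl | rfl | rfl <;> decide) _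
  have r₁ : (graphSearch.exec s₀).real = s₀.real := by
    funext a
    exact Cmd.exec_real_of_notMem _ (by
      simp [graphSearch, findEdge, setNatCell, Cmd.realWrites]) _
  have f₂ : ∀ s a, a ≠ 12 → a ≠ 13 → (initWeights.exec s).nat a = s.nat a := fun s a h₁ h₂ =>
    Cmd.exec_nat_of_notMem _ (by simp [initWeights, Cmd.natWrites, h₁, h₂]) _
  have r₂ : ∀ s a, a ≠ 1 → (initWeights.exec s).real a = s.real a := fun s a h₁ =>
    Cmd.exec_real_of_notMem _ (by simp [initWeights, Cmd.realWrites, h₁]) _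
  have f₃ : ∀ s a, a ≠ 12 → (initRate.exec s).nat a = s.nat a := fun s a h₁ =>
    Cmd.exec_nat_of_notMem _ (by simp [initRate, setRealCell, Cmd.natWrites, h₁]) _
  have r₃ : ∀ s a, a ≠ 5 → (initRate.exec s).real a = s.real a := fun s a h₁ =>
    Cmd.exec_real_of_notMem _ (by simp [initRate, setRealCell, Cmd.realWrites, h₁]) _
  have f₄ : ∀ s, (initCut.exec s).nat = s.nat := fun s => rfl
  have r₄ : ∀ s a, a ≠ 4 → (initCut.exec s).real a = s.real a := fun s a h₁ =>
    Cmd.exec_real_of_notMem _ (by simp [initCut, setRealCell, Cmd.realWrites, h₁]) _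
  have e₀ : s₀.nat 0 0 0 = n := by simp [hs₀, initialState]
  have e₁ : s₀.nat 1 0 0 = K := by simp [hs₀, initialState]
  have e₂ : s₀.nat 2 0 0 = T := by simp [hs₀, initialState]
  have e₃ : s₀.nat 3 0 0 = f := by simp [hs₀, initialState]
  obtain ⟨ch, pa, hord, h8, h9⟩ := graphSearch_spec hG (s := s₀) e₀ (by
      intro u v
      simp only [hs₀, initialState, if_true]
      split_ifs with h
      · obtain ⟨u', v', hu, hv, h⟩ := h
        rw [← Fin.ext hu, ← Fin.ext hv]
        simpa using h
      · simpa using fun h' => h ⟨u, v, rfl, rfl, h'⟩) (by simp [hs₀, initialState]) hr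
  set s₁ := graphSearch.exec s₀
  have hw := initWeights_spec (n := n) (K := K) (s := s₁) (by rw [f₁ 0 (by simp), e₀])
    (by rw [f₁ 1 (by simp), e₁])
  set s₂ := initWeights.exec s₁ with hs₂
  obtain ⟨m, hm, hm₁, hm₂⟩ := initRate_spec (K := K) (T := T) (f := f) (s := s₂)
    (by rw [hs₂, f₂ _ _ (by decide) (by decide), f₁ 1 (by simp), e₁])
    (by rw [hs₂, f₂ _ _ (by decide) (by decide), f₁ 2 (by simp), e₂])
    (by rw [hs₂, f₂ _ _ (by decide) (by decide), f₁ 3 (by simp), e₃])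
    (by rw [hs₂, r₂ _ _ (by decide), r₁]; rfl)
  set s₃ := initRate.exec s₂ with hs₃
  have hn₃ : ∀ a, a ≠ 12 → a ≠ 13 → s₃.nat a = s₁.nat a := fun a h₁ h₂ => by
    rw [hs₃, f₃ _ _ h₁, hs₂, f₂ _ _ h₁ h₂]
  have hready : Ready (1 / ((n : ℝ) * K)) (1 / m) ch pa (fun (_ : Fin n) (_ : Fin K) => 1)
      (treeHedge.prepare.exec s₀) := by
    change Ready _ _ _ _ _ (initCut.exec s₃)
    refine ⟨?_, ?_, fun e he => ?_, fun e he => ?_, ?_, ?_, fun v i => ?_⟩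
    · rw [f₄, hn₃ _ (by decide) (by decide), f₁ 0 (by simp), e₀]
    · rw [f₄, hn₃ _ (by decide) (by decide), f₁ 1 (by simp), e₁]
    · rw [f₄, hn₃ _ (by decide) (by decide), h8 e he]
    · rw [f₄, hn₃ _ (by decide) (by decide), h9 e he]
    · have h₀ : s₃.nat 0 0 0 = n := by rw [hn₃ _ (by decide) (by decide), f₁ 0 (by simp), e₀]
      have h₁ : s₃.nat 1 0 0 = K := by rw [hn₃ _ (by decide) (by decide), f₁ 1 (by simp), e₁]
      simp [initCut, setRealCell, Cmd.exec, State.tick, State.writeReal, RealExpr.eval,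
        NatExpr.eval, natCell, h₀, h₁]
    · rw [r₄ _ _ (by decide), hm]
    · rw [r₄ _ _ (by decide), hs₃, r₃ _ _ (by decide), hw]
  refine ⟨ch, pa, m, hord, hm₁, hm₂, fun ω => ?_⟩
  have hseed : treeHedge.prepare.exec (initialState G K T f ω) =
      (treeHedge.prepare.exec s₀).withSeed ω :=
    Cmd.exec_withSeed _ (by
      simp [treeHedge, graphSearch, findEdge, setNatCell, setRealCell, initWeights, initRate, initCut,
        Cmd.DrawFree]) s₀ ω
  rw [hseed]
  exact ⟨hready.congr (fun _ _ => rfl) fun _ _ => rfl, rfl⟩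

section Play

variable {n K : ℕ} {α η : ℝ} {ch pa : ℕ → Fin n}

theorem update_spec {ψ : Fin n → Fin K → ℝ} {s : State} (hs : Ready α η ch pa ψ s) {c : Fin n}
    (hc : s.nat 5 0 0 = c) {i : Fin K} (hi : s.nat 6 0 0 = i) {Z : Fin K → ℝ}
    (hZ : ∀ a : Fin K, s.real 3 0 a = Z a) (hW : s.real 7 0 0 = ∑ a, Z a) (ρ : ℝ) :
    Ready α η ch pa (hedgeStep η Z ψ c i ρ) (treeHedge.update.exec (s.writeReal 0 0 0 ρ)) := by
  have hr : ∀ a, a ≠ 0 → (s.writeReal 0 0 0 ρ).real a = s.real a := fun a ha => by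
    simp [State.writeReal, ha]
  have h₀ : (s.writeReal 0 0 0 ρ).real 0 0 0 = ρ := by simp [State.writeReal]
  have hn : (s.writeReal 0 0 0 ρ).nat = s.nat := rfl
  have hn' : (treeHedge.update.exec (s.writeReal 0 0 0 ρ)).nat = s.nat := rfl
  have hr' : ∀ a, a ≠ 1 → (treeHedge.update.exec (s.writeReal 0 0 0 ρ)).real a =
      (s.writeReal 0 0 0 ρ).real a := fun a ha =>
    Cmd.exec_real_of_notMem _ (by simp [treeHedge, Cmd.realWrites, ha]) _
  refine ⟨by rw [hn', hs.vertices], by rw [hn', hs.arms], by rw [hn']; exact hs.child,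
    by rw [hn']; exact hs.parent, by rw [hr' 4 (by decide), hr 4 (by decide), hs.cut],
    by rw [hr' 5 (by decide), hr 5 (by decide), hs.rate], fun v j => ?_⟩
  generalize s.writeReal 0 0 0 ρ = s' at *
  simp only [treeHedge, Cmd.exec, State.tick, State.writeReal, natCell, realCell, NatExpr.eval,
    RealExpr.eval, hn, hc, hi, hr 1 (by decide), hr 3 (by decide), hr 5 (by decide),
    hr 7 (by decide), h₀, hZ, hW, hs.rate, hs.weights, true_and, Nat.cast_one, hedgeStep,
    Fin.val_inj]
  split_ifs with h
  · rw [h.1, h.2]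
  · rfl

variable [NeZero K] {G : SimpleGraph (Fin n)} {r : Fin n}

theorem chooseState_spec (hr : (r : ℕ) = 0) (hord : SearchOrder G r ch pa (n - 1)) (hα : 0 < α)
    {ψ : Fin n → Fin K → ℝ} (hψ : ∀ v i, 0 < ψ v i) {s : State} (hs : Ready α η ch pa ψ s)
    (c : Fin n) :
    Ready α η ch pa ψ (treeHedge.chooseState s c) ∧ (treeHedge.chooseState s c).nat 5 0 0 = c ∧
      (treeHedge.chooseState s c).nat 6 0 0 =
        sample (marginal (treeWeight α ch pa (n - 1)) ψ c) (s.seed 0) ∧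
      (∀ a : Fin K, (treeHedge.chooseState s c).real 3 0 a =
        marginal (treeWeight α ch pa (n - 1)) ψ c a) ∧
      (treeHedge.chooseState s c).real 7 0 0 =
        ∑ a, marginal (treeWeight α ch pa (n - 1)) ψ c a ∧
      (treeHedge.chooseState s c).seed = fun k => s.seed (k + 1) := by
  have hwt : ∀ x : Fin n → Fin K, 0 < treeWeight α ch pa (n - 1) x := fun x =>
    Finset.prod_pos fun e _ => by split_ifs <;> positivity
  have hZpos := marginal_pos hwt hψ c
  have hn : n - 1 + 1 = Fintype.card (Fin n) := by
    have := r.2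
    rw [Fintype.card_fin]
    omega
  set Z := marginal (treeWeight α ch pa (n - 1)) ψ c with hZ
  set s₀ := s.writeNat 5 0 0 c with hs₀
  have hn₀ : ∀ a, a ≠ 5 → s₀.nat a = s.nat a := fun a ha => by simp [hs₀, State.writeNat, ha]
  have e5 : s₀.nat 5 0 0 = c := by simp [hs₀, State.writeNat]
  have hready : Ready α η ch pa ψ s₀ := hs.congr (by
    intro a ha
    simp only [List.mem_cons, List.not_mem_nil, or_false] at ha
    exact hn₀ a (by omega)) fun _ _ => rfl
  have hmarg := marginalsCmd_spec hready.vertices hready.arms hready.weights hready.cut hready.child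
    hready.parent e5 hr
  simp only [treeMarginal_eq_marginal α hord hn ψ c, ← hZ] at hmarg
  have n₁ : ∀ a, a ≠ 12 → a ≠ 13 → a ≠ 14 → (marginalsCmd.exec s₀).nat a = s₀.nat a :=
    fun a h₁ h₂ h₃ => Cmd.exec_nat_of_notMem _ (by
      simp [marginalsCmd, clampCmd, elimCmd, elimStepCmd, sumRow, setRealCell, Cmd.natWrites, h₁, h₂,
        h₃]) _
  set s₁ := marginalsCmd.exec s₀ with hs₁
  have hsum := sumRow_spec (x := 12) (a := 7) (b := 3) (s := s₁) (row := .lit 0) (v := 0)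
    (by decide) (show _ = K by rw [n₁ _ (by decide) (by decide) (by decide), hready.arms])
    fun _ _ => rfl
  rw [Finset.sum_range, Finset.sum_congr rfl fun a _ => hmarg a] at hsum
  have n₂ : ∀ a, a ≠ 12 → ((sumRow 12 7 3 (.lit 0)).exec s₁).nat a = s₁.nat a :=
    fun a h₁ => Cmd.exec_nat_of_notMem _ (by simp [sumRow, setRealCell, Cmd.natWrites, h₁]) _
  have r₂ : ∀ a, a ≠ 7 → ((sumRow 12 7 3 (.lit 0)).exec s₁).real a = s₁.real a :=
    fun a h₁ => Cmd.exec_real_of_notMem _ (by simp [sumRow, setRealCell, Cmd.realWrites, h₁]) _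
  set s₂ := (sumRow 12 7 3 (.lit 0)).exec s₁ with hs₂
  have seed₂ : s₂.seed = s.seed := by
    rw [hs₂, Cmd.exec_seed _ (by simp [sumRow, setRealCell, Cmd.DrawFree]), hs₁, Cmd.exec_seed _ (by
      simp [marginalsCmd, clampCmd, elimCmd, elimStepCmd, sumRow, setRealCell, Cmd.DrawFree])]
    rfl
  have hZ₂ : ∀ a : Fin K, s₂.real 3 0 a = Z a := fun a => by rw [r₂ _ (by decide), hmarg]
  have hsample := sampleCmd_spec (s := s₂) (by
    rw [n₂ _ (by decide), n₁ _ (by decide) (by decide) (by decide), hready.arms]) hZ₂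
    (fun a => (hZpos a).le) hsum
  have n₃ : ∀ a, a ≠ 6 → a ≠ 12 → (sampleCmd.exec s₂).nat a = s₂.nat a :=
    fun a h₁ h₂ => Cmd.exec_nat_of_notMem _ (by
      simp [sampleCmd, setRealCell, setNatCell, Cmd.natWrites, h₁, h₂]) _
  have r₃ : ∀ a, a ≠ 8 → a ≠ 9 → (sampleCmd.exec s₂).real a = s₂.real a :=
    fun a h₁ h₂ => Cmd.exec_real_of_notMem _ (by
      simp [sampleCmd, setRealCell, setNatCell, Cmd.realWrites, h₁, h₂]) _
  have r₁ : ∀ a ∈ [1, 4, 5], s₁.real a = s₀.real a := fun a ha =>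
    Cmd.exec_real_of_notMem _ (by
      simp only [List.mem_cons, List.not_mem_nil, or_false] at ha
      rcases ha with rfl | rfl | rfl <;> decide) _
  have hfinal : treeHedge.chooseState s c = sampleCmd.exec s₂ := rfl
  rw [hfinal]
  refine ⟨hready.congr (fun a ha => ?_) (fun a ha => ?_), ?_, ?_, fun a => ?_, ?_, ?_⟩
  · simp only [List.mem_cons, List.not_mem_nil, or_false] at ha
    rw [n₃ a (by omega) (by omega), n₂ a (by omega), n₁ a (by omega) (by omega) (by omega)]
  · have ha' := ha
    simp only [List.mem_cons, List.not_mem_nil, or_false] at ha'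
    rw [r₃ a (by omega) (by omega), r₂ a (by omega), r₁ a ha]
  · rw [n₃ 5 (by decide) (by decide), n₂ 5 (by decide), n₁ 5 (by decide) (by decide) (by decide), e5]
  · rw [hsample, seed₂]
  · rw [r₃ 3 (by decide) (by decide), hZ₂]
  · rw [r₃ 7 (by decide) (by decide), hsum]
  · rw [sampleCmd_seed, seed₂]

/-- Simulation of the idealised process by the machine. Exactly one random number is drawn per
round, so after `t` rounds the unread stream starts at `ω t`. -/
theorem play_spec (hr : (r : ℕ) = 0) (hord : SearchOrder G r ch pa (n - 1)) (hα : 0 < α)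
    (hη : 0 ≤ η) {T f : ℕ} {ω : ℕ → unitInterval}
    (hs : Ready α η ch pa (fun (_ : Fin n) (_ : Fin K) => 1)
      (treeHedge.prepare.exec (initialState G K T f ω)))
    (hseed : (treeHedge.prepare.exec (initialState G K T f ω)).seed = ω) (adv : Adversary n K)
    (X : ℕ → Fin n → Fin K → unitInterval) (t : ℕ) :
    Ready α η ch pa (hedgeRun (marginal (treeWeight α ch pa (n - 1))) η adv (X, ω) t).1
      (treeHedge.play G T f adv X ω t).1 ∧
    (treeHedge.play G T f adv X ω t).1.seed = (fun k => ω (t + k)) ∧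
    (treeHedge.play G T f adv X ω t).2 =
      (hedgeRun (marginal (treeWeight α ch pa (n - 1))) η adv (X, ω) t).2 := by
  have hwt : ∀ x : Fin n → Fin K, 0 < treeWeight α ch pa (n - 1) x := fun x =>
    Finset.prod_pos fun e _ => by split_ifs <;> positivity
  induction t with
  | zero => exact ⟨hs, by simpa [Algorithm.play] using hseed, rfl⟩
  | succ t ih =>
    obtain ⟨h₁, h₂, h₃⟩ := ih
    have hψ : ∀ v i, 0 < (hedgeRun (marginal (treeWeight α ch pa (n - 1))) η adv (X, ω) t).1 v i :=
      fun v i => by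
        obtain ⟨⟨b, hb, h⟩, -⟩ := exists_hedgeRun_bound hwt hη adv t
        exact hb.trans_le (h _ v i)
    have hchoose := chooseState_spec hr hord hα hψ h₁ (adv t (treeHedge.play G T f adv X ω t).2)
    simp only [Algorithm.play, hedgeRun]
    rw [h₂, h₃] at *
    obtain ⟨g₁, g₂, g₃, g₄, g₅, g₆⟩ := hchoose
    have harm : chosenArm K (treeHedge.chooseState (treeHedge.play G T f adv X ω t).1
        (adv t (hedgeRun (marginal (treeWeight α ch pa (n - 1))) η adv (X, ω) t).2)) =
        sample (marginal (treeWeight α ch pa (n - 1))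
          (hedgeRun (marginal (treeWeight α ch pa (n - 1))) η adv (X, ω) t).1
          (adv t (hedgeRun (marginal (treeWeight α ch pa (n - 1))) η adv (X, ω) t).2)) (ω t) := by
      rw [chosenArm, g₃, Fin.ofNat_val_eq_self]
      rfl
    rw [harm]
    refine ⟨update_spec g₁ g₂ g₃ g₄ g₅ _, ?_, rfl⟩
    rw [Cmd.exec_seed _ (by simp [treeHedge, Cmd.DrawFree])]
    change State.seed (treeHedge.chooseState _ _) = _
    rw [g₆]
    funext k
    exact congrArg ω (show t + (k + 1) = t + 1 + k by omega)

end Play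

/-! ### Running time -/

/-- All loop bounds are computed from the input cells in arrays `0`, `1`, `2`, which the program
never writes, so every loop runs at most `n + K + T` times. The extra step per round is the single
assignment of `update`. -/
theorem play_steps_le {n K : ℕ} [NeZero K] (G : SimpleGraph (Fin n)) (T f : ℕ) (adv : Adversary n K)
    (X : ℕ → Fin n → Fin K → unitInterval) (ω : ℕ → unitInterval) (t : ℕ) :
    (∀ a ∈ [0, 1, 2], (treeHedge.play G T f adv X ω t).1.nat a = (initialState G K T f ω).nat a) ∧
    (treeHedge.play G T f adv X ω t).1.steps ≤
      treeHedge.prepare.size * (n + K + T + 1) ^ treeHedge.prepare.size +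
        t * (treeHedge.choose.size * (n + K + T + 1) ^ treeHedge.choose.size + 1) := by
  have bound : ∀ b ∈ treeHedge.prepare.loopBounds ++ treeHedge.choose.loopBounds, ∀ s : State,
      (∀ a ∈ [0, 1, 2], s.nat a = (initialState G K T f ω).nat a) → b.eval s ≤ n + K + T := by
    intro b hb s hs
    have e₀ : s.nat 0 0 0 = n := by simp [hs 0, initialState]
    have e₁ : s.nat 1 0 0 = K := by simp [hs 1, initialState]
    have e₂ : s.nat 2 0 0 = T := by simp [hs 2, initialState]
    simp only [treeHedge, graphSearch, findEdge, setNatCell, setRealCell, initWeights, initRate,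
      initCut, marginalsCmd, clampCmd, elimCmd, elimStepCmd, sumRow, sampleCmd, Cmd.loopBounds,
      List.mem_append, List.mem_cons, List.not_mem_nil, or_false, false_or] at hb
    have hb' : b = .sub (natCell 0) (.lit 1) ∨ b = natCell 0 ∨ b = natCell 1 ∨
        b = .add (natCell 2) (natCell 1) := by tauto
    rcases hb' with rfl | rfl | rfl | rfl <;>
    simp only [natCell, NatExpr.eval, e₀, e₁, e₂] <;> omega
  have write₁ : ∀ a ∈ [0, 1, 2], a ∉ treeHedge.prepare.natWrites := by decide
  have write₂ : ∀ a ∈ [0, 1, 2], a ∉ treeHedge.choose.natWrites := by decide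
  induction t with
  | zero =>
    refine ⟨fun a ha => Cmd.exec_nat_of_notMem _ (write₁ a ha) _, ?_⟩
    have := Cmd.exec_steps_le treeHedge.prepare write₁
      (fun b hb => bound b (List.mem_append_left _ hb)) (initialState G K T f ω) fun _ _ => rfl
    simpa [Algorithm.play, initialState] using this
  | succ t ih =>
    set s := (treeHedge.play G T f adv X ω t).1
    set c := adv t (treeHedge.play G T f adv X ω t).2
    have h₅ : ∀ a ∈ [0, 1, 2], (s.writeNat 5 0 0 c).nat a = (initialState G K T f ω).nat a := by
      intro a ha
      rw [← ih.1 a ha]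
      have : a ≠ 5 := by
        simp only [List.mem_cons, List.not_mem_nil, or_false] at ha
        omega
      simp [State.writeNat, this, s]
    have h := Cmd.exec_steps_le treeHedge.choose write₂
      (fun b hb => bound b (List.mem_append_right _ hb)) (s.writeNat 5 0 0 c) h₅
    have hnat : (treeHedge.play G T f adv X ω (t + 1)).1.nat =
        (treeHedge.choose.exec (s.writeNat 5 0 0 c)).nat := rfl
    have hsteps : (treeHedge.play G T f adv X ω (t + 1)).1.steps =
        (treeHedge.choose.exec (s.writeNat 5 0 0 c)).steps + 1 := rfl
    have hs : (s.writeNat 5 0 0 c).steps = s.steps := rfl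
    refine ⟨fun a ha => ?_, ?_⟩
    · rw [hnat, Cmd.exec_nat_of_notMem _ (write₂ a ha), h₅ a ha]
    · rw [hsteps, add_mul, one_mul]
      have := ih.2
      omega

theorem runningTime_le {n K : ℕ} [NeZero K] (G : SimpleGraph (Fin n)) (T f : ℕ)
    (adv : Adversary n K) (X : ℕ → Fin n → Fin K → unitInterval) (ω : ℕ → unitInterval) :
    treeHedge.runningTime G T f adv X ω ≤
      ((treeHedge.prepare.size + treeHedge.choose.size + 1) *
        2 ^ (treeHedge.prepare.size + treeHedge.choose.size + 1)) *
        (n + K + T) ^ (treeHedge.prepare.size + treeHedge.choose.size + 1) := by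
  have h := (play_steps_le G T f adv X ω T).2
  rw [Algorithm.runningTime]
  generalize treeHedge.prepare.size = a at *
  generalize treeHedge.choose.size = b at *
  have hK : 1 ≤ K := Nat.pos_of_neZero K
  set M := n + K + T with hM
  have p₁ : (M + 1) ^ a ≤ (M + 1) ^ (a + b + 1) := Nat.pow_le_pow_right (by omega) (by omega)
  have p₂ : (M + 1) ^ (b + 1) ≤ (M + 1) ^ (a + b + 1) := Nat.pow_le_pow_right (by omega) (by omega)
  have p₃ : (M + 1) ^ 1 ≤ (M + 1) ^ (a + b + 1) := Nat.pow_le_pow_right (by omega) (by omega)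
  -- `M ≥ K ≥ 1` gives `M + 1 ≤ 2 * M`.
  have p₄ : (M + 1) ^ (a + b + 1) ≤ (2 * M) ^ (a + b + 1) := Nat.pow_le_pow_left (by omega) _
  calc _ ≤ a * (M + 1) ^ a + T * (b * (M + 1) ^ b + 1) := h
    _ ≤ a * (M + 1) ^ a + (M + 1) * (b * (M + 1) ^ b + 1) := by gcongr; omega
    _ = a * (M + 1) ^ a + b * (M + 1) ^ (b + 1) + (M + 1) ^ 1 := by ring
    _ ≤ a * (M + 1) ^ (a + b + 1) + b * (M + 1) ^ (a + b + 1) + (M + 1) ^ (a + b + 1) := by gcongr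
    _ = (a + b + 1) * (M + 1) ^ (a + b + 1) := by ring
    _ ≤ (a + b + 1) * (2 * M) ^ (a + b + 1) := by gcongr
    _ = _ := by rw [mul_pow, mul_assoc]

/-! ### The prior -/

section Prior

variable {V : Type*} [DecidableEq V] [Fintype V] {K : ℕ}

/-- Summing out the label of the last child gives `1 + (K - 1) * α`, whatever the label of its
parent. -/
theorem sum_treeWeight (α : ℝ) {G : SimpleGraph V} {r : V} {ch pa : ℕ → V} {m : ℕ}
    (h : SearchOrder G r ch pa m) :
    (K : ℝ) ^ m * ∑ x : V → Fin K, treeWeight α ch pa m x =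
      (K : ℝ) ^ Fintype.card V * (1 + (K - 1) * α) ^ m := by
  induction m with
  | zero => simp [treeWeight]
  | succ m ih =>
    have hv := h.notMem_remaining
    have hp : pa m ∈ remaining r ch m := h.parent_mem (by omega) le_rfl
    have ne : ∀ w ∈ remaining r ch m, w ≠ ch m := fun w hw h' => hv (h' ▸ hw)
    have hupd : ∀ (x : V → Fin K) i, treeWeight α ch pa (m + 1) (Function.update x (ch m) i) =
        treeWeight α ch pa m x * if i = x (pa m) then 1 else α := by
      intro x i
      rw [treeWeight, Finset.prod_range_succ, treeWeight, Function.update_self,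
        Function.update_of_ne (ne _ hp)]
      congr 1
      refine Finset.prod_congr rfl fun e he => ?_
      have he := Finset.mem_range.1 he
      rw [Function.update_of_ne (h.ne_of_lt m (by omega) e he),
        Function.update_of_ne (ne _ (h.parent_mem (by omega) he.le))]
    have hsum : ∀ x : V → Fin K, ∑ i, (if i = x (pa m) then 1 else α) = 1 + (K - 1) * α := by
      intro x
      have : ∀ i, (if i = x (pa m) then 1 else α) = α + if i = x (pa m) then 1 - α else 0 := by
        intro i
        split_ifs <;> ring
      simp only [this, Finset.sum_add_distrib, Finset.sum_const, Finset.card_univ, Fintype.card_fin,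
        nsmul_eq_mul, Finset.sum_ite_eq', Finset.mem_univ, if_true]
      ring
    rw [pow_succ, mul_assoc, ← sum_sum_update (ch m)]
    simp only [hupd, ← Finset.mul_sum, hsum]
    rw [← Finset.sum_mul, ← mul_assoc, ih h.of_succ]
    ring

/-- A tree edge that `π` cuts has endpoints with different `y`, so it is a cut edge of `G`;
different indices give different edges. As `α ≤ 1`, fewer cuts mean a larger weight. -/
theorem pow_cutsize_le_treeWeight {n : ℕ} {L : Type*} {G : SimpleGraph (Fin n)} {r : Fin n} {α : ℝ}
    (hα : 0 < α) (hα₁ : α ≤ 1) {ch pa : ℕ → Fin n} {m f : ℕ} (h : SearchOrder G r ch pa m)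
    {y : Fin n → L} (hy : cutsize G y ≤ f) {π : Fin n → Fin K}
    (hπ : ∀ c c', y c = y c' → π c = π c') : α ^ f ≤ treeWeight α ch pa m π := by
  classical
  rw [treeWeight, Finset.prod_ite, Finset.prod_const_one, one_mul, Finset.prod_const]
  refine pow_le_pow_of_le_one hα.le hα₁ (le_trans ?_ hy)
  rw [cutsize, ← Set.ncard_coe_finset]
  refine Set.ncard_le_ncard_of_injOn (fun e => s(ch e, pa e)) ?_ ?_ (Set.toFinite _)
  · intro e he
    simp only [Finset.coe_filter, Finset.mem_range, Set.mem_ofPred_eq] at he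
    exact ⟨ch e, pa e, rfl, (h.adj e he.1).symm, fun h' => he.2 (hπ _ _ h')⟩
  -- If `e < e'`, then `ch e'` differs from `ch e` and from `pa e`, which is the root or was listed
  -- even before `ch e`.
  · have key : ∀ e < m, ∀ e' < m, e < e' → s(ch e, pa e) ≠ s(ch e', pa e') := by
      intro e he e' he' hlt heq
      have hmem : ch e' ∈ s(ch e, pa e) := heq ▸ Sym2.mem_mk_left _ _
      rcases Sym2.mem_iff.1 hmem with h' | h'
      · exact h.ne_of_lt e' he' e hlt h'.symm
      · rcases h.parent e he with hr | ⟨e'', h₁, h₂⟩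
        · exact h.ne_root e' he' (h'.trans hr)
        · exact h.ne_of_lt e' he' e'' (h₁.trans hlt) (h₂.trans h'.symm)
    intro e he e' he' heq
    simp only [Finset.coe_filter, Finset.mem_range, Set.mem_ofPred_eq] at he he'
    rcases lt_trichotomy e e' with hlt | heq' | hlt
    · exact (key e he.1 e' he'.1 hlt heq).elim
    · exact heq'
    · exact (key e' he'.1 e he.1 hlt heq.symm).elim

end Prior

/-- The value `α = 1 / (n * K)` balances two demands: `(K - 1) * α ≤ 1 / n` keeps the total prior
weight below `e * K`, and each cut edge costs only `log (n * K)`. -/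
theorem log_sum_div_le {n K f : ℕ} [NeZero K] {L : Type*} {G : SimpleGraph (Fin n)} {r : Fin n}
    {ch pa : ℕ → Fin n} (h : SearchOrder G r ch pa (n - 1)) {y : Fin n → L} (hy : cutsize G y ≤ f)
    {π : Fin n → Fin K} (hπ : ∀ c c', y c = y c' → π c = π c') :
    Real.log ((∑ x, treeWeight (K := K) (1 / ((n : ℝ) * K)) ch pa (n - 1) x) /
      treeWeight (1 / ((n : ℝ) * K)) ch pa (n - 1) π) ≤
      Real.log K + 1 + f * (Real.log n + Real.log K) := by
  have hn : 1 ≤ n := Nat.one_le_of_lt r.2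
  have hK : 1 ≤ K := Nat.pos_of_neZero K
  have hn' : (1 : ℝ) ≤ n := by exact_mod_cast hn
  have hK' : (1 : ℝ) ≤ K := by exact_mod_cast hK
  set α := 1 / ((n : ℝ) * K) with hα
  have hnK : 1 ≤ (n : ℝ) * K := one_le_mul_of_one_le_of_one_le hn' hK'
  have hα₀ : 0 < α := by positivity
  have hα₁ : α ≤ 1 := (div_le_one (by positivity)).2 hnK
  have hsum : ∑ x : Fin n → Fin K, treeWeight α ch pa (n - 1) x =
      K * (1 + (K - 1) * α) ^ (n - 1) := by
    have := sum_treeWeight (K := K) α h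
    rw [Fintype.card_fin] at this
    have e : (K : ℝ) ^ n = K ^ (n - 1) * K := by
      rw [← pow_succ]
      congr 1
      omega
    rw [e, mul_assoc] at this
    exact mul_left_cancel₀ (by positivity) this
  have hbase : 1 + ((K : ℝ) - 1) * α ≤ Real.exp (1 / n) := by
    have : ((K : ℝ) - 1) * α ≤ 1 / n := by
      rw [hα, mul_one_div, div_le_div_iff₀ (by positivity) (by positivity)]
      nlinarith
    linarith [Real.add_one_le_exp (1 / (n : ℝ))]
  have hbase₁ : 1 ≤ 1 + ((K : ℝ) - 1) * α := by
    have : 0 ≤ ((K : ℝ) - 1) * α := mul_nonneg (by linarith) hα₀.le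
    linarith
  have hpow : (1 + ((K : ℝ) - 1) * α) ^ (n - 1) ≤ Real.exp 1 := by
    calc (1 + ((K : ℝ) - 1) * α) ^ (n - 1) ≤ (1 + ((K : ℝ) - 1) * α) ^ n :=
          pow_le_pow_right₀ hbase₁ (Nat.sub_le n 1)
      _ ≤ Real.exp (1 / n) ^ n := pow_le_pow_left₀ (by linarith) hbase n
      _ = Real.exp 1 := by
        rw [← Real.exp_nat_mul]
        congr 1
        field_simp
  have hwt := pow_cutsize_le_treeWeight hα₀ hα₁ h hy hπ
  have hwtpos : 0 < α ^ f := by positivity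
  have hW : 0 < (K : ℝ) * (1 + (K - 1) * α) ^ (n - 1) := by positivity
  rw [hsum, Real.log_div hW.ne' (hwtpos.trans_le hwt).ne']
  have h₁ : Real.log ((K : ℝ) * (1 + (K - 1) * α) ^ (n - 1)) ≤ Real.log K + 1 := by
    rw [Real.log_mul (by positivity) (by positivity)]
    have := Real.log_le_log (by positivity) hpow
    rw [Real.log_exp] at this
    linarith
  have h₂ : -(f * (Real.log n + Real.log K)) ≤ Real.log (treeWeight α ch pa (n - 1) π) := by
    have hlog : Real.log α = -(Real.log n + Real.log K) := by
      rw [hα, one_div, Real.log_inv, Real.log_mul (by positivity) (by positivity)]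
    have := Real.log_le_log hwtpos hwt
    rw [Real.log_pow, hlog] at this
    linarith
  linarith

/-! ### The regret bound -/

theorem regret_rate_pow_three (T K f : ℕ) :
    ((T : ℝ) ^ (2 / 3 : ℝ) * (K : ℝ) ^ (1 / 3 : ℝ) * (f : ℝ) ^ (1 / 3 : ℝ)) ^ 3 =
      (T : ℝ) ^ 2 * K * f := by
  rw [mul_pow, mul_pow, ← Real.rpow_natCast, ← Real.rpow_natCast, ← Real.rpow_natCast,
    ← Real.rpow_mul (by positivity), ← Real.rpow_mul (by positivity),
    ← Real.rpow_mul (by positivity)]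
  norm_num

/-- After cubing, the claim is `T ^ 3 ≤ T ^ 2 * K * f`. In this regime the trivial regret bound `T`
suffices. -/
theorem le_regret_rate_of_lt {T K f : ℕ} (h : T < K * f) :
    (T : ℝ) ≤ (T : ℝ) ^ (2 / 3 : ℝ) * (K : ℝ) ^ (1 / 3 : ℝ) * (f : ℝ) ^ (1 / 3 : ℝ) := by
  refine le_of_pow_le_pow_left₀ (n := 3) (by norm_num) (by positivity) ?_
  rw [regret_rate_pow_three]
  have : (T : ℝ) ≤ K * f := by exact_mod_cast h.le
  nlinarith [mul_le_mul_of_nonneg_left this (sq_nonneg (T : ℝ))]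

/-- The sixth powers are `(T * K * f) ^ 3` and `(T ^ 2 * K * f) ^ 2`; the missing inequality is `K *
f ≤ T`. -/
theorem sqrt_le_regret_rate {T K f : ℕ} (h : K * f ≤ T) :
    √((T : ℝ) * K * f) ≤
      (T : ℝ) ^ (2 / 3 : ℝ) * (K : ℝ) ^ (1 / 3 : ℝ) * (f : ℝ) ^ (1 / 3 : ℝ) := by
  refine le_of_pow_le_pow_left₀ (n := 6) (by norm_num) (by positivity) ?_
  have e₁ : √((T : ℝ) * K * f) ^ 6 = ((T : ℝ) * K * f) ^ 3 := by
    rw [show 6 = 2 * 3 by norm_num, pow_mul, Real.sq_sqrt (by positivity)]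
  have e₂ : ((T : ℝ) ^ (2 / 3 : ℝ) * (K : ℝ) ^ (1 / 3 : ℝ) * (f : ℝ) ^ (1 / 3 : ℝ)) ^ 6 =
      ((T : ℝ) ^ 2 * K * f) ^ 2 := by
    rw [show 6 = 3 * 2 by norm_num, pow_mul, regret_rate_pow_three]
  rw [e₁, e₂]
  have h' : (K : ℝ) * f ≤ T := by exact_mod_cast h
  have := mul_le_mul_of_nonneg_left h' (by positivity : 0 ≤ (T : ℝ) ^ 3 * (K * f) ^ 2)
  calc ((T : ℝ) * K * f) ^ 3 = (T : ℝ) ^ 3 * (K * f) ^ 2 * (K * f) := by ring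
    _ ≤ (T : ℝ) ^ 3 * (K * f) ^ 2 * T := this
    _ = _ := by ring

theorem one_le_log {n T : ℕ} (hn : 1 ≤ n) : 1 ≤ Real.log (n + T + 2) := by
  rw [Real.le_log_iff_exp_le (by positivity)]
  have h₁ : (1 : ℝ) ≤ n := by exact_mod_cast hn
  have h₂ : (0 : ℝ) ≤ T := Nat.cast_nonneg T
  linarith [Real.exp_one_lt_d9]

/-- The constant is `9 = 4 * 2 + 1`. The prior costs at most `4 * f * L`, and `f * m ≤ 2 * u`
because both `(m - 1) * f` and `f` are at most `u`; the second term is `T * K / m ≤ u`. -/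
theorem hedge_bound_le {n K T f m : ℕ} (hn : 1 ≤ n) (hK : 1 ≤ K) (hf : 1 ≤ f) (hT : K * f ≤ T)
    (hm₁ : T * K ≤ m ^ 2 * f) (hm₂ : (m - 1) ^ 2 * f < T * K) (hm : 1 ≤ m) :
    (Real.log K + 1 + f * (Real.log n + Real.log K)) / (1 / m) + T * (1 / m * K) ≤
      9 * √((T : ℝ) * K * f) * Real.log (n + T + 2) := by
  have hLog := one_le_log (T := T) hn
  set L := Real.log (n + T + 2)
  set u := √((T : ℝ) * K * f) with hu
  have hu₀ : 0 ≤ u := Real.sqrt_nonneg _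
  have husq : u ^ 2 = (T : ℝ) * K * f := Real.sq_sqrt (by positivity)
  have hn' : (1 : ℝ) ≤ n := by exact_mod_cast hn
  have hK' : (1 : ℝ) ≤ K := by exact_mod_cast hK
  have hf' : (1 : ℝ) ≤ f := by exact_mod_cast hf
  have hm' : (1 : ℝ) ≤ m := by exact_mod_cast hm
  have hT' : (K : ℝ) * f ≤ T := by exact_mod_cast hT
  have hKT : (K : ℝ) ≤ T := by nlinarith
  have hlogK : Real.log K ≤ L := Real.log_le_log (by linarith) (by linarith)
  have hlogn : Real.log n ≤ L := Real.log_le_log (by linarith) (by linarith)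
  have hm₁' : (T : ℝ) * K ≤ m ^ 2 * f := by exact_mod_cast hm₁
  have hm₂' : ((m : ℝ) - 1) ^ 2 * f ≤ T * K := by
    have : (((m - 1 : ℕ) : ℝ)) ^ 2 * f ≤ T * K := by exact_mod_cast hm₂.le
    rwa [Nat.cast_sub hm, Nat.cast_one] at this
  have hF : Real.log K + 1 + f * (Real.log n + Real.log K) ≤ 4 * f * L := by
    have h₁ : (f : ℝ) * (Real.log n + Real.log K) ≤ f * (L + L) := by gcongr
    have h₂ : L ≤ f * L := le_mul_of_one_le_left (by linarith) hf'
    linarith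
  have hfm : ((m : ℝ) - 1) * f ≤ u := by
    refine le_of_pow_le_pow_left₀ (n := 2) (by norm_num) hu₀ ?_
    rw [husq]
    nlinarith [mul_le_mul_of_nonneg_right hm₂' (by linarith : (0 : ℝ) ≤ f)]
  have hfu : (f : ℝ) ≤ u := by
    refine le_of_pow_le_pow_left₀ (n := 2) (by norm_num) hu₀ ?_
    rw [husq]
    have h₁ : (f : ℝ) ≤ T * K := by nlinarith
    nlinarith [mul_le_mul_of_nonneg_right h₁ (by linarith : (0 : ℝ) ≤ f)]
  have hTKm : (T : ℝ) * K / m ≤ u := by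
    refine le_of_pow_le_pow_left₀ (n := 2) (by norm_num) hu₀ ?_
    rw [husq, div_pow, div_le_iff₀ (by positivity)]
    nlinarith [mul_le_mul_of_nonneg_left hm₁' (by positivity : (0 : ℝ) ≤ T * K)]
  have e : (T : ℝ) * (1 / m * K) = T * K / m := by ring
  rw [div_div_eq_mul_div, div_one, e]
  have h₁ : (Real.log K + 1 + f * (Real.log n + Real.log K)) * m ≤ 4 * f * L * m := by gcongr
  have h₂ : (f : ℝ) * m ≤ 2 * u := by linarith
  have h₃ : 4 * (f * m) * L ≤ 4 * (2 * u) * L := by gcongr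
  have h₄ : u ≤ u * L := le_mul_of_one_le_right hu₀ hLog
  linarith

/-- A policy that plays a best arm, and that depends on the reward distributions only. -/
theorem exists_best_policy {n K : ℕ} [NeZero K]
    (ν : Fin n → Fin K → ProbabilityMeasure unitInterval) :
    ∃ π : Fin n → Fin K, (∀ c c', ν c = ν c' → π c = π c') ∧
      ∀ c, ⨆ i, meanReward ν c i = meanReward ν c (π c) := by
  -- The arm is chosen for each tuple of distributions, not for each vertex, so vertices with equal
  -- distributions automatically get equal arms.
  have h : ∀ μ : Fin K → ProbabilityMeasure unitInterval, ∃ i, ∀ j,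
      ∫ r, (r : ℝ) ∂(μ j : Measure unitInterval) ≤ ∫ r, (r : ℝ) ∂(μ i : Measure unitInterval) :=
    fun μ => Finite.exists_max _
  choose best hbest using h
  refine ⟨fun c => best (ν c), fun c c' h => by simp only [h], fun c => ?_⟩
  exact le_antisymm (ciSup_le (hbest (ν c)))
    (le_ciSup (f := meanReward ν c) (Set.finite_range _).bddAbove _)

theorem treeHedge_regret {n K T f : ℕ} [NeZero K] {G : SimpleGraph (Fin n)} (hG : G.Connected)
    (hf : 1 ≤ f) {L : Type*} {y : Fin n → L} (hy : cutsize G y ≤ f)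
    {ν : Fin n → Fin K → ProbabilityMeasure unitInterval} (hν : ∀ c c', y c = y c' → ν c = ν c')
    {adv : Adversary n K} (hadv : ∀ t, Measurable (adv t)) :
    Integrable (fun z => treeHedge.regret G T f adv ν z.1 z.2) (law ν) ∧
    ∫ z, treeHedge.regret G T f adv ν z.1 z.2 ∂(law ν) ≤
      9 * ((T : ℝ) ^ (2 / 3 : ℝ) * (K : ℝ) ^ (1 / 3 : ℝ) * (f : ℝ) ^ (1 / 3 : ℝ)) *
        Real.log (n + T + 2) := by
  have hK : 1 ≤ K := Nat.pos_of_neZero K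
  have hn : 1 ≤ n := by
    obtain ⟨r⟩ := hG.nonempty
    exact Nat.one_le_of_lt r.2
  have hLog := one_le_log (T := T) hn
  -- For `T = 0` one has `m = 0`, and the learning rate `1 / m` would not be positive; the regret is
  -- then an empty sum.
  rcases Nat.eq_zero_or_pos T with rfl | hTpos
  · simp only [Algorithm.regret, Finset.range_zero, Finset.sum_empty, integral_zero]
    exact ⟨integrable_const _, by positivity⟩
  obtain ⟨π, hπ, hbest⟩ := exists_best_policy ν
  obtain ⟨ch, pa, m, hord, hm₁, hm₂, hprep⟩ := prepare_spec hG (r := ⟨0, hn⟩) rfl K T f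
  have hm₁ := hm₁ hf
  have hm : 1 ≤ m := by
    by_contra h
    have : m = 0 := by omega
    subst this
    have := Nat.mul_pos hTpos hK
    simp at hm₁
    omega
  have hm₂ := hm₂ hm
  have hα : 0 < 1 / ((n : ℝ) * K) := by
    have : (0 : ℝ) < n := by exact_mod_cast hn
    have : (0 : ℝ) < K := by exact_mod_cast hK
    positivity
  have hη : 0 < 1 / (m : ℝ) := by
    have : (0 : ℝ) < m := by exact_mod_cast hm
    positivity
  set α := 1 / ((n : ℝ) * K)
  set η := 1 / (m : ℝ)
  set Z := marginal (K := K) (treeWeight α ch pa (n - 1))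
  have hwt : ∀ x : Fin n → Fin K, 0 < treeWeight α ch pa (n - 1) x := fun x =>
    Finset.prod_pos fun e _ => by split_ifs <;> positivity
  have hregret : ∀ z : (ℕ → Fin n → Fin K → unitInterval) × (ℕ → unitInterval),
      treeHedge.regret G T f adv ν z.1 z.2 = ∑ t ∈ Finset.range T,
        (meanReward ν (hedgeContext Z η adv t z) (π (hedgeContext Z η adv t z)) -
          meanReward ν (hedgeContext Z η adv t z) (hedgeArm Z η adv t z)) := by
    intro z
    refine Finset.sum_congr rfl fun t _ => ?_
    obtain ⟨h₁, h₂, h₃⟩ := play_spec rfl hord hα hη.le (hprep z.2).1 (hprep z.2).2 adv z.1 t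
    have hc : treeHedge.contextAt G T f adv z.1 z.2 t = hedgeContext Z η adv t z := by
      rw [Algorithm.contextAt, h₃]
      rfl
    have hψ : ∀ v i, 0 < (hedgeRun Z η adv z t).1 v i := fun v i => by
      obtain ⟨⟨b, hb, h⟩, -⟩ := exists_hedgeRun_bound hwt hη.le adv t
      exact hb.trans_le (h _ v i)
    have ha : treeHedge.armAt G T f adv z.1 z.2 t = hedgeArm Z η adv t z := by
      rw [Algorithm.armAt, hc, chosenArm,
        (chooseState_spec rfl hord hα hψ h₁ (hedgeContext Z η adv t z)).2.2.1,
        Fin.ofNat_val_eq_self, h₂]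
      rfl
    rw [hc, ha, hbest]
  simp only [hregret]
  obtain ⟨hint, hle⟩ := hedge_regret ν hadv hwt hη π T
  refine ⟨hint, ?_⟩
  -- If `T < K * f`, regret at most `1` per round is enough; otherwise the bound of exponential
  -- weights applies.
  rcases lt_or_ge T (K * f) with hlt | hge
  · have h₁ := le_regret_rate_of_lt hlt
    set R := (T : ℝ) ^ (2 / 3 : ℝ) * (K : ℝ) ^ (1 / 3 : ℝ) * (f : ℝ) ^ (1 / 3 : ℝ)
    have hR : 0 ≤ R := by positivity
    have h₂ : R ≤ R * Real.log (n + T + 2) := le_mul_of_one_le_right hR hLog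
    refine le_trans (integral_mono hint (integrable_const (T : ℝ)) fun z => ?_) ?_
    · refine (Finset.sum_le_card_nsmul _ _ 1 fun t _ => ?_).trans (by simp)
      linarith [(meanReward_mem ν (hedgeContext Z η adv t z) (π (hedgeContext Z η adv t z))).2,
        (meanReward_mem ν (hedgeContext Z η adv t z) (hedgeArm Z η adv t z)).1]
    · rw [integral_const, probReal_univ, one_smul]
      linarith
  · refine hle.trans ?_
    have h₁ := log_sum_div_le hord hy (π := π) fun c c' h => hπ c c' (hν c c' h)
    have h₂ := div_le_div_of_nonneg_right h₁ hη.le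
    have h₃ := hedge_bound_le hn hK hf hge hm₁ hm₂ hm
    have h₄ := sqrt_le_regret_rate hge
    refine (add_le_add h₂ le_rfl).trans (h₃.trans ?_)
    gcongr

end GraphBandit

/-- There is one randomized program, running in polynomial time, whose pseudo-regret on every tree
(in particular on every path) with at most `f` cut edges, `f ≥ 1`, is
`Õ(T ^ (2/3) * K ^ (1/3) * f ^ (1/3))`, against every adaptive choice of the contexts. -/
theorem theorem1 :
    ∃ (A : GraphBandit.Algorithm) (C : ℕ) (p : ℕ),
      ∀ (n K T f : ℕ) [NeZero K] (G : SimpleGraph (Fin n)), G.IsTree → 1 ≤ f →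
        (∀ (adv : GraphBandit.Adversary n K) (X : ℕ → Fin n → Fin K → unitInterval)
            (ω : ℕ → unitInterval),
          A.runningTime G T f adv X ω ≤ C * (n + K + T) ^ p) ∧
        ∀ (L : Type*) (y : Fin n → L), GraphBandit.cutsize G y ≤ f →
          ∀ ν : Fin n → Fin K → MeasureTheory.ProbabilityMeasure unitInterval,
            (∀ c c' : Fin n, y c = y c' → ν c = ν c') →
            ∀ adv : GraphBandit.Adversary n K, (∀ t, Measurable (adv t)) →
              MeasureTheory.Integrable
                (fun z => A.regret G T f adv ν z.1 z.2) (GraphBandit.law ν) ∧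
              ∫ z, A.regret G T f adv ν z.1 z.2 ∂(GraphBandit.law ν) ≤
                (C : ℝ) * (T : ℝ) ^ (2 / 3 : ℝ) * (K : ℝ) ^ (1 / 3 : ℝ) * (f : ℝ) ^ (1 / 3 : ℝ) *
                  Real.log (n + T + 2) ^ p := by
  -- One `q` serves as both exponents: it comes from the running time, and the first power of the
  -- logarithm in the regret may be raised to the power `q` because the logarithm is at least `1`.
  -- The summand `9` in `C` is the constant of the regret bound.
  let q := GraphBandit.treeHedge.prepare.size + GraphBandit.treeHedge.choose.size + 1
  refine ⟨GraphBandit.treeHedge, q * 2 ^ q + 9, q, fun n K T f _ G hG hf =>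
    ⟨fun adv X ω => (GraphBandit.runningTime_le G T f adv X ω).trans
      (Nat.mul_le_mul_right _ (Nat.le_add_right _ _)), fun L y hy ν hν adv hadv => ?_⟩⟩
  obtain ⟨hint, hle⟩ := GraphBandit.treeHedge_regret (T := T) hG.connected hf hy hν hadv
  refine ⟨hint, hle.trans ?_⟩
  have hn : 1 ≤ n := by
    obtain ⟨r⟩ := hG.connected.nonempty
    exact Nat.one_le_of_lt r.2
  have hLog := GraphBandit.one_le_log (T := T) hn
  have hC : (9 : ℝ) ≤ ((q * 2 ^ q + 9 : ℕ) : ℝ) := by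
    exact_mod_cast Nat.le_add_left _ _
  have hpow : Real.log (n + T + 2) ≤ Real.log (n + T + 2) ^ q :=
    le_self_pow₀ hLog (by omega)
  rw [mul_assoc (((q * 2 ^ q + 9 : ℕ) : ℝ) * _), mul_assoc ((q * 2 ^ q + 9 : ℕ) : ℝ),
    ← mul_assoc ((T : ℝ) ^ (2 / 3 : ℝ))]
  gcongr
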